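/- **System.** A decode-and-forward relay with $M$ antennas serves $N$ pairs of single-antenna users $U_{A,i},U_{B,i}$ ($1\le i\le N$). All receiver noises have unit variance. For $X\in\{A,B\}$ the channel of $U_{X,i}$ is $$h_{XR,i}=\sqrt{\beta_{XR,i}}\Big(\sqrt{\tfrac{K_{XR,i}}{K_{XR,i}+1}}\,\bar g_{XR,i}+\sqrt{\tfrac1{K_{XR,i}+1}}\,\tilde g_{XR,i}\Big)\in\mathbb C^M,\qquad \beta_{XR,i}>0,\ K_{XR,i}\ge 0,$$ where the entries of all $\tilde g_{XR,i}$ are independent $\mathcal{CN}(0,1)$, and the line-of-sight vectors $\bar g_{XR,i}$ (which depend on $M$) are deterministic with $\|\bar g_{XR,i}\|^2=M$ and $|\bar g_{XR,i}^H\bar g_{YR,j}|^2=o(M)$ for distinct users $(X,i)\neq(Y,j)$. Let $0<\tau<T$ (training and coherence lengths) and $p_p>0$ (pilot power). From $y_{X,i}=\sqrt{\tau p_p\beta_{XR,i}}\,\tilde g_{XR,i}+w_{X,i}$, with all entries of the $w_{X,i}$ independent $\mathcal{CN}(0,1)$ and independent of the $\tilde g_{XR,i}$, the relay forms the MMSE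 estimate of $\tilde g_{XR,i}$, namely $\frac{\sqrt{\tau p_p\beta_{XR,i}}}{1+\tau p_p\beta_{XR,i}}\,y_{X,i}$. Substituting it for $\tilde g_{XR,i}$ gives the channel estimate $\hat h_{XR,i}$, with error $e_{XR,i}=h_{XR,i}-\hat h_{XR,i}$, whose entries have variance $\sigma_{XR,i}^2=\frac{\beta_{XR,i}}{(1+\tau p_p\beta_{XR,i})(K_{XR,i}+1)}$. The users have transmit powers $p_{X,i}>0$ and the relay has transmit power $p_r>0$. **Exact spectral efficiencies.** Let $\lambda=\frac{T-\tau}{2T}$. Let $A_i=p_{A,i}(|\hat h_{AR,i}^H\hat h_{AR,i}|^2+|\hat h_{BR,i}^H\hat h_{AR,i}|^2)$ and $B_i=p_{B,i}(|\hat h_{AR,i}^H\hat h_{BR,i}|^2+|\hat h_{BR,i}^H\hat h_{BR,i}|^2)$. Let $$C_i=\sum_{X\in\{A,B\}}p_{X,i}\big(|\hat h_{AR,i}^He_{XR,i}|^2+|\hat h_{BR,i}^He_{XR,i}|^2\big),\qquad D_i=\sum_{j\ne i}\sum_{X\in\{A,B\}}p_{X,j}\big(|\hat h_{AR,i}^Hh_{XR,j}|^2+|\hat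 h_{BR,i}^Hh_{XR,j}|^2\big),$$ $E_i=\|\hat h_{AR,i}\|^2+\|\hat h_{BR,i}\|^2$ and $Y_i=C_i+D_i+E_i$. Put $$R_{1,i}=\lambda\,\mathbb E\log_2\Big(1+\frac{A_i+B_i}{Y_i}\Big),\qquad R_{XR,i}=\lambda\,\mathbb E\log_2\Big(1+\frac{X_i}{Y_i}\Big)\quad(X_i=A_i\text{ or }B_i),$$ $R_{RX,i}=\lambda\log_2(1+\mathrm{SINR}_{RX,i})$ with $$\mathrm{SINR}_{RX,i}=\frac{|\mathbb E\{h_{XR,i}^T\hat h_{XR,i}^*\}|^2}{\mathrm{Var}\{h_{XR,i}^T\hat h_{XR,i}^*\}+\mathrm{Var}\{h_{XR,i}^T\hat h_{\bar XR,i}^*\}+\sum_{j\ne i}\big(\mathbb E|h_{XR,i}^T\hat h_{BR,j}^*|^2+\mathbb E|h_{XR,i}^T\hat h_{AR,j}^*|^2\big)+\rho^{-2}},$$ where $\{\bar X\}=\{A,B\}\setminus\{X\}$ and $\rho^2=p_r/\mathbb E\sum_{j}(\|\hat h_{AR,j}\|^2+\|\hat h_{BR,j}\|^2)$. Finally let $R_{2,i}=\min(R_{AR,i},R_{RB,i})+\min(R_{BR,i},R_{RA,i})$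 and $R_i=\min(R_{1,i},R_{2,i})$. **Closed form.** Let $\eta_{XR,i}=\frac{\tau p_p\beta_{XR,i}}{1+\tau p_p\beta_{XR,i}}$, $\omega_{XR,i}=\frac{\beta_{XR,i}}{K_{XR,i}+1}(K_{XR,i}+\eta_{XR,i})$ and $q_i=p_{A,i}\sigma_{AR,i}^2+p_{B,i}\sigma_{BR,i}^2+1$. For users $(X,i)$ and $(Y,j)$ let $$\kappa_{Xi,Yj}=\frac{\beta_{XR,i}\beta_{YR,j}}{(K_{XR,i}+1)(K_{YR,j}+1)}\Big(\frac{K_{XR,i}+\eta_{XR,i}}{1+\tau p_p\beta_{YR,j}}+K_{YR,j}\eta_{XR,i}+K_{XR,i}\eta_{YR,j}+\eta_{XR,i}\eta_{YR,j}\Big).$$ Let $\xi_{XR,ij}=\kappa_{Xi,Aj}$, $\chi_{XR,ij}=\kappa_{Xi,Bj}$, $\zeta^{X}_{YR,ij}=\kappa_{Yj,Xi}$, and $$Q_i=\sum_{j\ne i}\big(p_{A,j}(\xi_{AR,ij}+\xi_{BR,ij})+p_{B,j}(\chi_{AR,ij}+\chi_{BR,ij})\big),\qquad Z^X_{ij}=p_r(\zeta^X_{AR,ij}+\zeta^X_{BR,ij}).$$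 Put $$\tilde R_{1,i}=\lambda\log_2\Big(1+\frac{Mp_{A,i}\omega_{AR,i}^2+Mp_{B,i}\omega_{BR,i}^2}{(\omega_{AR,i}+\omega_{BR,i})q_i+Q_i}\Big),\qquad \tilde R_{XR,i}=\lambda\log_2\Big(1+\frac{Mp_{X,i}\omega_{XR,i}^2}{(\omega_{AR,i}+\omega_{BR,i})q_i+Q_i}\Big),$$ $$\tilde R_{RX,i}=\lambda\log_2\Big(1+\frac{Mp_r\omega_{XR,i}^2}{\sum_{j=1}^N(\omega_{AR,j}+\omega_{BR,j}+Z^X_{ij})}\Big),$$ $\tilde R_{2,i}=\min(\tilde R_{AR,i},\tilde R_{RB,i})+\min(\tilde R_{BR,i},\tilde R_{RA,i})$ and $\tilde R_i=\min(\tilde R_{1,i},\tilde R_{2,i})$. **Theorem.** Let $\alpha,\varepsilon,\gamma\ge0$. For each $M$ replace every $p_{X,i}$ by $p_{X,i}/M^{\alpha}$, $p_r$ by $p_r/M^{\varepsilon}$ and $p_p$ by $p_p/M^{\gamma}$, with everything else fixed ($\alpha=\varepsilon=\gamma=0$ is the case of fixed powers). If $\gamma>0$, assume that all $K_{XR,j}>0$.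 Fix a pair $i$. Then as $M\to\infty$: 1. $R_i/\tilde R_i\to1$ and $R_i-\tilde R_i=O(1)$. If $\alpha>0$, then moreover $R_i-\tilde R_i\to0$. 2. The same holds for $R_{1,i}$ and $\tilde R_{1,i}$, for $R_{2,i}$ and $\tilde R_{2,i}$, and for $R_{XR,i}$ and $\tilde R_{XR,i}$ ($X=A,B$). 3. For $X=A,B$, and for all $\alpha,\varepsilon,\gamma\geq 0$, $R_{RX,i}/\tilde R_{RX,i}\to1$ and $R_{RX,i}-\tilde R_{RX,i}\to0$. 4. For all $\alpha,\varepsilon,\gamma\geq 0$, $\lambda\log_2\big(1+\frac{\mathbb E\{A_i+B_i\}}{\mathbb E\{Y_i\}}\big)$ and $\tilde R_{1,i}$ have ratio tending to $1$ and difference tending to $0$. The same holds for $\lambda\log_2\big(1+\frac{\mathbb E\{X_i\}}{\mathbb E\{Y_i\}}\big)$ and $\tilde R_{XR,i}$ ($X=A,B$). -/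

import Mathlib

open MeasureTheory ProbabilityTheory Filter Topology
open scoped Matrix

noncomputable section

namespace TwoWayRelay

/-- The two ends `A` and `B` of a user pair. -/
inductive Side where
  | A
  | B
  deriving DecidableEq

instance : Fintype Side := ⟨{Side.A, Side.B}, fun x => by cases x <;> simp⟩

/-- The opposite end of a pair. -/
def Side.other : Side → Side
  | Side.A => Side.B
  | Side.B => Side.A

/-- Deterministic parameters of a system with `N` user pairs. All receiver noises have unit variance. -/
structure Params (N : ℕ) where
  /-- length of the coherence interval -/
  T : ℝ
  /-- length of the channel training interval -/
  τ : ℝ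
  /-- path-loss coefficients -/
  β : Side → Fin N → ℝ
  /-- Rician factors -/
  K : Side → Fin N → ℝ
  /-- transmit powers of the users -/
  p : Side → Fin N → ℝ
  /-- transmit power of the relay -/
  pr : ℝ
  /-- transmit power of a pilot symbol -/
  pp : ℝ

/-- The admissible parameters (`K = 0` is Rayleigh fading). -/
structure Params.Valid {N : ℕ} (P : Params N) : Prop where
  tau_pos : 0 < P.τ
  tau_lt : P.τ < P.T
  beta_pos : ∀ X i, 0 < P.β X i
  K_nonneg : ∀ X i, 0 ≤ P.K X i
  p_pos : ∀ X i, 0 < P.p X i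
  pr_pos : 0 < P.pr
  pp_pos : 0 < P.pp

/-- The parameters with the user, relay and pilot powers divided by
`M ^ α`, `M ^ ε` and `M ^ γ`. Zero exponents leave the powers unchanged. -/
def Params.scale {N : ℕ} (P : Params N) (α ε γ : ℝ) (M : ℕ) : Params N :=
  { P with
    p := fun X i => P.p X i / (M : ℝ) ^ α
    pr := P.pr / (M : ℝ) ^ ε
    pp := P.pp / (M : ℝ) ^ γ }

/-! ### The random channels and their estimates -/

/-- The circularly symmetric standard complex Gaussian law `CN(0, 1)`. -/
def stdCN : Measure ℂ :=
  ((gaussianReal 0 (1 / 2)).prod (gaussianReal 0 (1 / 2))).map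
    Complex.measurableEquivRealProd.symm

instance : IsProbabilityMeasure stdCN :=
  Measure.isProbabilityMeasure_map Complex.measurableEquivRealProd.symm.measurable.aemeasurable

/-- A sample consists of the scattered components of all channels (first component) and the
noises in the pilot observations (second component), for each end, pair and antenna. -/
abbrev Sample (N M : ℕ) : Type :=
  (Side × Fin N × Fin M → ℂ) × (Side × Fin N × Fin M → ℂ)

/-- All scattered components and pilot noises are independent and `CN(0, 1)`. -/
def law (N M : ℕ) : Measure (Sample N M) :=
  (Measure.pi fun _ => stdCN).prod (Measure.pi fun _ => stdCN)

section Channel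

variable {N M : ℕ} (P : Params N) (gbar : Side → Fin N → Fin M → ℂ)

/-- The Rician fast-fading vector, with deterministic line-of-sight part `gbar X i`. -/
def fading (X : Side) (i : Fin N) (s : Sample N M) : Fin M → ℂ := fun m =>
  (√(P.K X i / (P.K X i + 1)) : ℂ) * gbar X i m
    + (√(1 / (P.K X i + 1)) : ℂ) * s.1 (X, i, m)

/-- The channel vector `h`. -/
def chan (X : Side) (i : Fin N) (s : Sample N M) : Fin M → ℂ := fun m =>
  (√(P.β X i) : ℂ) * fading P gbar X i s m

/-- The normalised pilot observation of the scattered component, with signal-to-noise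
ratio `τ * pp * β`. -/
def pilot (X : Side) (i : Fin N) (s : Sample N M) : Fin M → ℂ := fun m =>
  (√(P.τ * P.pp * P.β X i) : ℂ) * s.1 (X, i, m) + s.2 (X, i, m)

/-- The MMSE estimate (conditional mean) of the `CN(0, 1)` scattered component from its pilot
observation. -/
def scatEst (X : Side) (i : Fin N) (s : Sample N M) : Fin M → ℂ := fun m =>
  ((√(P.τ * P.pp * P.β X i) / (1 + P.τ * P.pp * P.β X i) : ℝ) : ℂ) * pilot P X i s m

/-- The channel estimate: the line-of-sight part is known, the scattered part is estimated. -/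
def chanEst (X : Side) (i : Fin N) (s : Sample N M) : Fin M → ℂ := fun m =>
  (√(P.β X i) : ℂ) *
    ((√(P.K X i / (P.K X i + 1)) : ℂ) * gbar X i m
      + (√(1 / (P.K X i + 1)) : ℂ) * scatEst P X i s m)

/-- The estimation error `e`, so that `chan = chanEst + err`. -/
def err (X : Side) (i : Fin N) (s : Sample N M) : Fin M → ℂ :=
  chan P gbar X i s - chanEst P gbar X i s

end Channel

/-- `|aᴴ b|²`. -/
def corr {M : ℕ} (a b : Fin M → ℂ) : ℝ := ‖star a ⬝ᵥ b‖ ^ 2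

/-- The squared Euclidean norm. -/
def sqNorm {M : ℕ} (a : Fin M → ℂ) : ℝ := ∑ m, ‖a m‖ ^ 2

/-- The factor `λ = (T - τ) / (2 T)`. -/
def Params.prelog {N : ℕ} (P : Params N) : ℝ := (P.T - P.τ) / (2 * P.T)

/-! ### Uplink spectral efficiencies -/

section Exact

variable {N M : ℕ} (P : Params N) (gbar : Side → Fin N → Fin M → ℂ)

/-- The signal terms `A_i` (for `X = A`) and `B_i` (for `X = B`). -/
def sig (X : Side) (i : Fin N) (s : Sample N M) : ℝ :=
  P.p X i *
    (corr (chanEst P gbar Side.A i s) (chanEst P gbar X i s)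
      + corr (chanEst P gbar Side.B i s) (chanEst P gbar X i s))

/-- The estimation-error term `C_i`. -/
def errTerm (i : Fin N) (s : Sample N M) : ℝ :=
  P.p Side.A i *
      (corr (chanEst P gbar Side.A i s) (err P gbar Side.A i s)
        + corr (chanEst P gbar Side.B i s) (err P gbar Side.A i s))
    + P.p Side.B i *
      (corr (chanEst P gbar Side.A i s) (err P gbar Side.B i s)
        + corr (chanEst P gbar Side.B i s) (err P gbar Side.B i s))

/-- The inter-user interference `D_i`. -/
def interf (i : Fin N) (s : Sample N M) : ℝ :=
  (∑ j ∈ Finset.univ.erase i, P.p Side.A j *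
      (corr (chanEst P gbar Side.A i s) (chan P gbar Side.A j s)
        + corr (chanEst P gbar Side.B i s) (chan P gbar Side.A j s)))
    + ∑ j ∈ Finset.univ.erase i, P.p Side.B j *
      (corr (chanEst P gbar Side.A i s) (chan P gbar Side.B j s)
        + corr (chanEst P gbar Side.B i s) (chan P gbar Side.B j s))

/-- The compound noise `E_i`. -/
def noise (i : Fin N) (s : Sample N M) : ℝ :=
  sqNorm (chanEst P gbar Side.A i s) + sqNorm (chanEst P gbar Side.B i s)

/-- The denominator `C_i + D_i + E_i`. -/
def den (i : Fin N) (s : Sample N M) : ℝ :=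
  errTerm P gbar i s + interf P gbar i s + noise P gbar i s

/-- The spectral efficiency `R_{1,i}` of the pair in the uplink phase. -/
def R1 (i : Fin N) : ℝ :=
  P.prelog * ∫ s, Real.logb 2
    (1 + (sig P gbar Side.A i s + sig P gbar Side.B i s) / den P gbar i s) ∂law N M

/-- The spectral efficiency `R_{XR,i}` of the link from user `X` of the pair to the relay. -/
def RUp (X : Side) (i : Fin N) : ℝ :=
  P.prelog * ∫ s, Real.logb 2 (1 + sig P gbar X i s / den P gbar i s) ∂law N M

/-- `R_{1,i}` with signal and interference replaced by their expectations. -/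
def R1Mean (i : Fin N) : ℝ :=
  P.prelog * Real.logb 2
    (1 + (∫ s, (sig P gbar Side.A i s + sig P gbar Side.B i s) ∂law N M)
      / ∫ s, den P gbar i s ∂law N M)

/-- `R_{XR,i}` with signal and interference replaced by their expectations. -/
def RUpMean (X : Side) (i : Fin N) : ℝ :=
  P.prelog * Real.logb 2
    (1 + (∫ s, sig P gbar X i s ∂law N M) / ∫ s, den P gbar i s ∂law N M)

/-! ### Downlink spectral efficiencies -/

/-- The effective gain `h_{XR,i}ᵀ ĥ_{YR,j}^*`. -/
def gain (X : Side) (i : Fin N) (Y : Side) (j : Fin N) (s : Sample N M) : ℂ :=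
  chan P gbar X i s ⬝ᵥ star (chanEst P gbar Y j s)

/-- The variance of a complex random variable. -/
def cVar (Z : Sample N M → ℂ) : ℝ := ∫ s, ‖Z s - ∫ t, Z t ∂law N M‖ ^ 2 ∂law N M

/-- The normalisation `ρ = √(p_r / E ‖F_d‖²)` of the precoder `F_d = [Ĥ_BR, Ĥ_AR]^*`. -/
def rho : ℝ :=
  √(P.pr / ∫ s, (∑ j, (sqNorm (chanEst P gbar Side.B j s) + sqNorm (chanEst P gbar Side.A j s)))
      ∂law N M)

/-- The downlink signal-to-interference-plus-noise ratio of user `X` of the pair `i`. -/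
def sinrDown (X : Side) (i : Fin N) : ℝ :=
  ‖∫ s, gain P gbar X i X i s ∂law N M‖ ^ 2 /
    (cVar (gain P gbar X i X i) + cVar (gain P gbar X i X.other i)
      + (∑ j ∈ Finset.univ.erase i,
          ((∫ s, ‖gain P gbar X i Side.B j s‖ ^ 2 ∂law N M)
            + ∫ s, ‖gain P gbar X i Side.A j s‖ ^ 2 ∂law N M))
      + 1 / rho P gbar ^ 2)

/-- The spectral efficiency `R_{RX,i}` of the link from the relay to user `X` of the pair. -/
def RDown (X : Side) (i : Fin N) : ℝ :=
  P.prelog * Real.logb 2 (1 + sinrDown P gbar X i)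

/-- The spectral efficiency `R_{2,i}` of the pair in the downlink phase. -/
def R2 (i : Fin N) : ℝ :=
  min (RUp P gbar Side.A i) (RDown P gbar Side.B i)
    + min (RUp P gbar Side.B i) (RDown P gbar Side.A i)

/-- The spectral efficiency `R_i` of the pair. -/
def R (i : Fin N) : ℝ := min (R1 P gbar i) (R2 P gbar i)

end Exact

/-! ### The closed form -/

section ClosedForm

variable {N : ℕ} (P : Params N)

/-- `η_{XR,i}`. -/
def eta (X : Side) (i : Fin N) : ℝ :=
  P.τ * P.pp * P.β X i / (1 + P.τ * P.pp * P.β X i)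

/-- `ω_{XR,i}`. -/
def omega (X : Side) (i : Fin N) : ℝ :=
  P.β X i / (P.K X i + 1) * (P.K X i + eta P X i)

/-- The error variance `σ²_{XR,i}`. -/
def sigmaSq (X : Side) (i : Fin N) : ℝ :=
  P.β X i / ((1 + P.τ * P.pp * P.β X i) * (P.K X i + 1))

/-- `q_i`. -/
def q (i : Fin N) : ℝ :=
  P.p Side.A i * sigmaSq P Side.A i + P.p Side.B i * sigmaSq P Side.B i + 1

/-- The common form of `ξ`, `χ` and `ζ`: the estimated channel is that of user `X` in pair `i`,
the true channel that of user `Y` in pair `j`. -/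
def cross (X : Side) (i : Fin N) (Y : Side) (j : Fin N) : ℝ :=
  P.β X i * P.β Y j / ((P.K X i + 1) * (P.K Y j + 1)) *
    ((P.K X i + eta P X i) / (1 + P.τ * P.pp * P.β Y j)
      + P.K Y j * eta P X i + P.K X i * eta P Y j + eta P X i * eta P Y j)

/-- `ξ_{XR,ij}`. -/
def xi (X : Side) (i j : Fin N) : ℝ := cross P X i Side.A j

/-- `χ_{XR,ij}`. -/
def chi (X : Side) (i j : Fin N) : ℝ := cross P X i Side.B j

/-- `ζ^X_{YR,ij}`, for the true channel of user `X` in pair `i` and the estimated channel of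
user `Y` in pair `j`. -/
def zeta (X Y : Side) (i j : Fin N) : ℝ := cross P Y j X i

/-- `Q_i`. -/
def Q (i : Fin N) : ℝ :=
  ∑ j ∈ Finset.univ.erase i,
    (P.p Side.A j * (xi P Side.A i j + xi P Side.B i j)
      + P.p Side.B j * (chi P Side.A i j + chi P Side.B i j))

/-- `Z^X_{ij}`. -/
def Z (X : Side) (i j : Fin N) : ℝ := P.pr * (zeta P X Side.A i j + zeta P X Side.B i j)

/-- `R̃_{1,i}` for `M` antennas. -/
def R1Approx (M : ℕ) (i : Fin N) : ℝ :=
  P.prelog * Real.logb 2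
    (1 + (M * P.p Side.A i * omega P Side.A i ^ 2 + M * P.p Side.B i * omega P Side.B i ^ 2)
      / ((omega P Side.A i + omega P Side.B i) * q P i + Q P i))

/-- `R̃_{XR,i}` for `M` antennas. -/
def RUpApprox (M : ℕ) (X : Side) (i : Fin N) : ℝ :=
  P.prelog * Real.logb 2
    (1 + M * P.p X i * omega P X i ^ 2
      / ((omega P Side.A i + omega P Side.B i) * q P i + Q P i))

/-- `R̃_{RX,i}` for `M` antennas. -/
def RDownApprox (M : ℕ) (X : Side) (i : Fin N) : ℝ :=
  P.prelog * Real.logb 2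
    (1 + M * P.pr * omega P X i ^ 2
      / ∑ j, (omega P Side.A j + omega P Side.B j + Z P X i j))

/-- `R̃_{2,i}` for `M` antennas. -/
def R2Approx (M : ℕ) (i : Fin N) : ℝ :=
  min (RUpApprox P M Side.A i) (RDownApprox P M Side.B i)
    + min (RUpApprox P M Side.B i) (RDownApprox P M Side.A i)

/-- `R̃_i` for `M` antennas. -/
def RApprox (M : ℕ) (i : Fin N) : ℝ := min (R1Approx P M i) (R2Approx P M i)

end ClosedForm

/-! ### Modes of approximation as the number of antennas grows -/

/-- `a / b → 1` and `a - b → 0`. -/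
def StrongApprox (a b : ℕ → ℝ) : Prop :=
  Tendsto (fun M => a M / b M) atTop (𝓝 1) ∧ Tendsto (fun M => a M - b M) atTop (𝓝 0)

/-- `a / b → 1` and `a - b` stays bounded. -/
def LogApprox (a b : ℕ → ℝ) : Prop :=
  Tendsto (fun M => a M / b M) atTop (𝓝 1) ∧ ∃ C : ℝ, ∀ᶠ M in atTop, |a M - b M| ≤ C

/-- The line-of-sight vectors have squared norm `M`, and those of distinct users have inner
products `o(√M)`. -/
structure LineOfSight {N : ℕ} (gbar : (M : ℕ) → Side → Fin N → Fin M → ℂ) : Prop where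
  norm_sq : ∀ M X i, sqNorm (gbar M X i) = M
  orthogonal : ∀ X i Y j, (X, i) ≠ (Y, j) →
    Tendsto (fun M : ℕ => corr (gbar M X i) (gbar M Y j) / M) atTop (𝓝 0)

end TwoWayRelay

end

noncomputable section

namespace TwoWayRelay

/-! ### Moments of Gaussian variables -/

/-! The proof rests on one change of variables and on second moments. At one antenna the scattered
component and the pilot noise are i.i.d. `CN(0, 1)`. Rotating this pair so that its first coordinate
is proportional to the pilot makes the channel estimate affine in the first coordinate
(`chanEst_apply`) and the error a multiple of the second (`err_apply`). The rotated pairs stay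
independent, so means and variances of inner products reduce to moments at single antennas
(`integral_corr_affVec`).

The downlink ratio is built from expectations only. It has an exact formula (`sinrDown_eq`) that
differs from the closed form by line-of-sight correlations of size `o(M)`, against a denominator of
order `M`. The uplink ratios of expectations are compared in the same spirit.

For the ergodic uplink, the squared norm of an estimate has mean `M ω` and standard deviation at
most `√M ω`, so the normalised signal is within `O(M^(-1/2))` of 1 in mean. The denominator is
noise, which concentrates as well, plus estimation error and interference, whose mean relative to
the noise is `O(M^(-α))`. For `α > 0` both normalised quantities therefore tend to 1 in `L¹`. To
pass to logarithms, Cauchy–Schwarz (`sig_le_mul_den`) dominates the normalised ratio by a variable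
with bounded second moment, so rare events contribute little. The two bounds `log (1 + s) |r - 1|`
and `|log r|` for the change of `log (1 + s)` when `s` is multiplied by `r` control quotient and
difference whether `s` is small or large.

For `α = 0` the interference is comparable with the noise and no concentration of the denominator is
available. Its normalised mean is still bounded, which bounds the difference of the logarithms
(`abs_log_one_add_mul_div_sub_le_of_le_mul`). As `s` grows linearly in `M`, its logarithm diverges
and a bounded error suffices for the quotient. -/

lemma map_rotation_gaussianReal (v : NNReal) (θ : ℝ) :
    ((gaussianReal 0 v).prod (gaussianReal 0 v)).map (ContinuousLinearMap.rotation θ)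
      = (gaussianReal 0 v).prod (gaussianReal 0 v) :=
  IsGaussian.map_rotation_eq_self (by simp) θ

lemma integrable_pow_gaussianReal (v : NNReal) (n : ℕ) :
    Integrable (fun x : ℝ => x ^ n) (gaussianReal 0 v) := by
  have h := (memLp_id_gaussianReal' (μ := 0) (v := v) (n : ENNReal) (by simp)).integrable_norm_pow'
  refine (integrable_norm_iff (by fun_prop)).1 ?_
  simpa using h

lemma integral_sq_gaussianReal (v : NNReal) : ∫ x, x ^ 2 ∂gaussianReal 0 v = v := by
  have h := variance_fun_id_gaussianReal (μ := 0) (v := v)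
  rwa [variance_of_integral_eq_zero (by fun_prop) (by simp)] at h

lemma integral_odd_pow_gaussianReal (v : NNReal) {n : ℕ} (hn : Odd n) :
    ∫ x, x ^ n ∂gaussianReal 0 v = 0 := by
  have h : ∫ x, x ^ n ∂gaussianReal 0 v = ∫ x, (-x) ^ n ∂gaussianReal 0 v := by
    conv_lhs => rw [← neg_zero (G := ℝ), ← gaussianReal_map_neg]
    rw [integral_map (by fun_prop) (by fun_prop)]
  simp_rw [hn.neg_pow, integral_neg] at h
  linarith

/-- Rotation by `π / 4` gives `X` and `(X + Y) / √2` the same law. Comparing fourth moments yields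
`m = m / 2 + 3 v ^ 2 / 2`. -/
lemma integral_pow_four_gaussianReal (v : NNReal) :
    ∫ x, x ^ 4 ∂gaussianReal 0 v = 3 * (v : ℝ) ^ 2 := by
  set γ := gaussianReal 0 v with hγ
  have hint : ∀ a b : ℕ, Integrable (fun z : ℝ × ℝ => z.1 ^ a * z.2 ^ b) (γ.prod γ) := fun a b =>
    (integrable_pow_gaussianReal v a).mul_prod (integrable_pow_gaussianReal v b)
  have hmom : ∀ a b : ℕ, ∫ z : ℝ × ℝ, z.1 ^ a * z.2 ^ b ∂γ.prod γ
      = (∫ x, x ^ a ∂γ) * ∫ x, x ^ b ∂γ := fun a b =>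
    integral_prod_mul (fun x : ℝ => x ^ a) (fun x : ℝ => x ^ b)
  have h1 : ∫ z : ℝ × ℝ, z.1 ^ 4 ∂γ.prod γ = ∫ x, x ^ 4 ∂γ := by
    simpa using hmom 4 0
  have h2 : ∫ z : ℝ × ℝ, z.1 ^ 4 ∂γ.prod γ
      = ∫ z : ℝ × ℝ, (√2 / 2 * z.1 + √2 / 2 * z.2) ^ 4 ∂γ.prod γ := by
    conv_lhs => rw [hγ, ← map_rotation_gaussianReal v (Real.pi / 4)]
    rw [integral_map (by fun_prop) (by fun_prop)]
    simp [ContinuousLinearMap.rotation_apply, hγ]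
  have h4 : (√2 / 2 : ℝ) ^ 4 = 1 / 4 := by
    rw [div_pow, show (4 : ℕ) = 2 * 2 from rfl, pow_mul, Real.sq_sqrt (by norm_num)]; norm_num
  -- Zero exponents are kept so that `hmom` factors every term; the two terms with odd exponents
  -- then vanish.
  have h3 : ∀ z : ℝ × ℝ, (√2 / 2 * z.1 + √2 / 2 * z.2) ^ 4
      = 1 / 4 * (z.1 ^ 4 * z.2 ^ 0) + 1 * (z.1 ^ 3 * z.2 ^ 1) + 3 / 2 * (z.1 ^ 2 * z.2 ^ 2)
        + 1 * (z.1 ^ 1 * z.2 ^ 3) + 1 / 4 * (z.1 ^ 0 * z.2 ^ 4) := fun z => by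
    rw [← mul_add, mul_pow, h4]; ring
  simp_rw [h3] at h2
  rw [integral_add, integral_add, integral_add, integral_add] at h2
  · simp_rw [integral_const_mul, hmom] at h2
    rw [h1, hγ, integral_odd_pow_gaussianReal v (n := 3) (by decide), integral_sq_gaussianReal] at h2
    simp at h2
    linarith
  all_goals
    first
    | exact (hint _ _).const_mul _
    | skip
  · exact ((hint _ _).const_mul _).add ((hint _ _).const_mul _)
  · exact (((hint _ _).const_mul _).add ((hint _ _).const_mul _)).add ((hint _ _).const_mul _)
  · exact ((((hint _ _).const_mul _).add ((hint _ _).const_mul _)).add ((hint _ _).const_mul _)).add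
      ((hint _ _).const_mul _)

lemma integrable_affine_pow_gaussianReal (v : NNReal) (p c : ℝ) (n : ℕ) :
    Integrable (fun x : ℝ => (p + c * x) ^ n) (gaussianReal 0 v) := by
  simp_rw [add_pow, mul_pow]
  refine integrable_finsetSum _ fun k _ => ?_
  have := (integrable_pow_gaussianReal v (n - k)).const_mul (p ^ k * c ^ (n - k) * (n.choose k))
  refine this.congr (ae_of_all _ fun x => ?_)
  simp only
  ring

lemma integral_affine_sq_gaussianReal (v : NNReal) (p c : ℝ) :
    ∫ x, (p + c * x) ^ 2 ∂gaussianReal 0 v = p ^ 2 + c ^ 2 * v := by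
  have h : ∀ x : ℝ, (p + c * x) ^ 2 = p ^ 2 + 2 * p * c * x ^ 1 + c ^ 2 * x ^ 2 := fun x => by ring
  have hi := integrable_pow_gaussianReal v
  simp_rw [h]
  rw [integral_add (by fun_prop) (by fun_prop), integral_add (by fun_prop) (by fun_prop)]
  simp_rw [integral_const_mul, integral_odd_pow_gaussianReal v (n := 1) (by decide),
    integral_sq_gaussianReal]
  simp

lemma integral_affine_pow_four_gaussianReal (v : NNReal) (p c : ℝ) :
    ∫ x, (p + c * x) ^ 4 ∂gaussianReal 0 v
      = p ^ 4 + 6 * p ^ 2 * c ^ 2 * v + 3 * c ^ 4 * (v : ℝ) ^ 2 := by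
  have h : ∀ x : ℝ, (p + c * x) ^ 4 = p ^ 4 + 4 * p ^ 3 * c * x ^ 1 + 6 * p ^ 2 * c ^ 2 * x ^ 2
      + 4 * p * c ^ 3 * x ^ 3 + c ^ 4 * x ^ 4 := fun x => by ring
  have hi := integrable_pow_gaussianReal v
  simp_rw [h]
  rw [integral_add (by fun_prop) (by fun_prop), integral_add (by fun_prop) (by fun_prop),
    integral_add (by fun_prop) (by fun_prop), integral_add (by fun_prop) (by fun_prop)]
  simp_rw [integral_const_mul, integral_odd_pow_gaussianReal v (n := 1) (by decide),
    integral_odd_pow_gaussianReal v (n := 3) (by decide),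
    integral_sq_gaussianReal, integral_pow_four_gaussianReal]
  simp
  ring

/-! ### The law `CN(0, 1)` -/

lemma stdCN_eq_map : stdCN = ((gaussianReal 0 (1 / 2)).prod (gaussianReal 0 (1 / 2))).map
    Complex.equivRealProdCLM.symm := rfl

instance : IsGaussian stdCN := by
  rw [stdCN_eq_map]; infer_instance

lemma integral_stdCN {E : Type*} [NormedAddCommGroup E] [NormedSpace ℝ E] (F : ℂ → E) :
    ∫ z, F z ∂stdCN
      = ∫ x : ℝ × ℝ, F ⟨x.1, x.2⟩ ∂(gaussianReal 0 (1 / 2)).prod (gaussianReal 0 (1 / 2)) := by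
  rw [stdCN, integral_map_equiv]; rfl

lemma memLp_id_stdCN (n : ℕ) : MemLp id n stdCN :=
  IsGaussian.memLp_id _ _ (by simp)

lemma integrable_id_stdCN : Integrable (fun z : ℂ => z) stdCN :=
  (memLp_id_stdCN 1).integrable (by simp)

lemma integral_id_stdCN : ∫ z, z ∂stdCN = 0 := by
  have hint := integrable_id_stdCN
  have hneg : stdCN.map (fun z => -z) = stdCN := by
    have h : ∀ x : ℝ × ℝ, -(Complex.measurableEquivRealProd.symm x)
        = Complex.measurableEquivRealProd.symm (Prod.map Neg.neg Neg.neg x) := fun x => by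
      apply Complex.ext <;> simp
    rw [stdCN, Measure.map_map (by fun_prop) (by fun_prop)]
    have h' : (fun z : ℂ => -z) ∘ Complex.measurableEquivRealProd.symm
        = Complex.measurableEquivRealProd.symm ∘ Prod.map Neg.neg Neg.neg := funext h
    rw [h', ← Measure.map_map (by fun_prop) (by fun_prop),
      ← Measure.map_prod_map _ _ (by fun_prop) (by fun_prop)]
    have := gaussianReal_map_neg (μ := 0) (v := 1 / 2)
    rw [neg_zero] at this
    change Measure.map _ ((Measure.map (fun x => -x) _).prod (Measure.map (fun x => -x) _)) = _
    rw [this]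
  have h : ∫ z, z ∂stdCN = ∫ z, -z ∂stdCN := by
    conv_lhs => rw [← hneg]
    rw [integral_map (by fun_prop) (by fun_prop)]
  rw [integral_neg] at h
  exact self_eq_neg.1 h

lemma integral_normSq_affine_stdCN (μ : ℂ) (c : ℝ) :
    ∫ z, ‖μ + c * z‖ ^ 2 ∂stdCN = ‖μ‖ ^ 2 + c ^ 2 := by
  have h : ∀ x : ℝ × ℝ, ‖μ + c * (⟨x.1, x.2⟩ : ℂ)‖ ^ 2
      = (μ.re + c * x.1) ^ 2 * (μ.im + c * x.2) ^ 0
        + (μ.re + c * x.1) ^ 0 * (μ.im + c * x.2) ^ 2 := fun x => by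
    rw [Complex.sq_norm, Complex.normSq_apply]; simp; ring
  have hi := fun (p : ℝ) n => integrable_affine_pow_gaussianReal (1 / 2) p c n
  rw [integral_stdCN]
  simp_rw [h]
  rw [integral_add ((hi _ _).mul_prod (hi _ _)) ((hi _ _).mul_prod (hi _ _)),
    integral_prod_mul (fun x : ℝ => (μ.re + c * x) ^ 2) (fun x : ℝ => (μ.im + c * x) ^ 0),
    integral_prod_mul (fun x : ℝ => (μ.re + c * x) ^ 0) (fun x : ℝ => (μ.im + c * x) ^ 2),
    integral_affine_sq_gaussianReal, integral_affine_sq_gaussianReal, Complex.sq_norm,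
    Complex.normSq_apply]
  simp
  ring

/-- This fourth moment is what determines the fluctuation of the squared norm of an estimate. -/
lemma integral_norm_pow_four_affine_stdCN (μ : ℂ) (c : ℝ) :
    ∫ z, ‖μ + c * z‖ ^ 4 ∂stdCN = ‖μ‖ ^ 4 + 4 * c ^ 2 * ‖μ‖ ^ 2 + 2 * c ^ 4 := by
  have h4 : ∀ w : ℂ, ‖w‖ ^ 4 = (w.re * w.re + w.im * w.im) ^ 2 := fun w => by
    rw [← Complex.normSq_apply, ← Complex.sq_norm]; ring
  have h : ∀ x : ℝ × ℝ, ‖μ + c * (⟨x.1, x.2⟩ : ℂ)‖ ^ 4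
      = (μ.re + c * x.1) ^ 4 * (μ.im + c * x.2) ^ 0
        + 2 * ((μ.re + c * x.1) ^ 2 * (μ.im + c * x.2) ^ 2)
        + (μ.re + c * x.1) ^ 0 * (μ.im + c * x.2) ^ 4 := fun x => by
    rw [h4]; simp; ring
  have hi : ∀ a b : ℕ, Integrable
      (fun x : ℝ × ℝ => (μ.re + c * x.1) ^ a * (μ.im + c * x.2) ^ b)
      ((gaussianReal 0 (1 / 2)).prod (gaussianReal 0 (1 / 2))) := fun a b =>
    (integrable_affine_pow_gaussianReal _ _ _ a).mul_prod
      (integrable_affine_pow_gaussianReal _ _ _ b)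
  rw [integral_stdCN]
  simp_rw [h]
  rw [integral_add (by fun_prop) (by fun_prop), integral_add (by fun_prop) (by fun_prop),
    integral_const_mul,
    integral_prod_mul (fun x : ℝ => (μ.re + c * x) ^ 4) (fun x : ℝ => (μ.im + c * x) ^ 0),
    integral_prod_mul (fun x : ℝ => (μ.re + c * x) ^ 2) (fun x : ℝ => (μ.im + c * x) ^ 2),
    integral_prod_mul (fun x : ℝ => (μ.re + c * x) ^ 0) (fun x : ℝ => (μ.im + c * x) ^ 4),
    integral_affine_sq_gaussianReal, integral_affine_sq_gaussianReal,
    integral_affine_pow_four_gaussianReal, integral_affine_pow_four_gaussianReal, h4,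
    Complex.sq_norm, Complex.normSq_apply]
  simp
  ring

lemma integral_affine_stdCN (μ : ℂ) (c : ℝ) : ∫ z, (μ + c * z) ∂stdCN = μ := by
  have hint := integrable_id_stdCN
  rw [integral_add (by fun_prop) (hint.const_mul _), integral_const_mul, integral_id_stdCN]
  simp

lemma memLp_affine_stdCN (μ : ℂ) (c : ℝ) (n : ℕ) :
    MemLp (fun z : ℂ => μ + c * z) n stdCN :=
  (memLp_const μ).add ((memLp_id_stdCN n).const_mul (c : ℂ))

/-- Two independent `CN(0, 1)` variables stay so under rotations. -/
lemma map_rotation_stdCN (θ : ℝ) :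
    (stdCN.prod stdCN).map (ContinuousLinearMap.rotation θ) = stdCN.prod stdCN :=
  IsGaussian.map_rotation_eq_self (by simpa using integral_id_stdCN) θ

/-! ### The entries of the estimates and of the errors -/

instance {N M : ℕ} : IsProbabilityMeasure (law N M) := by
  unfold law; infer_instance

/-- The law is a product of two products, scatter and noise. Transposing it into a product over
antennas of pairs allows each pair to be rotated separately. -/
lemma measurePreserving_entries (N M : ℕ) :
    MeasurePreserving (fun (s : Sample N M) k => (s.1 k, s.2 k)) (law N M)
      (Measure.pi fun _ => stdCN.prod stdCN) :=
  (measurePreserving_arrowProdEquivProdArrow ℂ ℂ (Side × Fin N × Fin M)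
    (fun _ => stdCN) (fun _ => stdCN)).symm

lemma iIndepFun_entries (N M : ℕ) :
    iIndepFun (fun k (s : Sample N M) => (s.1 k, s.2 k)) (law N M) := by
  rw [iIndepFun_iff_map_fun_eq_pi_map (fun k => by fun_prop), (measurePreserving_entries N M).map_eq]
  congr 1
  ext1 k
  exact ((measurePreserving_eval _ k).comp (measurePreserving_entries N M)).map_eq.symm

lemma measurePreserving_entry {N M : ℕ} (k : Side × Fin N × Fin M) :
    MeasurePreserving (fun s : Sample N M => (s.1 k, s.2 k)) (law N M) (stdCN.prod stdCN) :=
  (measurePreserving_eval _ k).comp (measurePreserving_entries N M)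

section Entries

variable {N M : ℕ} (P : Params N) (gbar : Side → Fin N → Fin M → ℂ)

/-- The angle by which the pair (scattered component, pilot noise) is rotated so that its first
component is proportional to the pilot observation. -/
def trainAngle (X : Side) (i : Fin N) : ℝ :=
  Real.pi / 2 - Real.arctan √(P.τ * P.pp * P.β X i)

/-- The rotated pair (scattered component, pilot noise) of one antenna. -/
def rotEntry (k : Side × Fin N × Fin M) (s : Sample N M) : ℂ × ℂ :=
  ContinuousLinearMap.rotation (trainAngle P k.1 k.2.1) (s.1 k, s.2 k)

/-- The amplitude of the line-of-sight part of the channel. -/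
def losAmp (X : Side) (i : Fin N) : ℝ := √(P.β X i) * √(P.K X i / (P.K X i + 1))

/-- The amplitude of the scattered part of the channel estimate. -/
def estAmp (X : Side) (i : Fin N) : ℝ :=
  √(P.β X i) * √(1 / (P.K X i + 1)) * Real.cos (trainAngle P X i)

/-- The (signed) amplitude of the estimation error. -/
def errAmp (X : Side) (i : Fin N) : ℝ :=
  -(√(P.β X i) * √(1 / (P.K X i + 1)) * Real.sin (trainAngle P X i))

lemma measurePreserving_rotEntry (k : Side × Fin N × Fin M) :
    MeasurePreserving (rotEntry P k) (law N M) (stdCN.prod stdCN) :=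
  (MeasurePreserving.mk (by fun_prop) (map_rotation_stdCN _)).comp (measurePreserving_entry k)

lemma iIndepFun_rotEntry : iIndepFun (rotEntry (M := M) P) (law N M) :=
  (iIndepFun_entries N M).comp
    (fun k => ContinuousLinearMap.rotation (trainAngle P k.1 k.2.1)) (fun _ => by fun_prop)

variable {P}

lemma snr_pos (hP : P.Valid) (X : Side) (i : Fin N) : 0 < P.τ * P.pp * P.β X i :=
  mul_pos (mul_pos hP.tau_pos hP.pp_pos) (hP.beta_pos X i)

/-- The square of this cosine is `eta`: the angle records how the unit variance of the scattered
component splits between estimate and error. -/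
lemma cos_trainAngle (hP : P.Valid) (X : Side) (i : Fin N) :
    Real.cos (trainAngle P X i)
    = √(P.τ * P.pp * P.β X i) / √(1 + P.τ * P.pp * P.β X i) := by
  rw [trainAngle, Real.cos_pi_div_two_sub, Real.sin_arctan, Real.sq_sqrt (snr_pos hP X i).le]

lemma sin_trainAngle (hP : P.Valid) (X : Side) (i : Fin N) :
    Real.sin (trainAngle P X i) = 1 / √(1 + P.τ * P.pp * P.β X i) := by
  rw [trainAngle, Real.sin_pi_div_two_sub, Real.cos_arctan, Real.sq_sqrt (snr_pos hP X i).le]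

lemma losAmp_sq (hP : P.Valid) (X : Side) (i : Fin N) :
    losAmp P X i ^ 2 = P.β X i * P.K X i / (P.K X i + 1) := by
  have hK := hP.K_nonneg X i
  rw [losAmp, mul_pow, Real.sq_sqrt (hP.beta_pos X i).le, Real.sq_sqrt (by positivity)]
  ring

lemma estAmp_sq (hP : P.Valid) (X : Side) (i : Fin N) :
    estAmp P X i ^ 2 = P.β X i * eta P X i / (P.K X i + 1) := by
  have hK := hP.K_nonneg X i
  have h := snr_pos hP X i
  rw [estAmp, mul_pow, mul_pow, cos_trainAngle hP, div_pow, Real.sq_sqrt (hP.beta_pos X i).le,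
    Real.sq_sqrt (by positivity), Real.sq_sqrt h.le, Real.sq_sqrt (by positivity), eta]
  ring

lemma errAmp_sq (hP : P.Valid) (X : Side) (i : Fin N) : errAmp P X i ^ 2 = sigmaSq P X i := by
  have hK := hP.K_nonneg X i
  have h := snr_pos hP X i
  rw [errAmp, neg_sq, mul_pow, mul_pow, sin_trainAngle hP, div_pow,
    Real.sq_sqrt (hP.beta_pos X i).le,
    Real.sq_sqrt (by positivity), Real.sq_sqrt (by positivity), sigmaSq]
  field_simp

/-- The pilot is `√(1 + snr)` times the first rotated coordinate, and the MMSE coefficient `√snr /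
(1 + snr)` is the product of cosine and sine. The scattered estimate is thus the cosine times that
coordinate. -/
lemma chanEst_apply (hP : P.Valid) (X : Side) (i : Fin N) (s : Sample N M) (m : Fin M) :
    chanEst P gbar X i s m
      = losAmp P X i * gbar X i m + estAmp P X i * (rotEntry P (X, i, m) s).1 := by
  have h := snr_pos hP X i
  have h2 : √(1 + P.τ * P.pp * P.β X i) ≠ 0 := by positivity
  have h3 : ((√(P.τ * P.pp * P.β X i) / (1 + P.τ * P.pp * P.β X i) : ℝ) : ℂ)
      = (Real.cos (trainAngle P X i) : ℂ) * (Real.sin (trainAngle P X i) : ℝ) := by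
    rw [cos_trainAngle hP, sin_trainAngle hP, ← Complex.ofReal_mul, div_mul_div_comm, mul_one,
      Real.mul_self_sqrt (by positivity)]
  have h4 : ((Real.sin (trainAngle P X i) : ℝ) : ℂ) * (√(P.τ * P.pp * P.β X i) : ℝ)
      = (Real.cos (trainAngle P X i) : ℝ) := by
    rw [cos_trainAngle hP, sin_trainAngle hP, ← Complex.ofReal_mul]
    congr 1
    ring
  simp only [chanEst, scatEst, pilot, rotEntry, ContinuousLinearMap.rotation_apply, losAmp, estAmp,
    h3, Complex.real_smul]
  push_cast at h4 ⊢
  linear_combination (√(P.β X i) * √(1 / (P.K X i + 1)) * Complex.cos (trainAngle P X i)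
    * s.1 (X, i, m) : ℂ) * h4

/-- Undoing the rotation writes the scattered component as cosine times the first coordinate minus
sine times the second. Removing the estimate leaves only the second, which is independent of the
estimate. -/
lemma err_apply (hP : P.Valid) (X : Side) (i : Fin N) (s : Sample N M) (m : Fin M) :
    err P gbar X i s m = errAmp P X i * (rotEntry P (X, i, m) s).2 := by
  have h5 := Complex.sin_sq_add_cos_sq (trainAngle P X i : ℂ)
  simp only [err, Pi.sub_apply, chanEst_apply gbar hP]
  simp only [chan, fading, rotEntry, ContinuousLinearMap.rotation_apply, losAmp, estAmp, errAmp,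
    Complex.real_smul]
  push_cast
  linear_combination -(√(P.β X i) * √(1 / (P.K X i + 1)) * s.1 (X, i, m) : ℂ) * h5

lemma chan_eq_add_err (X : Side) (i : Fin N)
    (s : Sample N M) (m : Fin M) :
    chan P gbar X i s m = chanEst P gbar X i s m + err P gbar X i s m := by
  simp [err]

end Entries

/-! ### Second moments of sums of pairwise independent complex variables -/

section SumMoments

variable {Ω : Type*} [MeasurableSpace Ω] {μ : Measure Ω}

lemma integrable_mul_conj {f g : Ω → ℂ} (hf : MemLp f 2 μ) (hg : MemLp g 2 μ) :
    Integrable (fun s => f s * star (g s)) μ :=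
  hf.integrable_mul hg.star

lemma ofReal_norm_sq_eq_mul_star (z : ℂ) : ((‖z‖ ^ 2 : ℝ) : ℂ) = z * star z := by
  rw [Complex.star_def, Complex.mul_conj, Complex.normSq_eq_norm_sq]

/-- In the expanded square, pairwise independence factors each off-diagonal mean, so only the
diagonal deviates from the square of the mean: variances add. -/
lemma integral_normSq_sum [IsProbabilityMeasure μ] {ι : Type*} [Fintype ι] {W : ι → Ω → ℂ}
    (hW : ∀ m, MemLp (W m) 2 μ) (hind : ∀ m n, m ≠ n → IndepFun (W m) (W n) μ) :
    ∫ s, ‖∑ m, W m s‖ ^ 2 ∂μ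
      = ‖∑ m, ∫ s, W m s ∂μ‖ ^ 2 + ∑ m, (∫ s, ‖W m s‖ ^ 2 ∂μ - ‖∫ s, W m s ∂μ‖ ^ 2) := by
  classical
  have hoff : ∀ m n, m ≠ n → ∫ s, W m s * star (W n s) ∂μ
      = (∫ s, W m s ∂μ) * star (∫ s, W n s ∂μ) := fun m n hmn => by
    have h := ((hind m n hmn).comp measurable_id (ψ := star) (by fun_prop)).integral_mul_eq_mul_integral
      (hW m).1 (hW n).star.1
    have h2 : ∫ s, star (W n s) ∂μ = star (∫ s, W n s ∂μ) := integral_conj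
    rw [← h2]
    exact h
  apply Complex.ofReal_injective
  have hterm : ∀ m n, ∫ s, W m s * star (W n s) ∂μ
      = (∫ s, W m s ∂μ) * star (∫ s, W n s ∂μ)
        + if m = n then ((∫ s, ‖W m s‖ ^ 2 ∂μ - ‖∫ s, W m s ∂μ‖ ^ 2 : ℝ) : ℂ) else 0 := by
    intro m n
    split_ifs with h
    · subst h
      rw [Complex.ofReal_sub, ← integral_complex_ofReal, ofReal_norm_sq_eq_mul_star]
      simp_rw [ofReal_norm_sq_eq_mul_star]
      ring
    · rw [hoff m n h, add_zero]
  rw [← integral_complex_ofReal, Complex.ofReal_add]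
  simp_rw [ofReal_norm_sq_eq_mul_star, star_sum, Finset.sum_mul_sum]
  rw [integral_finsetSum _ fun m _ => integrable_finsetSum _ fun n _ =>
    integrable_mul_conj (hW m) (hW n)]
  simp_rw [integral_finsetSum _ fun n _ => integrable_mul_conj (hW _) (hW n), hterm,
    Finset.sum_add_distrib]
  simp

lemma integral_normSq_sub_integral [IsProbabilityMeasure μ] {Z : Ω → ℂ} (hZ : MemLp Z 2 μ) :
    ∫ s, ‖Z s - ∫ t, Z t ∂μ‖ ^ 2 ∂μ = ∫ s, ‖Z s‖ ^ 2 ∂μ - ‖∫ s, Z s ∂μ‖ ^ 2 := by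
  set c := ∫ t, Z t ∂μ with hc
  have hi : Integrable Z μ := hZ.integrable (by norm_num)
  apply Complex.ofReal_injective
  rw [← integral_complex_ofReal, Complex.ofReal_sub, ← integral_complex_ofReal]
  simp_rw [ofReal_norm_sq_eq_mul_star, star_sub, sub_mul, mul_sub]
  have hi' : Integrable (fun s => star (Z s)) μ := hZ.star.integrable (by norm_num)
  have h2 : ∫ s, star (Z s) ∂μ = star c := integral_conj
  have hm := integrable_mul_conj hZ hZ
  have ha : Integrable (fun s => Z s * star (Z s) - Z s * star c) μ := hm.sub (hi.mul_const _)
  have hb : Integrable (fun s => c * star (Z s) - c * star c) μ :=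
    (hi'.const_mul _).sub (integrable_const _)
  rw [integral_sub ha hb, integral_sub hm (hi.mul_const _), integral_sub (hi'.const_mul _) (by fun_prop),
    integral_mul_const, integral_const_mul, h2]
  simp [← hc]

/-- Hölder with `1/4 + 1/4 = 1/2`. Summands of an inner product are products of two Gaussian entries
and have to be square integrable. -/
lemma MemLp.mul_four {f g : Ω → ℂ} (hf : MemLp f 4 μ) (hg : MemLp g 4 μ) :
    MemLp (fun s => f s * g s) 2 μ := by
  have : ENNReal.HolderTriple 4 4 2 := ⟨by
    rw [← two_mul, show (4 : ENNReal) = 2 * 2 by norm_num,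
      ENNReal.mul_inv (by simp) (by simp), ← mul_assoc, ENNReal.mul_inv_cancel (by simp) (by simp),
      one_mul]⟩
  exact hg.mul' hf

end SumMoments

/-! ### Affine functions of two independent `CN(0, 1)` variables -/

/-- An affine function with real coefficients of a pair of complex numbers. -/
def affEntry (ν : ℂ) (c d : ℝ) (z : ℂ × ℂ) : ℂ := ν + c * z.1 + d * z.2

@[fun_prop]
lemma measurable_affEntry (ν : ℂ) (c d : ℝ) : Measurable (affEntry ν c d) := by
  unfold affEntry; fun_prop

lemma memLp_affEntry (ν : ℂ) (c d : ℝ) : MemLp (affEntry ν c d) 4 (stdCN.prod stdCN) := by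
  have h1 := (memLp_affine_stdCN ν c 4).comp_measurePreserving
    (measurePreserving_fst (μ := stdCN) (ν := stdCN))
  have h2 := (memLp_affine_stdCN 0 d 4).comp_measurePreserving
    (measurePreserving_snd (μ := stdCN) (ν := stdCN))
  have h : affEntry ν c d = (fun z : ℂ => ν + c * z) ∘ Prod.fst
      + (fun z : ℂ => 0 + d * z) ∘ Prod.snd := by
    ext z
    simp [affEntry]
  rw [h]
  exact h1.add h2

/-- Integrating the second coordinate first removes it, since it has mean zero. Here `F` plays the
role of a channel estimate, which sees only the first coordinate. -/
lemma integral_mul_affEntry {F : ℂ → ℂ} (hF : MemLp F 2 stdCN) (ν : ℂ) (c d : ℝ) :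
    ∫ z : ℂ × ℂ, F z.1 * affEntry ν c d z ∂stdCN.prod stdCN
      = ∫ z, F z * (ν + c * z) ∂stdCN := by
  have h1 : MemLp (fun z : ℂ × ℂ => F z.1) 2 (stdCN.prod stdCN) :=
    hF.comp_measurePreserving measurePreserving_fst
  have h2 : Integrable (fun z : ℂ × ℂ => F z.1 * affEntry ν c d z) (stdCN.prod stdCN) :=
    h1.integrable_mul ((memLp_affEntry ν c d).mono_exponent (p := 2) (by norm_num))
  rw [integral_prod _ h2]
  simp_rw [integral_const_mul, affEntry, integral_affine_stdCN]

lemma integral_affEntry (ν : ℂ) (c d : ℝ) :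
    ∫ z, affEntry ν c d z ∂stdCN.prod stdCN = ν := by
  have h := integral_mul_affEntry (memLp_const 1) ν c d
  simpa [integral_affine_stdCN] using h

/-- Integrating the second coordinate first leaves its variance `d ^ 2` as an additive term. -/
lemma integral_mul_normSq_affEntry {F : ℂ → ℂ} (hF : MemLp F 4 stdCN) (ν : ℂ) (c d : ℝ) :
    ∫ z : ℂ × ℂ, ‖F z.1 * affEntry ν c d z‖ ^ 2 ∂stdCN.prod stdCN
      = ∫ z, ‖F z * (ν + c * z)‖ ^ 2 ∂stdCN + d ^ 2 * ∫ z, ‖F z‖ ^ 2 ∂stdCN := by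
  have h1 : MemLp (fun z : ℂ × ℂ => F z.1) 4 (stdCN.prod stdCN) :=
    hF.comp_measurePreserving measurePreserving_fst
  rw [integral_prod _ (MemLp.mul_four h1 (memLp_affEntry ν c d)).integrable_norm_pow']
  simp_rw [norm_mul, mul_pow, integral_const_mul, affEntry, integral_normSq_affine_stdCN, mul_add]
  have h2 : Integrable (fun z => ‖F z‖ ^ 2 * ‖ν + c * z‖ ^ 2) stdCN := by
    simpa [mul_pow] using (MemLp.mul_four hF (memLp_affine_stdCN ν c 4)).integrable_norm_pow'
  have h3 : Integrable (fun z => ‖F z‖ ^ 2) stdCN :=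
    (hF.mono_exponent (p := 2) (by norm_num)).integrable_norm_pow'
  rw [integral_add h2 (h3.mul_const _), integral_mul_const, mul_comm (d ^ 2)]

lemma integral_normSq_affEntry (ν : ℂ) (c d : ℝ) :
    ∫ z, ‖affEntry ν c d z‖ ^ 2 ∂stdCN.prod stdCN = ‖ν‖ ^ 2 + c ^ 2 + d ^ 2 := by
  have h := integral_mul_normSq_affEntry (memLp_const 1) ν c d
  simpa [integral_normSq_affine_stdCN] using h

/-! ### Inner products of affine vectors -/

section Vectors

variable {N M : ℕ} (P : Params N)

/-- The random vector whose entries are affine in the rotated entries of user `(X, i)`. -/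
def affVec (X : Side) (i : Fin N) (ν : Fin M → ℂ) (c d : ℝ) (s : Sample N M) : Fin M → ℂ :=
  fun m => affEntry (ν m) c d (rotEntry P (X, i, m) s)

lemma memLp_affVec (X : Side) (i : Fin N) (ν : Fin M → ℂ) (c d : ℝ) (m : Fin M) :
    MemLp (fun s => affVec P X i ν c d s m) 4 (law N M) :=
  (memLp_affEntry (ν m) c d).comp_measurePreserving (measurePreserving_rotEntry P (X, i, m))

lemma integral_comp_rotEntry {E : Type*} [NormedAddCommGroup E] [NormedSpace ℝ E]
    (k : Side × Fin N × Fin M) {F : ℂ × ℂ → E}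
    (hF : AEStronglyMeasurable F (stdCN.prod stdCN)) :
    ∫ s, F (rotEntry P k s) ∂law N M = ∫ z, F z ∂stdCN.prod stdCN := by
  have h := measurePreserving_rotEntry P k
  rw [← h.map_eq, integral_map h.measurable.aemeasurable (h.map_eq ▸ hF)]

lemma aestronglyMeasurable_affEntry {μ : Measure (ℂ × ℂ)} (ν : ℂ) (c d : ℝ) :
    AEStronglyMeasurable (affEntry ν c d) μ :=
  (measurable_affEntry ν c d).aestronglyMeasurable

lemma integral_affVec (X : Side) (i : Fin N) (ν : Fin M → ℂ) (c d : ℝ) (m : Fin M) :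
    ∫ s, affVec P X i ν c d s m ∂law N M = ν m := by
  simp_rw [affVec]
  rw [integral_comp_rotEntry P _ (aestronglyMeasurable_affEntry _ _ _), integral_affEntry]

lemma integral_normSq_affVec (X : Side) (i : Fin N) (ν : Fin M → ℂ) (c d : ℝ) (m : Fin M) :
    ∫ s, ‖affVec P X i ν c d s m‖ ^ 2 ∂law N M = ‖ν m‖ ^ 2 + c ^ 2 + d ^ 2 := by
  simp_rw [affVec]
  rw [integral_comp_rotEntry P _ (F := fun z => ‖affEntry (ν m) c d z‖ ^ 2)
    (by fun_prop), integral_normSq_affEntry]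

/-- One summand of the inner product of two affine vectors. -/
def affProd (X : Side) (i : Fin N) (ν : Fin M → ℂ) (c d : ℝ)
    (Y : Side) (j : Fin N) (ν' : Fin M → ℂ) (c' d' : ℝ) (m : Fin M) (s : Sample N M) : ℂ :=
  star (affVec P X i ν c d s m) * affVec P Y j ν' c' d' s m

variable (X : Side) (i : Fin N) (ν : Fin M → ℂ) (c d : ℝ)
  (Y : Side) (j : Fin N) (ν' : Fin M → ℂ) (c' d' : ℝ)

lemma memLp_affProd (m : Fin M) :
    MemLp (affProd P X i ν c d Y j ν' c' d' m) 2 (law N M) :=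
  MemLp.mul_four (memLp_affVec P X i ν c d m).star (memLp_affVec P Y j ν' c' d' m)

/-- Products at different antennas use disjoint sets of rotated pairs, even when both vectors belong
to one user. -/
lemma indepFun_affProd (m n : Fin M) (hmn : m ≠ n) :
    IndepFun (affProd P X i ν c d Y j ν' c' d' m) (affProd P X i ν c d Y j ν' c' d' n)
      (law N M) := by
  have hne : ∀ (U V : Side) (k l : Fin N), (U, k, m) ≠ (V, l, n) := fun U V k l h =>
    hmn (congrArg (fun x => x.2.2) h)
  have h := (iIndepFun_rotEntry (M := M) P).indepFun_prodMk_prodMk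
    (fun k => (measurePreserving_rotEntry P k).measurable)
    (X, i, m) (Y, j, m) (X, i, n) (Y, j, n) (hne _ _ _ _) (hne _ _ _ _) (hne _ _ _ _) (hne _ _ _ _)
  have hφ : ∀ m : Fin M, Measurable (fun z : (ℂ × ℂ) × (ℂ × ℂ) =>
      star (affEntry (ν m) c d z.1) * affEntry (ν' m) c' d' z.2) := fun m => by fun_prop
  exact h.comp (hφ m) (hφ n)

lemma memLp_dotProduct_affVec :
    MemLp (fun s => star (affVec P X i ν c d s) ⬝ᵥ affVec P Y j ν' c' d' s) 2 (law N M) :=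
  memLp_finsetSum _ fun m _ => memLp_affProd P X i ν c d Y j ν' c' d' m

lemma integrable_corr_affVec :
    Integrable (fun s => corr (affVec P X i ν c d s) (affVec P Y j ν' c' d' s)) (law N M) :=
  (memLp_dotProduct_affVec P X i ν c d Y j ν' c' d').integrable_norm_pow'

lemma integral_dotProduct_affVec :
    ∫ s, star (affVec P X i ν c d s) ⬝ᵥ affVec P Y j ν' c' d' s ∂law N M
      = ∑ m, ∫ s, affProd P X i ν c d Y j ν' c' d' m s ∂law N M :=
  integral_finsetSum _ fun m _ =>
    (memLp_affProd P X i ν c d Y j ν' c' d' m).integrable (by norm_num)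

/-- The split separates a squared mean, which can be of order `M ^ 2`, from a sum of `M` variances.
-/
lemma integral_corr_affVec :
    ∫ s, corr (affVec P X i ν c d s) (affVec P Y j ν' c' d' s) ∂law N M
      = ‖∑ m, ∫ s, affProd P X i ν c d Y j ν' c' d' m s ∂law N M‖ ^ 2
        + ∑ m, (∫ s, ‖affProd P X i ν c d Y j ν' c' d' m s‖ ^ 2 ∂law N M
          - ‖∫ s, affProd P X i ν c d Y j ν' c' d' m s ∂law N M‖ ^ 2) :=
  integral_normSq_sum (memLp_affProd P X i ν c d Y j ν' c' d')
    (indepFun_affProd P X i ν c d Y j ν' c' d')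

variable {X i Y j}

lemma indepFun_affVec (h : (X, i) ≠ (Y, j)) (m : Fin M) :
    IndepFun (fun s => affVec P X i ν c d s m) (fun s => affVec P Y j ν' c' d' s m) (law N M) := by
  have h := (iIndepFun_rotEntry (M := M) P).indepFun (i := (X, i, m)) (j := (Y, j, m))
    (by simpa using h)
  exact h.comp (measurable_affEntry (ν m) c d) (measurable_affEntry (ν' m) c' d')

lemma integral_affProd_of_ne (h : (X, i) ≠ (Y, j)) (m : Fin M) :
    ∫ s, affProd P X i ν c d Y j ν' c' d' m s ∂law N M = star (ν m) * ν' m := by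
  have hi := ((indepFun_affVec P ν c d ν' c' d' h m).comp (φ := star) (ψ := id)
    (by fun_prop) (by fun_prop)).integral_fun_mul_eq_mul_integral
    (memLp_affVec P X i ν c d m).star.1 (memLp_affVec P Y j ν' c' d' m).1
  have hs : ∫ s, star (affVec P X i ν c d s m) ∂law N M = star (ν m) := by
    rw [← integral_affVec P X i ν c d m]
    exact integral_conj
  rw [← hs, ← integral_affVec P Y j ν' c' d' m]
  exact hi

lemma integral_normSq_affProd_of_ne (h : (X, i) ≠ (Y, j)) (m : Fin M) :
    ∫ s, ‖affProd P X i ν c d Y j ν' c' d' m s‖ ^ 2 ∂law N M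
      = (‖ν m‖ ^ 2 + c ^ 2 + d ^ 2) * (‖ν' m‖ ^ 2 + c' ^ 2 + d' ^ 2) := by
  have hi := ((indepFun_affVec P ν c d ν' c' d' h m).comp
    (φ := fun z => ‖z‖ ^ 2) (ψ := fun z => ‖z‖ ^ 2)
    (by fun_prop) (by fun_prop)).integral_fun_mul_eq_mul_integral
    (((by fun_prop : Continuous fun z : ℂ => ‖z‖ ^ 2)).comp_aestronglyMeasurable
      (memLp_affVec P X i ν c d m).1)
    (((by fun_prop : Continuous fun z : ℂ => ‖z‖ ^ 2)).comp_aestronglyMeasurable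
      (memLp_affVec P Y j ν' c' d' m).1)
  rw [← integral_normSq_affVec P X i ν c d m, ← integral_normSq_affVec P Y j ν' c' d' m]
  simp_rw [affProd, norm_mul, norm_star, mul_pow]
  exact hi

/-- The mean correlation of affine vectors of distinct users. -/
lemma integral_corr_affVec_of_ne (h : (X, i) ≠ (Y, j)) :
    ∫ s, corr (affVec P X i ν c d s) (affVec P Y j ν' c' d' s) ∂law N M
      = corr ν ν' + ((c' ^ 2 + d' ^ 2) * sqNorm ν + (c ^ 2 + d ^ 2) * sqNorm ν'
          + M * ((c ^ 2 + d ^ 2) * (c' ^ 2 + d' ^ 2))) := by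
  rw [integral_corr_affVec]
  simp_rw [integral_affProd_of_ne P ν c d ν' c' d' h, integral_normSq_affProd_of_ne P ν c d ν' c' d' h,
    norm_mul, norm_star]
  congr 1
  rw [sqNorm, sqNorm, Finset.mul_sum, Finset.mul_sum, ← Finset.sum_add_distrib]
  have hM : (M : ℝ) * ((c ^ 2 + d ^ 2) * (c' ^ 2 + d' ^ 2))
      = ∑ _m : Fin M, (c ^ 2 + d ^ 2) * (c' ^ 2 + d' ^ 2) := by simp
  rw [hM, ← Finset.sum_add_distrib]
  exact Finset.sum_congr rfl fun m _ => by ring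

lemma integral_dotProduct_affVec_of_ne (h : (X, i) ≠ (Y, j)) :
    ∫ s, star (affVec P X i ν c d s) ⬝ᵥ affVec P Y j ν' c' d' s ∂law N M = star ν ⬝ᵥ ν' := by
  rw [integral_dotProduct_affVec]
  simp_rw [integral_affProd_of_ne P ν c d ν' c' d' h]
  rfl

variable (X i)

/-- The left vector has no second-coordinate part because it stands for a channel estimate; this is
what makes the noise coordinate integrate out. -/
lemma integral_affProd_self (m : Fin M) :
    ∫ s, affProd P X i ν c 0 X i ν' c' d' m s ∂law N M
      = ∫ z, star (ν m + c * z) * (ν' m + c' * z) ∂stdCN := by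
  have h := integral_mul_affEntry ((memLp_affine_stdCN (ν m) c 2).star) (ν' m) c' d'
  simp only [Pi.star_apply] at h
  rw [← h, ← integral_comp_rotEntry P (X, i, m)]
  · simp [affProd, affVec, affEntry]
  · exact (by fun_prop : Measurable _).aestronglyMeasurable

lemma integral_normSq_affProd_self (m : Fin M) :
    ∫ s, ‖affProd P X i ν c 0 X i ν' c' d' m s‖ ^ 2 ∂law N M
      = ∫ z, ‖ν m + c * z‖ ^ 2 * ‖ν' m + c' * z‖ ^ 2 ∂stdCN + d' ^ 2 * (‖ν m‖ ^ 2 + c ^ 2) := by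
  have h := integral_mul_normSq_affEntry ((memLp_affine_stdCN (ν m) c 4).star) (ν' m) c' d'
  simp only [Pi.star_apply, norm_mul, norm_star, mul_pow, integral_normSq_affine_stdCN] at h
  rw [← h, ← integral_comp_rotEntry P (X, i, m)]
  · simp only [affProd, affVec, norm_mul, norm_star, mul_pow]
    simp [affEntry]
  · exact (by fun_prop : Measurable _).aestronglyMeasurable

lemma integral_star_mul_self_stdCN (ν : ℂ) (c : ℝ) :
    ∫ z : ℂ, star (ν + c * z) * (ν + c * z) ∂stdCN = ((‖ν‖ ^ 2 + c ^ 2 : ℝ) : ℂ) := by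
  rw [← integral_normSq_affine_stdCN, ← integral_complex_ofReal]
  simp_rw [ofReal_norm_sq_eq_mul_star, mul_comm]

lemma integral_dotProduct_affVec_self :
    ∫ s, star (affVec P X i ν c 0 s) ⬝ᵥ affVec P X i ν c d' s ∂law N M
      = ((sqNorm ν + M * c ^ 2 : ℝ) : ℂ) := by
  rw [integral_dotProduct_affVec]
  simp_rw [integral_affProd_self, integral_star_mul_self_stdCN, ← Complex.ofReal_sum,
    Finset.sum_add_distrib]
  simp [sqNorm]

/-- The mean correlation of two affine vectors of the same user with the same scattered part. -/
lemma integral_corr_affVec_self :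
    ∫ s, corr (affVec P X i ν c 0 s) (affVec P X i ν c d' s) ∂law N M
      = (sqNorm ν + M * c ^ 2) ^ 2
        + (2 * c ^ 2 * sqNorm ν + M * c ^ 4 + d' ^ 2 * (sqNorm ν + M * c ^ 2)) := by
  have h4 : ∀ ν : ℂ, ∫ z : ℂ, ‖ν + c * z‖ ^ 2 * ‖ν + c * z‖ ^ 2 ∂stdCN
      = ‖ν‖ ^ 4 + 4 * c ^ 2 * ‖ν‖ ^ 2 + 2 * c ^ 4 := fun ν => by
    rw [← integral_norm_pow_four_affine_stdCN]
    simp_rw [← pow_add]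
  rw [integral_corr_affVec, ← integral_dotProduct_affVec, integral_dotProduct_affVec_self]
  simp_rw [integral_normSq_affProd_self, h4, integral_affProd_self, integral_star_mul_self_stdCN,
    Complex.norm_real, Real.norm_eq_abs, sq_abs]
  congr 1
  have hM : ∀ x : ℝ, (M : ℝ) * x = ∑ _m : Fin M, x := by simp
  rw [hM, hM, sqNorm, ← Finset.sum_add_distrib, Finset.mul_sum, Finset.mul_sum,
    ← Finset.sum_add_distrib, ← Finset.sum_add_distrib]
  exact Finset.sum_congr rfl fun m _ => by ring

/-- The mean correlation of affine vectors of the same user with uncorrelated entries. -/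
lemma integral_corr_affVec_zero :
    ∫ s, corr (affVec P X i ν c 0 s) (affVec P X i 0 0 d' s) ∂law N M
      = d' ^ 2 * (sqNorm ν + M * c ^ 2) := by
  rw [integral_corr_affVec]
  simp_rw [integral_normSq_affProd_self, integral_affProd_self]
  have hM : ∀ x : ℝ, (M : ℝ) * x = ∑ _m : Fin M, x := by simp
  rw [hM, sqNorm, ← Finset.sum_add_distrib, Finset.mul_sum]
  simp

lemma integrable_sqNorm_affVec :
    Integrable (fun s => sqNorm (affVec P X i ν c d s)) (law N M) :=
  integrable_finsetSum _ fun m _ =>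
    ((memLp_affVec P X i ν c d m).mono_exponent (p := 2) (by norm_num)).integrable_norm_pow'

lemma integral_sqNorm_affVec :
    ∫ s, sqNorm (affVec P X i ν c d s) ∂law N M = sqNorm ν + M * (c ^ 2 + d ^ 2) := by
  simp_rw [sqNorm]
  rw [integral_finsetSum _ fun m _ =>
    ((memLp_affVec P X i ν c d m).mono_exponent (p := 2) (by norm_num)).integrable_norm_pow']
  simp_rw [integral_normSq_affVec, add_assoc, Finset.sum_add_distrib]
  simp [mul_add]

end Vectors

/-! ### Moments of the signal, interference and noise terms -/

section SystemMoments

variable {N M : ℕ} {P : Params N} {gbar : Side → Fin N → Fin M → ℂ}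

/-- The line-of-sight part of the channel vector. -/
def losVec (P : Params N) (gbar : Side → Fin N → Fin M → ℂ) (X : Side) (i : Fin N) : Fin M → ℂ :=
  fun m => losAmp P X i * gbar X i m

/-- The correlation of the line-of-sight parts of two channels. -/
def losCorr (P : Params N) (gbar : Side → Fin N → Fin M → ℂ) (X : Side) (i : Fin N)
    (Y : Side) (j : Fin N) : ℝ :=
  corr (losVec P gbar X i) (losVec P gbar Y j)

lemma corr_nonneg (a b : Fin M → ℂ) : 0 ≤ corr a b := sq_nonneg _

lemma sqNorm_nonneg (a : Fin M → ℂ) : 0 ≤ sqNorm a := Finset.sum_nonneg fun _ _ => sq_nonneg _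

lemma losCorr_nonneg (X : Side) (i : Fin N) (Y : Side) (j : Fin N) :
    0 ≤ losCorr P gbar X i Y j := corr_nonneg _ _

lemma losCorr_eq (X : Side) (i : Fin N) (Y : Side) (j : Fin N) :
    losCorr P gbar X i Y j
      = losAmp P X i ^ 2 * losAmp P Y j ^ 2 * corr (gbar X i) (gbar Y j) := by
  have h1 : losVec P gbar X i = (losAmp P X i : ℂ) • gbar X i := rfl
  have h2 : losVec P gbar Y j = (losAmp P Y j : ℂ) • gbar Y j := rfl
  rw [losCorr, corr, corr, h1, h2, star_smul, smul_dotProduct, dotProduct_smul]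
  simp [mul_pow]
  ring

lemma sqNorm_losVec (hg : ∀ X i, sqNorm (gbar X i) = M) (X : Side) (i : Fin N) :
    sqNorm (losVec P gbar X i) = losAmp P X i ^ 2 * M := by
  rw [← hg X i]
  simp [sqNorm, losVec, mul_pow, Finset.mul_sum]

lemma chanEst_eq_affVec (hP : P.Valid) (X : Side) (i : Fin N) (s : Sample N M) :
    chanEst P gbar X i s = affVec P X i (losVec P gbar X i) (estAmp P X i) 0 s := by
  ext m
  simp [chanEst_apply gbar hP, affVec, affEntry, losVec]

lemma err_eq_affVec (hP : P.Valid) (X : Side) (i : Fin N) (s : Sample N M) :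
    err P gbar X i s = affVec P X i 0 0 (errAmp P X i) s := by
  ext m
  simp [err_apply gbar hP, affVec, affEntry]

lemma chan_eq_affVec (hP : P.Valid) (X : Side) (i : Fin N) (s : Sample N M) :
    chan P gbar X i s
      = affVec P X i (losVec P gbar X i) (estAmp P X i) (errAmp P X i) s := by
  ext m
  simp [chan_eq_add_err, chanEst_apply gbar hP, err_apply gbar hP, affVec, affEntry, losVec]

/-! ### Closed-form coefficients in terms of amplitudes. -/

section Coefficients

lemma eta_nonneg (hP : P.Valid) (X : Side) (i : Fin N) : 0 ≤ eta P X i := by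
  have h := snr_pos hP X i
  unfold eta; positivity

lemma eta_le_one (hP : P.Valid) (X : Side) (i : Fin N) : eta P X i ≤ 1 := by
  have h := snr_pos hP X i
  unfold eta
  rw [div_le_one (by positivity)]
  linarith

lemma omega_eq (hP : P.Valid) (X : Side) (i : Fin N) :
    omega P X i = losAmp P X i ^ 2 + estAmp P X i ^ 2 := by
  rw [losAmp_sq hP, estAmp_sq hP, omega]
  ring

lemma inv_one_add_snr (hP : P.Valid) (X : Side) (i : Fin N) :
    1 / (1 + P.τ * P.pp * P.β X i) = 1 - eta P X i := by
  have h := snr_pos hP X i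
  unfold eta
  field_simp
  ring

lemma sigmaSq_eq (hP : P.Valid) (X : Side) (i : Fin N) :
    sigmaSq P X i = P.β X i / (P.K X i + 1) * (1 - eta P X i) := by
  rw [← inv_one_add_snr hP, sigmaSq, div_mul_div_comm, mul_one, mul_comm (P.K X i + 1)]

/-- This is the second moment of an estimate entry times that of a channel entry, without the
product of the two line-of-sight powers. That product belongs to the squared mean, so what remains
is a variance per antenna. -/
lemma cross_eq (hP : P.Valid) (X : Side) (i : Fin N) (Y : Side) (j : Fin N) :
    cross P X i Y j
      = (estAmp P Y j ^ 2 + errAmp P Y j ^ 2) * losAmp P X i ^ 2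
        + estAmp P X i ^ 2 * losAmp P Y j ^ 2
        + estAmp P X i ^ 2 * (estAmp P Y j ^ 2 + errAmp P Y j ^ 2) := by
  rw [losAmp_sq hP, estAmp_sq hP, losAmp_sq hP, estAmp_sq hP, errAmp_sq hP, sigmaSq_eq hP, cross,
    ← mul_one_div (P.K X i + eta P X i), inv_one_add_snr hP]
  have h1 := hP.K_nonneg X i
  have h2 := hP.K_nonneg Y j
  field_simp
  ring

lemma omega_nonneg (hP : P.Valid) (X : Side) (i : Fin N) : 0 ≤ omega P X i := by
  rw [omega_eq hP]; positivity

lemma cross_nonneg (hP : P.Valid) (X : Side) (i : Fin N) (Y : Side) (j : Fin N) :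
    0 ≤ cross P X i Y j := by
  rw [cross_eq hP]; positivity

lemma omega_le (hP : P.Valid) (X : Side) (i : Fin N) : omega P X i ≤ P.β X i := by
  have hK := hP.K_nonneg X i
  have h := eta_le_one hP X i
  rw [omega, div_mul_eq_mul_div, div_le_iff₀ (by positivity)]
  exact mul_le_mul_of_nonneg_left (by linarith) (hP.beta_pos X i).le

lemma sigmaSq_nonneg (hP : P.Valid) (X : Side) (i : Fin N) : 0 ≤ sigmaSq P X i := by
  rw [← errAmp_sq hP]; positivity

lemma omega_add_sigmaSq (hP : P.Valid) (X : Side) (i : Fin N) :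
    omega P X i + sigmaSq P X i = P.β X i := by
  have hK := hP.K_nonneg X i
  rw [omega, sigmaSq_eq hP]
  field_simp
  ring

lemma sigmaSq_le (hP : P.Valid) (X : Side) (i : Fin N) : sigmaSq P X i ≤ P.β X i := by
  linarith [omega_add_sigmaSq hP X i, omega_nonneg hP X i]

/-- Restoring the omitted line-of-sight product gives `ω (ω + σ²)`, and `ω + σ² = β`. The bound does
not involve the pilot power, so it is uniform under scaling. -/
lemma cross_le (hP : P.Valid) (X : Side) (i : Fin N) (Y : Side) (j : Fin N) :
    cross P X i Y j ≤ P.β X i * P.β Y j := by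
  have h1 : cross P X i Y j ≤ omega P X i * (omega P Y j + sigmaSq P Y j) := by
    rw [cross_eq hP, omega_eq hP, omega_eq hP, ← errAmp_sq hP]
    nlinarith [mul_nonneg (sq_nonneg (losAmp P X i)) (sq_nonneg (losAmp P Y j))]
  rw [omega_add_sigmaSq hP] at h1
  exact h1.trans (mul_le_mul_of_nonneg_right (omega_le hP X i) (hP.beta_pos Y j).le)

end Coefficients

/-! ### Means and variances of correlations of estimates, errors and channels. -/

section Correlations

lemma integrable_corr_chanEst (hP : P.Valid) (X : Side) (i : Fin N) (Y : Side) (j : Fin N) :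
    Integrable (fun s => corr (chanEst P gbar X i s) (chanEst P gbar Y j s)) (law N M) := by
  simp_rw [chanEst_eq_affVec hP]
  exact integrable_corr_affVec ..

lemma integrable_corr_chanEst_err (hP : P.Valid) (X : Side) (i : Fin N) (Y : Side) (j : Fin N) :
    Integrable (fun s => corr (chanEst P gbar X i s) (err P gbar Y j s)) (law N M) := by
  simp_rw [chanEst_eq_affVec hP, err_eq_affVec hP]
  exact integrable_corr_affVec ..

lemma integrable_corr_chanEst_chan (hP : P.Valid) (X : Side) (i : Fin N) (Y : Side) (j : Fin N) :
    Integrable (fun s => corr (chanEst P gbar X i s) (chan P gbar Y j s)) (law N M) := by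
  simp_rw [chanEst_eq_affVec hP, chan_eq_affVec hP]
  exact integrable_corr_affVec ..

lemma integrable_sqNorm_chanEst (hP : P.Valid) (X : Side) (i : Fin N) :
    Integrable (fun s => sqNorm (chanEst P gbar X i s)) (law N M) := by
  simp_rw [chanEst_eq_affVec hP]
  exact integrable_sqNorm_affVec ..

lemma integral_sqNorm_chanEst (hP : P.Valid) (hg : ∀ X i, sqNorm (gbar X i) = M)
    (X : Side) (i : Fin N) :
    ∫ s, sqNorm (chanEst P gbar X i s) ∂law N M = M * omega P X i := by
  simp_rw [chanEst_eq_affVec hP, integral_sqNorm_affVec, sqNorm_losVec hg, omega_eq hP]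
  ring

lemma integral_corr_chanEst_self (hP : P.Valid) (hg : ∀ X i, sqNorm (gbar X i) = M)
    (X : Side) (i : Fin N) :
    ∫ s, corr (chanEst P gbar X i s) (chanEst P gbar X i s) ∂law N M
      = (M * omega P X i) ^ 2
        + M * (2 * estAmp P X i ^ 2 * losAmp P X i ^ 2 + estAmp P X i ^ 4) := by
  simp_rw [chanEst_eq_affVec hP, integral_corr_affVec_self, sqNorm_losVec hg, omega_eq hP]
  ring

lemma integral_corr_chanEst_of_ne (hP : P.Valid) (hg : ∀ X i, sqNorm (gbar X i) = M)
    {X : Side} {i : Fin N} {Y : Side} {j : Fin N} (h : (X, i) ≠ (Y, j)) :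
    ∫ s, corr (chanEst P gbar X i s) (chanEst P gbar Y j s) ∂law N M
      = losCorr P gbar X i Y j + M * (estAmp P Y j ^ 2 * losAmp P X i ^ 2
        + estAmp P X i ^ 2 * losAmp P Y j ^ 2 + estAmp P X i ^ 2 * estAmp P Y j ^ 2) := by
  simp_rw [chanEst_eq_affVec hP, integral_corr_affVec_of_ne P _ _ _ _ _ _ h, sqNorm_losVec hg,
    losCorr]
  ring

lemma integral_corr_chanEst_err (hP : P.Valid) (hg : ∀ X i, sqNorm (gbar X i) = M)
    (X : Side) (i : Fin N) (Y : Side) (j : Fin N) :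
    ∫ s, corr (chanEst P gbar X i s) (err P gbar Y j s) ∂law N M
      = M * (omega P X i * sigmaSq P Y j) := by
  simp_rw [chanEst_eq_affVec hP, err_eq_affVec hP, omega_eq hP, ← errAmp_sq hP]
  -- For a user's own error, independence comes from the two rotated coordinates; for another user's
  -- error, from distinct entries. The value is the same.
  by_cases h : (X, i) = (Y, j)
  · obtain ⟨rfl, rfl⟩ := Prod.mk.inj h
    rw [integral_corr_affVec_zero, sqNorm_losVec hg]
    ring
  · rw [integral_corr_affVec_of_ne P _ _ _ _ _ _ h, sqNorm_losVec hg]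
    simp [corr, sqNorm]
    ring

lemma integral_corr_chanEst_chan_of_ne (hP : P.Valid) (hg : ∀ X i, sqNorm (gbar X i) = M)
    {X : Side} {i : Fin N} {Y : Side} {j : Fin N} (h : (X, i) ≠ (Y, j)) :
    ∫ s, corr (chanEst P gbar X i s) (chan P gbar Y j s) ∂law N M
      = losCorr P gbar X i Y j + M * cross P X i Y j := by
  simp_rw [chanEst_eq_affVec hP, chan_eq_affVec hP, integral_corr_affVec_of_ne P _ _ _ _ _ _ h,
    sqNorm_losVec hg, cross_eq hP, losCorr]
  ring

lemma gain_eq (X : Side) (i : Fin N) (Y : Side) (j : Fin N) (s : Sample N M) :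
    gain P gbar X i Y j s = star (chanEst P gbar Y j s) ⬝ᵥ chan P gbar X i s :=
  dotProduct_comm _ _

lemma norm_gain_sq (X : Side) (i : Fin N) (Y : Side) (j : Fin N) (s : Sample N M) :
    ‖gain P gbar X i Y j s‖ ^ 2 = corr (chanEst P gbar Y j s) (chan P gbar X i s) := by
  rw [gain_eq, corr]

lemma memLp_gain (hP : P.Valid) (X : Side) (i : Fin N) (Y : Side) (j : Fin N) :
    MemLp (gain P gbar X i Y j) 2 (law N M) := by
  have h : gain P gbar X i Y j
      = fun s => star (chanEst P gbar Y j s) ⬝ᵥ chan P gbar X i s := funext fun s => gain_eq ..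
  rw [h]
  simp_rw [chanEst_eq_affVec hP, chan_eq_affVec hP]
  exact memLp_dotProduct_affVec ..

lemma norm_integral_gain_self_sq (hP : P.Valid) (hg : ∀ X i, sqNorm (gbar X i) = M)
    (X : Side) (i : Fin N) :
    ‖∫ s, gain P gbar X i X i s ∂law N M‖ ^ 2 = (M * omega P X i) ^ 2 := by
  simp_rw [gain_eq, chanEst_eq_affVec hP, chan_eq_affVec hP, integral_dotProduct_affVec_self,
    Complex.norm_real, Real.norm_eq_abs, sq_abs, sqNorm_losVec hg, omega_eq hP]
  ring

/-- The term of order `M ^ 2` is exactly the squared mean and cancels. The rest has the same form as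
the cross terms, so a user's own fluctuation fits into the sum over all pairs. -/
lemma cVar_gain_self (hP : P.Valid) (hg : ∀ X i, sqNorm (gbar X i) = M)
    (X : Side) (i : Fin N) :
    cVar (gain P gbar X i X i) = M * cross P X i X i := by
  rw [cVar, integral_normSq_sub_integral (memLp_gain hP X i X i),
    norm_integral_gain_self_sq hP hg]
  simp_rw [norm_gain_sq, chanEst_eq_affVec hP, chan_eq_affVec hP, integral_corr_affVec_self,
    sqNorm_losVec hg, cross_eq hP, omega_eq hP]
  ring

/-- Centring removes the line-of-sight correlation. It survives only in the uncentred second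
moments, which is why `losDown` omits the pair itself. -/
lemma cVar_gain_of_ne (hP : P.Valid) (hg : ∀ X i, sqNorm (gbar X i) = M)
    {X : Side} {i : Fin N} {Y : Side} {j : Fin N} (h : (Y, j) ≠ (X, i)) :
    cVar (gain P gbar X i Y j) = M * cross P Y j X i := by
  rw [cVar, integral_normSq_sub_integral (memLp_gain hP X i Y j)]
  simp_rw [norm_gain_sq, gain_eq]
  rw [integral_corr_chanEst_chan_of_ne hP hg h]
  simp_rw [chanEst_eq_affVec hP, chan_eq_affVec hP, integral_dotProduct_affVec_of_ne P _ _ _ _ _ _ h,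
    losCorr, corr]
  ring

end Correlations

end SystemMoments

/-! ### The uplink and downlink terms -/

section LinkTerms

variable {N M : ℕ} {P : Params N} {gbar : Side → Fin N → Fin M → ℂ}

lemma sum_side {E : Type*} [AddCommMonoid E] (f : Side → E) : ∑ X, f X = f Side.A + f Side.B :=
  Finset.sum_pair (by decide)

lemma Side.other_ne (X : Side) : X.other ≠ X := by cases X <;> decide

lemma Side.other_prod_ne (X : Side) (i : Fin N) : (X.other, i) ≠ (X, i) :=
  fun h => X.other_ne (congrArg Prod.fst h)

lemma corr_self (a : Fin M → ℂ) : corr a a = sqNorm a ^ 2 := by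
  have h : star a ⬝ᵥ a = ((sqNorm a : ℝ) : ℂ) := by
    simp only [dotProduct, sqNorm, Complex.ofReal_sum, ofReal_norm_sq_eq_mul_star, mul_comm,
      Pi.star_apply]
  rw [corr, h, Complex.norm_real, Real.norm_eq_abs, sq_abs]

lemma corr_le_mul (a b : Fin M → ℂ) : corr a b ≤ sqNorm a * sqNorm b := by
  have h : ‖star a ⬝ᵥ b‖ ≤ ∑ m, ‖a m‖ * ‖b m‖ := by
    refine (norm_sum_le _ _).trans_eq (Finset.sum_congr rfl fun m _ => ?_)
    rw [norm_mul, Pi.star_apply, norm_star]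
  exact (pow_le_pow_left₀ (norm_nonneg _) h 2).trans (Finset.sum_mul_sq_le_sq_mul_sq _ _ _)

/-- The denominator of the closed-form uplink ratios. -/
def upDen (P : Params N) (i : Fin N) : ℝ :=
  (omega P Side.A i + omega P Side.B i) * q P i + Q P i

/-- The denominator of the closed-form downlink ratio. -/
def downDen (P : Params N) (X : Side) (i : Fin N) : ℝ :=
  ∑ j, (omega P Side.A j + omega P Side.B j + Z P X i j)

/-- The line-of-sight contribution to the mean uplink interference. -/
def losUp (P : Params N) (gbar : Side → Fin N → Fin M → ℂ) (i : Fin N) : ℝ :=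
  ∑ j ∈ Finset.univ.erase i,
    (P.p Side.A j * (losCorr P gbar Side.A i Side.A j + losCorr P gbar Side.B i Side.A j)
      + P.p Side.B j * (losCorr P gbar Side.A i Side.B j + losCorr P gbar Side.B i Side.B j))

/-- The line-of-sight contribution to the mean downlink interference. -/
def losDown (P : Params N) (gbar : Side → Fin N → Fin M → ℂ) (X : Side) (i : Fin N) : ℝ :=
  ∑ j ∈ Finset.univ.erase i, (losCorr P gbar Side.B j X i + losCorr P gbar Side.A j X i)

lemma losUp_nonneg (hP : P.Valid) (i : Fin N) : 0 ≤ losUp P gbar i :=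
  Finset.sum_nonneg fun j _ => by
    have h1 := (hP.p_pos Side.A j).le
    have h2 := (hP.p_pos Side.B j).le
    have h := @losCorr_nonneg N M P gbar
    exact add_nonneg (mul_nonneg h1 (add_nonneg (h ..) (h ..)))
      (mul_nonneg h2 (add_nonneg (h ..) (h ..)))

lemma losDown_nonneg (X : Side) (i : Fin N) : 0 ≤ losDown P gbar X i :=
  Finset.sum_nonneg fun _ _ => add_nonneg (losCorr_nonneg ..) (losCorr_nonneg ..)

lemma Q_nonneg (hP : P.Valid) (i : Fin N) : 0 ≤ Q P i :=
  Finset.sum_nonneg fun j _ => by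
    have h1 := (hP.p_pos Side.A j).le
    have h2 := (hP.p_pos Side.B j).le
    have h := cross_nonneg hP
    exact add_nonneg (mul_nonneg h1 (add_nonneg (h ..) (h ..)))
      (mul_nonneg h2 (add_nonneg (h ..) (h ..)))

lemma one_le_q (hP : P.Valid) (i : Fin N) : 1 ≤ q P i := by
  have h1 := mul_nonneg (hP.p_pos Side.A i).le (sigmaSq_nonneg hP Side.A i)
  have h2 := mul_nonneg (hP.p_pos Side.B i).le (sigmaSq_nonneg hP Side.B i)
  unfold q
  linarith

lemma add_omega_le_upDen (hP : P.Valid) (i : Fin N) :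
    omega P Side.A i + omega P Side.B i ≤ upDen P i := by
  have h := mul_le_mul_of_nonneg_left (one_le_q hP i)
    (add_nonneg (omega_nonneg hP Side.A i) (omega_nonneg hP Side.B i))
  have h2 := Q_nonneg hP i
  unfold upDen
  linarith

/-- Keeps the downlink denominator away from zero once `omega` is bounded below. -/
lemma add_omega_le_downDen (hP : P.Valid) (X : Side) (i : Fin N) :
    omega P Side.A i + omega P Side.B i ≤ downDen P X i := by
  have hZ : ∀ j, 0 ≤ Z P X i j := fun j =>
    mul_nonneg hP.pr_pos.le (add_nonneg (cross_nonneg hP ..) (cross_nonneg hP ..))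
  have ho := omega_nonneg hP
  refine le_trans ?_ (Finset.single_le_sum (f := fun j => omega P Side.A j + omega P Side.B j
    + Z P X i j) (fun j _ => ?_) (Finset.mem_univ i))
  · simpa using hZ i
  · exact add_nonneg (add_nonneg (ho _ _) (ho _ _)) (hZ j)

/-- An identity for each `M`, without any limit: dropping the term `losDown` gives the closed-form
ratio. -/
lemma sinrDown_eq (hP : P.Valid) (hg : ∀ X i, sqNorm (gbar X i) = M) (X : Side) (i : Fin N) :
    sinrDown P gbar X i
      = P.pr * (M * omega P X i) ^ 2 / (M * downDen P X i + P.pr * losDown P gbar X i) := by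
  have hint : ∫ s, (∑ j, (sqNorm (chanEst P gbar Side.B j s) + sqNorm (chanEst P gbar Side.A j s)))
      ∂law N M = M * ∑ j, (omega P Side.B j + omega P Side.A j) := by
    have hi := @integrable_sqNorm_chanEst N M P gbar hP
    rw [integral_finsetSum _ fun j _ => by fun_prop, Finset.mul_sum]
    refine Finset.sum_congr rfl fun j _ => ?_
    rw [integral_add (hi _ _) (hi _ _), integral_sqNorm_chanEst hP hg,
      integral_sqNorm_chanEst hP hg, mul_add]
  have hS : 0 ≤ ∑ j, (omega P Side.B j + omega P Side.A j) :=
    Finset.sum_nonneg fun j _ => add_nonneg (omega_nonneg hP _ _) (omega_nonneg hP _ _)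
  have hpr := hP.pr_pos
  have hrho : 1 / rho P gbar ^ 2 = M * (∑ j, (omega P Side.B j + omega P Side.A j)) / P.pr := by
    rw [rho, hint, Real.sq_sqrt (by positivity), one_div_div]
  have hcross : ∀ j ∈ Finset.univ.erase i,
      (∫ s, ‖gain P gbar X i Side.B j s‖ ^ 2 ∂law N M)
            + ∫ s, ‖gain P gbar X i Side.A j s‖ ^ 2 ∂law N M
        = losCorr P gbar Side.B j X i + losCorr P gbar Side.A j X i
          + M * (cross P Side.A j X i + cross P Side.B j X i) := by
    intro j hj
    have hne : ∀ Y, (Y, j) ≠ (X, i) := fun Y h => Finset.ne_of_mem_erase hj (congrArg Prod.snd h)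
    simp_rw [norm_gain_sq]
    rw [integral_corr_chanEst_chan_of_ne hP hg (hne _),
      integral_corr_chanEst_chan_of_ne hP hg (hne _)]
    ring
  have hself : cVar (gain P gbar X i X i) + cVar (gain P gbar X i X.other i)
      = M * (cross P Side.A i X i + cross P Side.B i X i) := by
    rw [cVar_gain_self hP hg,
      cVar_gain_of_ne hP hg (X.other_prod_ne i)]
    cases X <;> simp only [Side.other] <;> ring
  -- Numerator and denominator are multiplied by the relay power, which clears the division in `1 /
  -- ρ ^ 2`.
  rw [sinrDown, norm_integral_gain_self_sq hP hg, hself, Finset.sum_congr rfl hcross, hrho,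
    Finset.sum_add_distrib, ← Finset.mul_sum, ← mul_div_mul_left _ _ hpr.ne']
  congr 1
  -- The two variances of the pair itself supply the missing term `j = i` of the sum.
  have hsum := Finset.add_sum_erase Finset.univ
    (fun j => cross P Side.A j X i + cross P Side.B j X i) (Finset.mem_univ i)
  have hdown : downDen P X i = ∑ j, (omega P Side.B j + omega P Side.A j)
      + P.pr * ∑ j, (cross P Side.A j X i + cross P Side.B j X i) := by
    rw [downDen, Finset.mul_sum, ← Finset.sum_add_distrib]
    refine Finset.sum_congr rfl fun j _ => ?_
    rw [Z, zeta, zeta]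
    ring
  rw [hdown, ← hsum, losDown]
  field_simp
  ring

/-! ### Pointwise bounds and means of the uplink terms. -/

lemma errTerm_nonneg (hP : P.Valid) (i : Fin N) (s : Sample N M) : 0 ≤ errTerm P gbar i s := by
  have h1 := (hP.p_pos Side.A i).le
  have h2 := (hP.p_pos Side.B i).le
  exact add_nonneg (mul_nonneg h1 (add_nonneg (corr_nonneg ..) (corr_nonneg ..)))
      (mul_nonneg h2 (add_nonneg (corr_nonneg ..) (corr_nonneg ..)))

lemma interf_nonneg (hP : P.Valid) (i : Fin N) (s : Sample N M) : 0 ≤ interf P gbar i s :=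
  add_nonneg
    (Finset.sum_nonneg fun j _ =>
      mul_nonneg (hP.p_pos _ j).le (add_nonneg (corr_nonneg ..) (corr_nonneg ..)))
    (Finset.sum_nonneg fun j _ =>
      mul_nonneg (hP.p_pos _ j).le (add_nonneg (corr_nonneg ..) (corr_nonneg ..)))

lemma noise_le_den (hP : P.Valid) (i : Fin N) (s : Sample N M) :
    noise P gbar i s ≤ den P gbar i s := by
  have h1 := errTerm_nonneg (gbar := gbar) hP i s
  have h2 := interf_nonneg (gbar := gbar) hP i s
  unfold den
  linarith

lemma noise_nonneg (i : Fin N) (s : Sample N M) : 0 ≤ noise P gbar i s :=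
  add_nonneg (sqNorm_nonneg _) (sqNorm_nonneg _)

lemma den_nonneg (hP : P.Valid) (i : Fin N) (s : Sample N M) : 0 ≤ den P gbar i s :=
  (noise_nonneg i s).trans (noise_le_den hP i s)

lemma sig_eq (X : Side) (i : Fin N) (s : Sample N M) :
    sig P gbar X i s = P.p X i * (sqNorm (chanEst P gbar X i s) ^ 2
      + corr (chanEst P gbar X.other i s) (chanEst P gbar X i s)) := by
  rw [← corr_self]
  cases X <;> simp only [sig, Side.other]
  ring

lemma sig_nonneg (hP : P.Valid) (X : Side) (i : Fin N) (s : Sample N M) :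
    0 ≤ sig P gbar X i s :=
  mul_nonneg (hP.p_pos X i).le (add_nonneg (corr_nonneg ..) (corr_nonneg ..))

/-- The signal-to-interference ratio never exceeds the signal-to-noise ratio of maximum ratio
combining. -/
lemma sig_le_mul_den (hP : P.Valid) (X : Side) (i : Fin N) (s : Sample N M) :
    sig P gbar X i s ≤ P.p X i * sqNorm (chanEst P gbar X i s) * den P gbar i s := by
  have hn : sqNorm (chanEst P gbar X i s) + sqNorm (chanEst P gbar X.other i s)
      = noise P gbar i s := by
    cases X <;> simp only [noise, Side.other]
    ring
  have hd := noise_le_den (gbar := gbar) hP i s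
  have hc := corr_le_mul (chanEst P gbar X.other i s) (chanEst P gbar X i s)
  rw [sig_eq, mul_assoc]
  refine mul_le_mul_of_nonneg_left ?_ (hP.p_pos X i).le
  -- By Cauchy–Schwarz both correlations share the factor `‖ĥ_X‖²`; the cofactors add up to the
  -- noise term.
  calc _ ≤ sqNorm (chanEst P gbar X i s) * noise P gbar i s := by rw [← hn]; linarith
    _ ≤ _ := mul_le_mul_of_nonneg_left hd (sqNorm_nonneg _)

lemma integrable_sig (hP : P.Valid) (X : Side) (i : Fin N) :
    Integrable (sig P gbar X i) (law N M) :=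
  ((integrable_corr_chanEst hP _ _ _ _).add (integrable_corr_chanEst hP _ _ _ _)).const_mul _

lemma integrable_errTerm (hP : P.Valid) (i : Fin N) :
    Integrable (errTerm P gbar i) (law N M) :=
  (((integrable_corr_chanEst_err hP _ _ _ _).add
    (integrable_corr_chanEst_err hP _ _ _ _)).const_mul _).add
    (((integrable_corr_chanEst_err hP _ _ _ _).add
    (integrable_corr_chanEst_err hP _ _ _ _)).const_mul _)

lemma integrable_interf_term (hP : P.Valid) (i : Fin N) (Y : Side) (j : Fin N) :
    Integrable (fun s => P.p Y j * (corr (chanEst P gbar Side.A i s) (chan P gbar Y j s)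
      + corr (chanEst P gbar Side.B i s) (chan P gbar Y j s))) (law N M) :=
  ((integrable_corr_chanEst_chan hP _ _ _ _).add
    (integrable_corr_chanEst_chan hP _ _ _ _)).const_mul _

lemma integrable_interf (hP : P.Valid) (i : Fin N) :
    Integrable (interf P gbar i) (law N M) :=
  (integrable_finsetSum _ fun j _ => integrable_interf_term hP i Side.A j).add
    (integrable_finsetSum _ fun j _ => integrable_interf_term hP i Side.B j)

lemma integrable_noise (hP : P.Valid) (i : Fin N) :
    Integrable (noise P gbar i) (law N M) :=
  (integrable_sqNorm_chanEst hP _ _).add (integrable_sqNorm_chanEst hP _ _)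

lemma integrable_den (hP : P.Valid) (i : Fin N) :
    Integrable (den P gbar i) (law N M) :=
  ((integrable_errTerm hP i).add (integrable_interf hP i)).add (integrable_noise hP i)

lemma integral_noise (hP : P.Valid) (hg : ∀ X i, sqNorm (gbar X i) = M) (i : Fin N) :
    ∫ s, noise P gbar i s ∂law N M = M * (omega P Side.A i + omega P Side.B i) := by
  simp_rw [noise]
  rw [integral_add (integrable_sqNorm_chanEst hP _ _) (integrable_sqNorm_chanEst hP _ _),
    integral_sqNorm_chanEst hP hg, integral_sqNorm_chanEst hP hg]
  ring

lemma integral_errTerm (hP : P.Valid) (hg : ∀ X i, sqNorm (gbar X i) = M) (i : Fin N) :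
    ∫ s, errTerm P gbar i s ∂law N M
      = M * ((omega P Side.A i + omega P Side.B i) * (q P i - 1)) := by
  have hi := @integrable_corr_chanEst_err N M P gbar hP
  simp_rw [errTerm]
  rw [integral_add (by fun_prop) (by fun_prop), integral_const_mul, integral_const_mul,
    integral_add (hi _ _ _ _) (hi _ _ _ _), integral_add (hi _ _ _ _) (hi _ _ _ _)]
  simp_rw [integral_corr_chanEst_err hP hg, q]
  ring

lemma integral_interf (hP : P.Valid) (hg : ∀ X i, sqNorm (gbar X i) = M) (i : Fin N) :
    ∫ s, interf P gbar i s ∂law N M = M * Q P i + losUp P gbar i := by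
  have hi := @integrable_corr_chanEst_chan N M P gbar hP
  have ht := @integrable_interf_term N M P gbar hP i
  simp_rw [interf]
  rw [integral_add (integrable_finsetSum _ fun j _ => ht _ j)
    (integrable_finsetSum _ fun j _ => ht _ j), integral_finsetSum _ fun j _ => ht _ j,
    integral_finsetSum _ fun j _ => ht _ j, ← Finset.sum_add_distrib, Q, losUp, Finset.mul_sum,
    ← Finset.sum_add_distrib]
  refine Finset.sum_congr rfl fun j hj => ?_
  have hne : ∀ X Y : Side, (X, i) ≠ (Y, j) := fun X Y h =>
    Finset.ne_of_mem_erase hj (congrArg Prod.snd h.symm)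
  rw [integral_const_mul, integral_const_mul, integral_add (hi _ _ _ _) (hi _ _ _ _),
    integral_add (hi _ _ _ _) (hi _ _ _ _)]
  simp_rw [integral_corr_chanEst_chan_of_ne hP hg (hne _ _), xi, chi]
  ring

lemma integral_den (hP : P.Valid) (hg : ∀ X i, sqNorm (gbar X i) = M) (i : Fin N) :
    ∫ s, den P gbar i s ∂law N M = M * upDen P i + losUp P gbar i := by
  have h : ∫ s, den P gbar i s ∂law N M
      = ∫ s, errTerm P gbar i s ∂law N M + ∫ s, interf P gbar i s ∂law N M
        + ∫ s, noise P gbar i s ∂law N M := by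
    have h1 := integrable_errTerm (gbar := gbar) hP i
    have h2 := integrable_interf (gbar := gbar) hP i
    have h3 := integrable_noise (gbar := gbar) hP i
    simp_rw [den]
    rw [integral_add (by fun_prop) (by fun_prop), integral_add (by fun_prop) (by fun_prop)]
  rw [h, integral_errTerm hP hg, integral_interf hP hg, integral_noise hP hg, upDen]
  ring

/-! ### Concentration in mean -/

/-- Integrating `|f| ≤ f ^ 2 / (2 c) + c / 2`, which is `(|f| - c) ^ 2 ≥ 0`, replaces the
Cauchy–Schwarz inequality. -/
lemma integral_abs_le_of_integral_sq_le {Ω : Type*} [MeasurableSpace Ω] {μ : Measure Ω}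
    [IsProbabilityMeasure μ] {f : Ω → ℝ} (hf : Integrable f μ)
    (hf2 : Integrable (fun s => f s ^ 2) μ) {c : ℝ} (hc : 0 < c)
    (h : ∫ s, f s ^ 2 ∂μ ≤ c ^ 2) : ∫ s, |f s| ∂μ ≤ c := by
  have hpt : ∀ s, |f s| ≤ (1 / (2 * c)) * f s ^ 2 + c / 2 := fun s => by
    have h2 : (1 / (2 * c)) * f s ^ 2 + c / 2 - |f s| = (|f s| - c) ^ 2 / (2 * c) := by
      rw [← sq_abs (f s)]
      field_simp
      ring
    have h3 : 0 ≤ (|f s| - c) ^ 2 / (2 * c) := by positivity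
    linarith
  calc ∫ s, |f s| ∂μ ≤ ∫ s, ((1 / (2 * c)) * f s ^ 2 + c / 2) ∂μ :=
        integral_mono hf.abs ((hf2.const_mul _).add (integrable_const _)) hpt
    _ = (1 / (2 * c)) * ∫ s, f s ^ 2 ∂μ + c / 2 := by
        rw [integral_add (hf2.const_mul _) (integrable_const _), integral_const_mul]
        simp
    _ ≤ (1 / (2 * c)) * c ^ 2 + c / 2 := by gcongr
    _ = c := by field_simp; ring

lemma integrable_sqNorm_chanEst_sq (hP : P.Valid) (X : Side) (i : Fin N) :
    Integrable (fun s => sqNorm (chanEst P gbar X i s) ^ 2) (law N M) := by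
  simp_rw [← corr_self]
  exact integrable_corr_chanEst hP X i X i

lemma integral_sqNorm_chanEst_sq_le (hP : P.Valid) (hg : ∀ X i, sqNorm (gbar X i) = M)
    (X : Side) (i : Fin N) :
    ∫ s, sqNorm (chanEst P gbar X i s) ^ 2 ∂law N M
      ≤ (M * omega P X i) ^ 2 + M * omega P X i ^ 2 := by
  simp_rw [← corr_self]
  rw [integral_corr_chanEst_self hP hg, omega_eq hP]
  have : 2 * estAmp P X i ^ 2 * losAmp P X i ^ 2 + estAmp P X i ^ 4
      ≤ (losAmp P X i ^ 2 + estAmp P X i ^ 2) ^ 2 := by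
    nlinarith [sq_nonneg (losAmp P X i ^ 2)]
  gcongr

lemma integral_sqNorm_chanEst_sub_sq_le (hP : P.Valid) (hg : ∀ X i, sqNorm (gbar X i) = M)
    (X : Side) (i : Fin N) :
    ∫ s, (sqNorm (chanEst P gbar X i s) - M * omega P X i) ^ 2 ∂law N M
      ≤ M * omega P X i ^ 2 := by
  have h1 := integrable_sqNorm_chanEst (gbar := gbar) hP X i
  have h2 := integrable_sqNorm_chanEst_sq (gbar := gbar) hP X i
  have h : ∀ s : Sample N M, (sqNorm (chanEst P gbar X i s) - M * omega P X i) ^ 2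
      = sqNorm (chanEst P gbar X i s) ^ 2
        - 2 * (M * omega P X i) * sqNorm (chanEst P gbar X i s) + (M * omega P X i) ^ 2 :=
    fun s => by ring
  simp_rw [h]
  rw [integral_add (by fun_prop) (by fun_prop),
    integral_sub (by fun_prop) (by fun_prop), integral_const_mul, integral_sqNorm_chanEst hP hg]
  have := integral_sqNorm_chanEst_sq_le hP hg X i
  simp
  linarith

lemma integrable_sqNorm_chanEst_sub_sq (hP : P.Valid) (X : Side) (i : Fin N) (c : ℝ) :
    Integrable (fun s => (sqNorm (chanEst P gbar X i s) - c) ^ 2) (law N M) := by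
  have h1 := integrable_sqNorm_chanEst (gbar := gbar) hP X i
  have h2 := integrable_sqNorm_chanEst_sq (gbar := gbar) hP X i
  have h : ∀ s : Sample N M, (sqNorm (chanEst P gbar X i s) - c) ^ 2
      = sqNorm (chanEst P gbar X i s) ^ 2
        - 2 * c * sqNorm (chanEst P gbar X i s) + c ^ 2 :=
    fun s => by ring
  simp_rw [h]
  exact (h2.sub (h1.const_mul _)).add (integrable_const _)

lemma integral_abs_sqNorm_chanEst_sub_le (hP : P.Valid) (hg : ∀ X i, sqNorm (gbar X i) = M)
    (hM : 0 < M) (X : Side) (i : Fin N) (hω : 0 < omega P X i) :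
    ∫ s, |sqNorm (chanEst P gbar X i s) - M * omega P X i| ∂law N M ≤ √M * omega P X i := by
  have hM' : (0 : ℝ) < M := by exact_mod_cast hM
  refine integral_abs_le_of_integral_sq_le
    ((integrable_sqNorm_chanEst hP X i).sub (integrable_const _))
    (integrable_sqNorm_chanEst_sub_sq hP X i _) (by positivity) ?_
  rw [mul_pow, Real.sq_sqrt hM'.le]
  exact integral_sqNorm_chanEst_sub_sq_le hP hg X i

/-- With `n` the squared norm and `m` its mean, `n ^ 2 - m ^ 2 = (n - m) ^ 2 + 2 m (n - m)`, which
is of order `M √M` in mean. The correlation with the partner's estimate is nonnegative, so its mean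
bounds its contribution. -/
lemma integral_abs_sig_sub_le (hP : P.Valid) (hg : ∀ X i, sqNorm (gbar X i) = M)
    (hM : 0 < M) (X : Side) (i : Fin N) (hω : 0 < omega P X i) :
    ∫ s, |sig P gbar X i s - (M : ℝ) ^ 2 * (P.p X i * omega P X i ^ 2)| ∂law N M
      ≤ P.p X i * (3 * (M * √M) * omega P X i ^ 2
        + (losCorr P gbar X.other i X i + M * (omega P X.other i * omega P X i))) := by
  have hM' : (1 : ℝ) ≤ M := by exact_mod_cast hM
  have hp := hP.p_pos X i
  set n := fun s : Sample N M => sqNorm (chanEst P gbar X i s) with hn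
  set m := M * omega P X i with hm
  have hm0 : 0 < m := by positivity
  have hc := integrable_corr_chanEst (gbar := gbar) hP X.other i X i
  have h1 : Integrable (fun s => (n s - m) ^ 2) (law N M) :=
    integrable_sqNorm_chanEst_sub_sq hP X i m
  have h2 : Integrable (fun s => |n s - m|) (law N M) :=
    ((integrable_sqNorm_chanEst hP X i).sub (integrable_const _)).abs
  have hpt : ∀ s, |sig P gbar X i s - (M : ℝ) ^ 2 * (P.p X i * omega P X i ^ 2)|
      ≤ P.p X i * (((n s - m) ^ 2 + 2 * m * |n s - m|)
        + corr (chanEst P gbar X.other i s) (chanEst P gbar X i s)) := fun s => by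
    have he : sig P gbar X i s - (M : ℝ) ^ 2 * (P.p X i * omega P X i ^ 2)
        = P.p X i * ((n s - m) ^ 2 + 2 * m * (n s - m)
          + corr (chanEst P gbar X.other i s) (chanEst P gbar X i s)) := by
      rw [sig_eq]; simp only [hn, hm]; ring
    rw [he, abs_mul, abs_of_pos hp]
    refine mul_le_mul_of_nonneg_left ?_ hp.le
    refine (abs_add_le _ _).trans (add_le_add ((abs_add_le _ _).trans (add_le_add ?_ ?_)) ?_)
    · rw [abs_of_nonneg (sq_nonneg _)]
    · rw [abs_mul, abs_of_pos (by positivity : 0 < 2 * m)]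
    · rw [abs_of_nonneg (corr_nonneg _ _)]
  have hcorr : ∫ s, corr (chanEst P gbar X.other i s) (chanEst P gbar X i s) ∂law N M
      ≤ losCorr P gbar X.other i X i + M * (omega P X.other i * omega P X i) := by
    rw [integral_corr_chanEst_of_ne hP hg (X.other_prod_ne i),
      omega_eq hP, omega_eq hP]
    gcongr
    nlinarith [mul_nonneg (sq_nonneg (losAmp P X i)) (sq_nonneg (losAmp P X.other i))]
  have hs : √(M : ℝ) * √M = M := Real.mul_self_sqrt (by positivity)
  have hs1 : 1 ≤ √(M : ℝ) := Real.one_le_sqrt.2 hM'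
  calc _ ≤ ∫ s, P.p X i * (((n s - m) ^ 2 + 2 * m * |n s - m|)
        + corr (chanEst P gbar X.other i s) (chanEst P gbar X i s)) ∂law N M :=
        integral_mono (((integrable_sig hP X i).sub (integrable_const _)).abs)
          (((h1.add (h2.const_mul _)).add hc).const_mul _) hpt
    _ = P.p X i * ((∫ s, (n s - m) ^ 2 ∂law N M + 2 * m * ∫ s, |n s - m| ∂law N M)
        + ∫ s, corr (chanEst P gbar X.other i s) (chanEst P gbar X i s) ∂law N M) := by
        rw [integral_const_mul, integral_add (by fun_prop) (by fun_prop),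
          integral_add (by fun_prop) (by fun_prop), integral_const_mul]
    _ ≤ P.p X i * ((M * omega P X i ^ 2 + 2 * m * (√M * omega P X i))
        + (losCorr P gbar X.other i X i + M * (omega P X.other i * omega P X i))) := by
        gcongr
        · exact integral_sqNorm_chanEst_sub_sq_le hP hg X i
        · exact integral_abs_sqNorm_chanEst_sub_le hP hg hM X i hω
    _ ≤ _ := by
        gcongr
        -- The constant 3 is 1 from the squared deviation, enlarged from `M` to `M √M`, plus 2 from
        -- the linear term.
        have : (M : ℝ) * omega P X i ^ 2 ≤ M * √M * omega P X i ^ 2 := by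
          gcongr
          exact le_mul_of_one_le_right (by positivity) hs1
        rw [hm]
        linarith

/-- Only the noise part is shown to concentrate. Error and interference are nonnegative, so their
absolute mean is their mean; it enters once as a random term and once through `upDen`, whence the
factor 2. -/
lemma integral_abs_den_sub_le (hP : P.Valid) (hg : ∀ X i, sqNorm (gbar X i) = M)
    (hM : 0 < M) (i : Fin N) (hω : ∀ X, 0 < omega P X i) :
    ∫ s, |den P gbar i s - M * upDen P i| ∂law N M
      ≤ √M * (omega P Side.A i + omega P Side.B i)
        + 2 * M * (upDen P i - (omega P Side.A i + omega P Side.B i)) + losUp P gbar i := by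
  set n := fun X (s : Sample N M) => |sqNorm (chanEst P gbar X i s) - M * omega P X i| with hn
  set o := omega P Side.A i + omega P Side.B i with ho
  have hi : ∀ X, Integrable (n X) (law N M) := fun X =>
    ((integrable_sqNorm_chanEst hP X i).sub (integrable_const _)).abs
  have hod : 0 ≤ M * (upDen P i - o) :=
    mul_nonneg (Nat.cast_nonneg _) (sub_nonneg.2 (add_omega_le_upDen hP i))
  have hd := integrable_den (gbar := gbar) hP i
  have hno := integrable_noise (gbar := gbar) hP i
  have hpt : ∀ s, |den P gbar i s - M * upDen P i|
      ≤ ((n Side.A s + n Side.B s) + (den P gbar i s - noise P gbar i s))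
        + M * (upDen P i - o) := fun s => by
    have he : den P gbar i s - M * upDen P i
        = (((sqNorm (chanEst P gbar Side.A i s) - M * omega P Side.A i)
          + (sqNorm (chanEst P gbar Side.B i s) - M * omega P Side.B i))
          + (den P gbar i s - noise P gbar i s)) + (-(M * (upDen P i - o))) := by
      rw [noise, ho]; ring
    rw [he]
    refine (abs_add_le _ _).trans (add_le_add ((abs_add_le _ _).trans
      (add_le_add (abs_add_le _ _) ?_)) ?_)
    · rw [abs_of_nonneg (sub_nonneg.2 (noise_le_den hP i s))]
    · rw [abs_neg, abs_of_nonneg hod]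
  have hA := integral_abs_sqNorm_chanEst_sub_le hP hg hM Side.A i (hω _)
  have hB := integral_abs_sqNorm_chanEst_sub_le hP hg hM Side.B i (hω _)
  calc _ ≤ ∫ s, (((n Side.A s + n Side.B s) + (den P gbar i s - noise P gbar i s))
        + M * (upDen P i - o)) ∂law N M :=
        integral_mono ((hd.sub (integrable_const _)).abs)
          ((((hi _).add (hi _)).add (hd.sub hno)).add (integrable_const _)) hpt
    _ = ((∫ s, n Side.A s ∂law N M + ∫ s, n Side.B s ∂law N M)
        + (∫ s, den P gbar i s ∂law N M - ∫ s, noise P gbar i s ∂law N M))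
        + M * (upDen P i - o) := by
        rw [integral_add (by fun_prop) (by fun_prop), integral_add (by fun_prop) (by fun_prop),
          integral_add (by fun_prop) (by fun_prop), integral_sub (by fun_prop) (by fun_prop)]
        simp
    _ ≤ _ := by
        rw [integral_den hP hg, integral_noise hP hg]
        rw [ho] at *
        linarith

end LinkTerms

/-! ### Logarithms of perturbed ratios -/

section LogBounds

/-- Bernoulli's inequality compares `1 + s r` with `(1 + s) ^ r`, in opposite directions for `r ≥ 1`
and `r ≤ 1`. This relative bound remains useful when `s` tends to zero. -/
lemma abs_log_one_add_mul_sub_le_mul {s r : ℝ} (hs : 0 < s) (hr : 0 ≤ r) :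
    |Real.log (1 + s * r) - Real.log (1 + s)| ≤ Real.log (1 + s) * |r - 1| := by
  have hs1 : 0 < 1 + s := by linarith
  have hsr : 0 < 1 + s * r := by positivity
  have hlog : Real.log ((1 + s) ^ r) = r * Real.log (1 + s) := Real.log_rpow hs1 r
  have hL : 0 ≤ Real.log (1 + s) := Real.log_nonneg (by linarith)
  rcases le_total 1 r with h | h
  · have h1 : Real.log (1 + s) ≤ Real.log (1 + s * r) :=
      Real.log_le_log hs1 (by nlinarith)
    have h2 : Real.log (1 + s * r) ≤ r * Real.log (1 + s) := by
      rw [← hlog, mul_comm s r]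
      exact Real.log_le_log (by linarith [mul_comm s r])
        (one_add_mul_self_le_rpow_one_add (by linarith) h)
    rw [abs_of_nonneg (by linarith), abs_of_nonneg (by linarith)]
    linarith
  · have h1 : Real.log (1 + s * r) ≤ Real.log (1 + s) :=
      Real.log_le_log hsr (by nlinarith)
    have h2 : r * Real.log (1 + s) ≤ Real.log (1 + s * r) := by
      rw [← hlog, mul_comm s r]
      exact Real.log_le_log (by positivity)
        (rpow_one_add_le_one_add_mul_self (by linarith) hr h)
    rw [abs_of_nonpos (by linarith), abs_of_nonpos (by linarith)]
    linarith

/-- The quotient `(1 + s r) / (1 + s)` lies between 1 and `r`. This absolute bound is uniform in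
`s`. -/
lemma abs_log_one_add_mul_sub_le_abs_log {s r : ℝ} (hs : 0 < s) (hr : 0 < r) :
    |Real.log (1 + s * r) - Real.log (1 + s)| ≤ |Real.log r| := by
  have hs1 : 0 < 1 + s := by linarith
  have hsr : 0 < 1 + s * r := by positivity
  rcases le_total 1 r with h | h
  · have h1 : Real.log (1 + s) ≤ Real.log (1 + s * r) := Real.log_le_log hs1 (by nlinarith)
    rw [abs_of_nonneg (by linarith), abs_of_nonneg (Real.log_nonneg h), sub_le_iff_le_add,
      ← Real.log_mul hr.ne' hs1.ne']
    exact Real.log_le_log hsr (by linarith)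
  · have h1 : Real.log (1 + s * r) ≤ Real.log (1 + s) := Real.log_le_log hsr (by nlinarith)
    rw [abs_of_nonpos (by linarith), abs_of_nonpos (Real.log_nonpos hr.le h)]
    have h2 : Real.log (r * (1 + s)) ≤ Real.log (1 + s * r) :=
      Real.log_le_log (by positivity) (by linarith)
    rw [Real.log_mul hr.ne' hs1.ne'] at h2
    linarith

lemma log_one_add_mul_le_add {s r V : ℝ} (hs : 0 < s) (hr : 0 ≤ r) (hV : 0 ≤ V) (h : r ≤ V) :
    Real.log (1 + s * r) ≤ Real.log (1 + s) + V := by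
  have hs1 : 0 < 1 + s := by linarith
  have hV1 : 0 < 1 + V := by linarith
  have h1 := Real.log_le_sub_one_of_pos hV1
  have h2 : Real.log (1 + s * r) ≤ Real.log ((1 + s) * (1 + V)) :=
    Real.log_le_log (by positivity) (by nlinarith)
  rw [Real.log_mul hs1.ne' hV1.ne'] at h2
  linarith

lemma abs_div_sub_one_le {x y δ : ℝ} (hδ : δ ≤ 1 / 2) (hx : |x - 1| ≤ δ) (hy : |y - 1| ≤ δ) :
    |x / y - 1| ≤ 4 * δ := by
  rw [abs_le] at *
  have hy0 : 0 < y := by linarith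
  constructor
  · rw [le_sub_iff_add_le, le_div_iff₀ hy0]
    nlinarith
  · rw [sub_le_iff_le_add, div_le_iff₀ hy0]
    nlinarith

lemma abs_log_div_le {x y δ : ℝ} (hδ : δ ≤ 1 / 2) (hx : |x - 1| ≤ δ) (hy : |y - 1| ≤ δ) :
    |Real.log (x / y)| ≤ 4 * δ := by
  have h1 := (abs_le.1 (abs_div_sub_one_le hδ hx hy)).2
  have h2 := (abs_le.1 (abs_div_sub_one_le hδ hy hx)).2
  have hx0 : 0 < x := by linarith [(abs_le.1 hx).1]
  have hy0 : 0 < y := by linarith [(abs_le.1 hy).1]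
  have h3 := Real.log_le_sub_one_of_pos (div_pos hx0 hy0)
  have h4 := Real.log_le_sub_one_of_pos (div_pos hy0 hx0)
  rw [← inv_div, Real.log_inv] at h4
  rw [inv_div] at h4
  rw [abs_le]
  constructor <;> linarith

/-- Truncation in algebraic form: on a rare event `V` costs `1 / η` times the event, while the
excess is paid by a small multiple of the second moment. -/
lemma le_inv_add_mul_sq {V η : ℝ} (hη : 0 < η) : V ≤ 1 / η + η * V ^ 2 := by
  have h : 1 / η + η * V ^ 2 - V = ((1 - η * V) ^ 2 + 1 + (η * V) ^ 2) / (2 * η) := by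
    field_simp
    ring
  have : 0 ≤ ((1 - η * V) ^ 2 + 1 + (η * V) ^ 2) / (2 * η) := by positivity
  linarith

/-- Outside the event that both factors are within `δ` of `1`, a ratio dominated by `V` contributes
at most the terms with `1 / δ`. -/
lemma abs_div_sub_one_le_of_le_mul {x y V δ η : ℝ} (hx : 0 ≤ x) (hy : 0 ≤ y) (hV : 0 ≤ V)
    (h : x ≤ V * y) (hδ0 : 0 < δ) (hδ : δ ≤ 1 / 2) (hη : 0 < η) :
    |x / y - 1| ≤ 4 * δ + (1 + 1 / η) * ((|x - 1| + |y - 1|) / δ) + η * V ^ 2 := by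
  have hx1 := abs_nonneg (x - 1)
  have hy1 := abs_nonneg (y - 1)
  have hη' : 0 < 1 / η := by positivity
  have hηV : 0 ≤ η * V ^ 2 := by positivity
  by_cases hD : |x - 1| + |y - 1| ≤ δ
  · have h1 := abs_div_sub_one_le hδ (by linarith : |x - 1| ≤ δ) (by linarith : |y - 1| ≤ δ)
    have h2 : 0 ≤ (1 + 1 / η) * ((|x - 1| + |y - 1|) / δ) := by positivity
    linarith
  · have hD' : 1 ≤ (|x - 1| + |y - 1|) / δ := by
      rw [one_le_div hδ0]; linarith
    have hr : x / y ≤ V := div_le_of_le_mul₀ hy hV h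
    have hr0 : 0 ≤ x / y := div_nonneg hx hy
    have h1 : |x / y - 1| ≤ 1 + V := by rw [abs_le]; constructor <;> linarith
    have h2 := le_inv_add_mul_sq (V := V) hη
    have h3 : (1 + 1 / η) * 1 ≤ (1 + 1 / η) * ((|x - 1| + |y - 1|) / δ) := by gcongr
    linarith

/-- On the good event the bound by `|log (x / y)|` makes the main term `4 δ` free of `log (1 + s)`;
that logarithm multiplies only the deviation. -/
lemma abs_log_one_add_mul_div_sub_le {s x y V δ η : ℝ} (hs : 0 < s) (hx : 0 ≤ x) (hy : 0 ≤ y)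
    (hV : 0 ≤ V) (h : x ≤ V * y) (hδ0 : 0 < δ) (hδ : δ ≤ 1 / 2) (hη : 0 < η) :
    |Real.log (1 + s * (x / y)) - Real.log (1 + s)|
      ≤ 4 * δ + (Real.log (1 + s) + 1 / η) * ((|x - 1| + |y - 1|) / δ) + η * V ^ 2 := by
  have hL : 0 ≤ Real.log (1 + s) := Real.log_nonneg (by linarith)
  have hx1 := abs_nonneg (x - 1)
  have hy1 := abs_nonneg (y - 1)
  have hη' : 0 < 1 / η := by positivity
  have hηV : 0 ≤ η * V ^ 2 := by positivity
  by_cases hD : |x - 1| + |y - 1| ≤ δ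
  · have hxδ : |x - 1| ≤ δ := by linarith
    have hyδ : |y - 1| ≤ δ := by linarith
    have hx0 : 0 < x := by linarith [(abs_le.1 hxδ).1]
    have hy0 : 0 < y := by linarith [(abs_le.1 hyδ).1]
    have h1 := (abs_log_one_add_mul_sub_le_abs_log hs (div_pos hx0 hy0)).trans
      (abs_log_div_le hδ hxδ hyδ)
    have h2 : 0 ≤ (Real.log (1 + s) + 1 / η) * ((|x - 1| + |y - 1|) / δ) := by positivity
    linarith
  · have hD' : 1 ≤ (|x - 1| + |y - 1|) / δ := by
      rw [one_le_div hδ0]; linarith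
    have hr : x / y ≤ V := div_le_of_le_mul₀ hy hV h
    have hr0 : 0 ≤ x / y := div_nonneg hx hy
    have h1 : |Real.log (1 + s * (x / y)) - Real.log (1 + s)| ≤ Real.log (1 + s) + V := by
      have h5 := log_one_add_mul_le_add hs hr0 hV hr
      have h6 : 0 ≤ Real.log (1 + s * (x / y)) :=
        Real.log_nonneg (by have := mul_nonneg hs.le hr0; linarith)
      rw [abs_le]; constructor <;> linarith
    have h2 := le_inv_add_mul_sq (V := V) hη
    have h3 : (Real.log (1 + s) + 1 / η) * 1
        ≤ (Real.log (1 + s) + 1 / η) * ((|x - 1| + |y - 1|) / δ) := by gcongr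
    linarith

/-- No closeness of `y` to 1 enters, only its size; this is what remains available for fixed user
powers. Concentration of `x` alone has to absorb the factor `log (1 + s)`. -/
lemma abs_log_one_add_mul_div_sub_le_of_le_mul {s x y V : ℝ} (hs : 0 < s) (hx : 0 ≤ x)
    (hy : 0 ≤ y) (hV : 0 ≤ V) (h : x ≤ V * y) :
    |Real.log (1 + s * (x / y)) - Real.log (1 + s)|
      ≤ V + Real.log 2 + y + 2 * Real.log (1 + s) * |x - 1| := by
  have hL : 0 ≤ Real.log (1 + s) := Real.log_nonneg (by linarith)
  have hl2 : 0 ≤ Real.log 2 := Real.log_nonneg (by norm_num)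
  have hx1 := abs_nonneg (x - 1)
  have hr : x / y ≤ V := div_le_of_le_mul₀ hy hV h
  have hr0 : 0 ≤ x / y := div_nonneg hx hy
  have h5 := log_one_add_mul_le_add hs hr0 hV hr
  have h6 : 0 ≤ Real.log (1 + s * (x / y)) :=
    Real.log_nonneg (by have := mul_nonneg hs.le hr0; linarith)
  have h7 : 0 ≤ 2 * Real.log (1 + s) * |x - 1| := by positivity
  rw [abs_le]
  refine ⟨?_, by linarith⟩
  -- Below `1 / 2` one has `1 ≤ 2 |x - 1|`, so all of `log (1 + s)` can be charged to the deviation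
  -- of `x`.
  by_cases hx2 : x < 1 / 2
  · have h8 : Real.log (1 + s) * 1 ≤ Real.log (1 + s) * (2 * |x - 1|) := by
      gcongr
      rw [abs_of_neg (by linarith)]
      linarith
    linarith
  · have hx2 : 1 / 2 ≤ x := not_lt.1 hx2
    -- If `y` vanished, domination by `V * y` would force `x ≤ 0`.
    have hy0 : 0 < y := by
      rcases hy.lt_or_eq with h | h'
      · exact h
      · rw [← h'] at h; linarith
    -- As `x ≥ 1 / 2`, replacing `s` by `s x / y` loses at most the factor `2 (1 + y)`, and `log (1
    -- + y) ≤ y`.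
    have h8 : Real.log (1 + s) ≤ Real.log (2 * ((1 + y) * (1 + s * (x / y)))) := by
      refine Real.log_le_log (by linarith) ?_
      have h9 : s * (1 / 2) ≤ s * (x / y) * y := by
        rw [mul_assoc, div_mul_cancel₀ _ hy0.ne']
        gcongr
      nlinarith [mul_nonneg hs.le hr0]
    have hp : 0 < 1 + s * (x / y) := by positivity
    have hy1 : 0 < 1 + y := by linarith
    rw [Real.log_mul (by norm_num) (by positivity), Real.log_mul hy1.ne' hp.ne'] at h8
    have h10 := Real.log_le_sub_one_of_pos hy1
    linarith

end LogBounds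

/-! ### Expected logarithms from mean deviations. -/

section MeanLog

lemma aestronglyMeasurable_log_one_add_mul_div {Ω : Type*} [MeasurableSpace Ω]
    {μ : Measure Ω} {x y : Ω → ℝ} {s : ℝ} (hxi : Integrable x μ)
    (hyi : Integrable y μ) :
    AEStronglyMeasurable (fun ω => Real.log (1 + s * (x ω / y ω))) μ := by
  have h1 := hxi.aemeasurable
  have h2 := hyi.aemeasurable
  exact (by fun_prop : AEMeasurable _ μ).aestronglyMeasurable

variable {Ω : Type*} [MeasurableSpace Ω] {μ : Measure Ω} [IsProbabilityMeasure μ]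

lemma abs_integral_sub_le {f g : Ω → ℝ} {c : ℝ} (hf : AEStronglyMeasurable f μ)
    (hg : Integrable g μ) (h : ∀ s, |f s - c| ≤ g s) : |∫ s, f s ∂μ - c| ≤ ∫ s, g s ∂μ := by
  have hfc : Integrable (fun s => f s - c) μ :=
    hg.mono' (hf.sub aestronglyMeasurable_const) (ae_of_all _ h)
  have hfi : Integrable f μ := by
    refine (hfc.add (integrable_const c)).congr (ae_of_all _ fun s => ?_)
    simp
  have h1 : ∫ s, f s ∂μ - c = ∫ s, (f s - c) ∂μ := by
    rw [integral_sub hfi (integrable_const c)]; simp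
  rw [h1]
  exact abs_integral_le_integral_abs.trans (integral_mono hfc.abs hg h)

variable {x y V : Ω → ℝ} {s δ η e v : ℝ}

/-- The factor `k` is left free because the absolute and the relative estimate differ only there. -/
lemma integral_bound_le (hxi : Integrable x μ) (hyi : Integrable y μ)
    (hVi : Integrable (fun ω => V ω ^ 2) μ) (hδ0 : 0 < δ) (hη : 0 < η)
    (he : ∫ ω, |x ω - 1| ∂μ + ∫ ω, |y ω - 1| ∂μ ≤ e) (hv : ∫ ω, V ω ^ 2 ∂μ ≤ v)
    {k : ℝ} (hk : 0 ≤ k) :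
    Integrable (fun ω => 4 * δ + k * ((|x ω - 1| + |y ω - 1|) / δ) + η * V ω ^ 2) μ ∧
    ∫ ω, (4 * δ + k * ((|x ω - 1| + |y ω - 1|) / δ) + η * V ω ^ 2) ∂μ
      ≤ 4 * δ + k * (e / δ) + η * v := by
  have h1 : Integrable (fun ω => |x ω - 1|) μ := (hxi.sub (integrable_const _)).abs
  have h2 : Integrable (fun ω => |y ω - 1|) μ := (hyi.sub (integrable_const _)).abs
  refine ⟨by fun_prop, ?_⟩
  rw [integral_add (by fun_prop) (by fun_prop), integral_add (by fun_prop) (by fun_prop),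
    integral_const_mul k, integral_const_mul η, integral_div, integral_add h1 h2]
  simp only [integral_const, probReal_univ, one_smul]
  gcongr

lemma abs_integral_log_sub_le (hs : 0 < s) (hx : ∀ ω, 0 ≤ x ω) (hy : ∀ ω, 0 ≤ y ω)
    (hV : ∀ ω, 0 ≤ V ω) (h : ∀ ω, x ω ≤ V ω * y ω) (hxi : Integrable x μ) (hyi : Integrable y μ)
    (hVi : Integrable (fun ω => V ω ^ 2) μ) (hδ0 : 0 < δ) (hδ : δ ≤ 1 / 2) (hη : 0 < η)
    (he : ∫ ω, |x ω - 1| ∂μ + ∫ ω, |y ω - 1| ∂μ ≤ e) (hv : ∫ ω, V ω ^ 2 ∂μ ≤ v) :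
    |∫ ω, Real.log (1 + s * (x ω / y ω)) ∂μ - Real.log (1 + s)|
      ≤ 4 * δ + (Real.log (1 + s) + 1 / η) * (e / δ) + η * v := by
  have hL : 0 ≤ Real.log (1 + s) := Real.log_nonneg (by linarith)
  obtain ⟨h1, h2⟩ := integral_bound_le hxi hyi hVi hδ0 hη he hv
    (by positivity : 0 ≤ Real.log (1 + s) + 1 / η)
  exact (abs_integral_sub_le (aestronglyMeasurable_log_one_add_mul_div hxi hyi) h1 fun ω =>
    abs_log_one_add_mul_div_sub_le hs (hx ω) (hy ω) (hV ω) (h ω) hδ0 hδ hη).trans h2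

lemma abs_integral_log_sub_le_mul (hs : 0 < s) (hx : ∀ ω, 0 ≤ x ω) (hy : ∀ ω, 0 ≤ y ω)
    (hV : ∀ ω, 0 ≤ V ω) (h : ∀ ω, x ω ≤ V ω * y ω) (hxi : Integrable x μ) (hyi : Integrable y μ)
    (hVi : Integrable (fun ω => V ω ^ 2) μ) (hδ0 : 0 < δ) (hδ : δ ≤ 1 / 2) (hη : 0 < η)
    (he : ∫ ω, |x ω - 1| ∂μ + ∫ ω, |y ω - 1| ∂μ ≤ e) (hv : ∫ ω, V ω ^ 2 ∂μ ≤ v) :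
    |∫ ω, Real.log (1 + s * (x ω / y ω)) ∂μ - Real.log (1 + s)|
      ≤ Real.log (1 + s) * (4 * δ + (1 + 1 / η) * (e / δ) + η * v) := by
  have hL : 0 ≤ Real.log (1 + s) := Real.log_nonneg (by linarith)
  obtain ⟨h1, h2⟩ := integral_bound_le hxi hyi hVi hδ0 hη he hv
    (by positivity : 0 ≤ 1 + 1 / η)
  refine (abs_integral_sub_le (aestronglyMeasurable_log_one_add_mul_div hxi hyi)
    (h1.const_mul (Real.log (1 + s))) fun ω => ?_).trans ?_
  · exact (abs_log_one_add_mul_sub_le_mul hs (div_nonneg (hx ω) (hy ω))).trans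
      (mul_le_mul_of_nonneg_left
        (abs_div_sub_one_le_of_le_mul (hx ω) (hy ω) (hV ω) (h ω) hδ0 hδ hη) hL)
  · rw [integral_const_mul]
    exact mul_le_mul_of_nonneg_left h2 hL

lemma abs_integral_log_sub_le_const (hs : 0 < s) (hx : ∀ ω, 0 ≤ x ω) (hy : ∀ ω, 0 ≤ y ω)
    (hV : ∀ ω, 0 ≤ V ω) (h : ∀ ω, x ω ≤ V ω * y ω) (hxi : Integrable x μ) (hyi : Integrable y μ)
    (hVm : Integrable V μ) (hVi : Integrable (fun ω => V ω ^ 2) μ)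
    (he : ∫ ω, |x ω - 1| ∂μ ≤ e) (hv : ∫ ω, V ω ^ 2 ∂μ ≤ v) :
    |∫ ω, Real.log (1 + s * (x ω / y ω)) ∂μ - Real.log (1 + s)|
      ≤ 1 + v + Real.log 2 + ∫ ω, y ω ∂μ + 2 * Real.log (1 + s) * e := by
  have hL : 0 ≤ Real.log (1 + s) := Real.log_nonneg (by linarith)
  have h1 : Integrable (fun ω => |x ω - 1|) μ := (hxi.sub (integrable_const _)).abs
  refine (abs_integral_sub_le (aestronglyMeasurable_log_one_add_mul_div hxi hyi)
    (g := fun ω => V ω + Real.log 2 + y ω + 2 * Real.log (1 + s) * |x ω - 1|) (by fun_prop)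
    fun ω => abs_log_one_add_mul_div_sub_le_of_le_mul hs (hx ω) (hy ω) (hV ω) (h ω)).trans ?_
  rw [integral_add (by fun_prop) (by fun_prop), integral_add (by fun_prop) (by fun_prop),
    integral_add (by fun_prop) (by fun_prop), integral_const_mul]
  have h2 : ∫ ω, V ω ∂μ ≤ ∫ ω, (1 + V ω ^ 2) ∂μ :=
    integral_mono hVm (by fun_prop) fun ω => by nlinarith [sq_nonneg (V ω - 1)]
  rw [integral_add (by fun_prop) (by fun_prop)] at h2
  simp only [integral_const, probReal_univ, one_smul] at h2 ⊢
  have h3 : 2 * Real.log (1 + s) * ∫ ω, |x ω - 1| ∂μ ≤ 2 * Real.log (1 + s) * e := by gcongr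
  linarith

end MeanLog

/-! ### Calculus of the modes of approximation -/

section Approx

variable {a b a' b' : ℕ → ℝ}

lemma StrongApprox.logApprox (h : StrongApprox a b) : LogApprox a b := by
  refine ⟨h.1, 1, ?_⟩
  have := h.2.abs
  rw [abs_zero] at this
  exact this.eventually_le_const one_pos

lemma StrongApprox.const_mul (h : StrongApprox a b) {c : ℝ} (hc : c ≠ 0) :
    StrongApprox (fun M => c * a M) (fun M => c * b M) := by
  refine ⟨h.1.congr fun M => (mul_div_mul_left _ _ hc).symm, ?_⟩
  simpa [mul_sub] using h.2.const_mul c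

lemma LogApprox.const_mul (h : LogApprox a b) {c : ℝ} (hc : c ≠ 0) :
    LogApprox (fun M => c * a M) (fun M => c * b M) := by
  obtain ⟨h1, C, hC⟩ := h
  refine ⟨h1.congr fun M => (mul_div_mul_left _ _ hc).symm, |c| * C, ?_⟩
  filter_upwards [hC] with M hM
  rw [← mul_sub, abs_mul]
  gcongr

lemma tendsto_div_one_iff :
    Tendsto (fun M => a M / b M) atTop (𝓝 1)
      ↔ Tendsto (fun M => |a M / b M - 1|) atTop (𝓝 0) := by
  rw [← tendsto_sub_nhds_zero_iff, tendsto_zero_iff_abs_tendsto_zero]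
  rfl

lemma abs_sub_le_of_abs_div_sub_one_le {u v ε : ℝ} (hv : 0 < v) (h : |u / v - 1| ≤ ε) :
    |u - v| ≤ ε * v := by
  have : u - v = (u / v - 1) * v := by field_simp
  rw [this, abs_mul, abs_of_pos hv]
  gcongr

lemma abs_div_sub_one_le_of_abs_sub_le {u v ε : ℝ} (hv : 0 < v) (h : |u - v| ≤ ε * v) :
    |u / v - 1| ≤ ε := by
  have : u / v - 1 = (u - v) / v := by field_simp
  rw [this, abs_div, abs_of_pos hv, div_le_iff₀ hv]
  exact h

/-- The two-sided bounds `(1 ± ε) v` pass through minima because both factors are nonnegative; for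
`1 - ε` this is where `ε ≤ 1` is needed. -/
lemma abs_min_sub_min_le_mul {u v u' v' ε : ℝ} (hε1 : ε ≤ 1) (hv : 0 < v) (_hv' : 0 < v')
    (h : |u - v| ≤ ε * v) (h' : |u' - v'| ≤ ε * v') :
    |min u u' - min v v'| ≤ ε * min v v' := by
  have hε : 0 ≤ ε := by
    have := (abs_nonneg _).trans h
    exact nonneg_of_mul_nonneg_left this hv
  rw [abs_le] at *
  rcases min_choice u u' with h1 | h1 <;> rcases min_choice v v' with h2 | h2 <;>
    rw [h1, h2] <;> constructor <;>
    nlinarith [min_le_left u u', min_le_right u u', min_le_left v v', min_le_right v v']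

lemma tendsto_div_of_abs_sub_le (op : ℝ → ℝ → ℝ)
    (hop : ∀ {u v u' v' ε : ℝ}, ε ≤ 1 → 0 < v → 0 < v' → |u - v| ≤ ε * v → |u' - v'| ≤ ε * v' →
      |op u u' - op v v'| ≤ ε * op v v')
    (hpos : ∀ {v v' : ℝ}, 0 < v → 0 < v' → 0 < op v v')
    (hb : ∀ᶠ M in atTop, 0 < b M) (hb' : ∀ᶠ M in atTop, 0 < b' M)
    (h : Tendsto (fun M => a M / b M) atTop (𝓝 1))
    (h' : Tendsto (fun M => a' M / b' M) atTop (𝓝 1)) :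
    Tendsto (fun M => op (a M) (a' M) / op (b M) (b' M)) atTop (𝓝 1) := by
  rw [tendsto_div_one_iff (a := fun M => op (a M) (a' M)) (b := fun M => op (b M) (b' M))]
  -- The sum of the two relative errors serves as a common `ε` for both sequences.
  have hz := (tendsto_div_one_iff.1 h).add (tendsto_div_one_iff.1 h')
  rw [add_zero] at hz
  refine squeeze_zero' (Eventually.of_forall fun M => abs_nonneg _) ?_ hz
  filter_upwards [hb, hb', hz.eventually_le_const one_pos] with M h1 h2 h3
  refine abs_div_sub_one_le_of_abs_sub_le (hpos h1 h2) (hop h3 h1 h2 ?_ ?_)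
  · exact abs_sub_le_of_abs_div_sub_one_le h1 (le_add_of_nonneg_right (abs_nonneg _))
  · exact abs_sub_le_of_abs_div_sub_one_le h2 (le_add_of_nonneg_left (abs_nonneg _))

lemma tendsto_min_div_min (hb : ∀ᶠ M in atTop, 0 < b M) (hb' : ∀ᶠ M in atTop, 0 < b' M)
    (h : Tendsto (fun M => a M / b M) atTop (𝓝 1))
    (h' : Tendsto (fun M => a' M / b' M) atTop (𝓝 1)) :
    Tendsto (fun M => min (a M) (a' M) / min (b M) (b' M)) atTop (𝓝 1) :=
  tendsto_div_of_abs_sub_le min abs_min_sub_min_le_mul lt_min hb hb' h h'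

lemma tendsto_add_div_add (hb : ∀ᶠ M in atTop, 0 < b M) (hb' : ∀ᶠ M in atTop, 0 < b' M)
    (h : Tendsto (fun M => a M / b M) atTop (𝓝 1))
    (h' : Tendsto (fun M => a' M / b' M) atTop (𝓝 1)) :
    Tendsto (fun M => (a M + a' M) / (b M + b' M)) atTop (𝓝 1) := by
  refine tendsto_div_of_abs_sub_le (fun u v => u + v) (fun {u v u' v' ε} _ _ _ h1 h2 => ?_)
    add_pos hb hb' h h'
  rw [add_sub_add_comm, mul_add]
  exact (abs_add_le _ _).trans (add_le_add h1 h2)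

lemma StrongApprox.min (h : StrongApprox a b) (h' : StrongApprox a' b')
    (hb : ∀ᶠ M in atTop, 0 < b M) (hb' : ∀ᶠ M in atTop, 0 < b' M) :
    StrongApprox (fun M => min (a M) (a' M)) (fun M => min (b M) (b' M)) := by
  refine ⟨tendsto_min_div_min hb hb' h.1 h'.1, ?_⟩
  have hz := h.2.abs.max h'.2.abs
  rw [abs_zero, max_self] at hz
  exact squeeze_zero_norm (fun M => abs_min_sub_min_le_max _ _ _ _) hz

lemma StrongApprox.add (h : StrongApprox a b) (h' : StrongApprox a' b')
    (hb : ∀ᶠ M in atTop, 0 < b M) (hb' : ∀ᶠ M in atTop, 0 < b' M) :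
    StrongApprox (fun M => a M + a' M) (fun M => b M + b' M) := by
  refine ⟨tendsto_add_div_add hb hb' h.1 h'.1, ?_⟩
  have hz := h.2.add h'.2
  rw [add_zero] at hz
  exact hz.congr fun M => by ring

lemma LogApprox.min (h : LogApprox a b) (h' : LogApprox a' b')
    (hb : ∀ᶠ M in atTop, 0 < b M) (hb' : ∀ᶠ M in atTop, 0 < b' M) :
    LogApprox (fun M => min (a M) (a' M)) (fun M => min (b M) (b' M)) := by
  obtain ⟨h1, C, hC⟩ := h
  obtain ⟨h1', C', hC'⟩ := h'
  refine ⟨tendsto_min_div_min hb hb' h1 h1', max C C', ?_⟩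
  filter_upwards [hC, hC'] with M h2 h3
  exact (abs_min_sub_min_le_max _ _ _ _).trans (max_le_max h2 h3)

lemma LogApprox.add (h : LogApprox a b) (h' : LogApprox a' b')
    (hb : ∀ᶠ M in atTop, 0 < b M) (hb' : ∀ᶠ M in atTop, 0 < b' M) :
    LogApprox (fun M => a M + a' M) (fun M => b M + b' M) := by
  obtain ⟨h1, C, hC⟩ := h
  obtain ⟨h1', C', hC'⟩ := h'
  refine ⟨tendsto_add_div_add hb hb' h1 h1', C + C', ?_⟩
  filter_upwards [hC, hC'] with M h2 h3
  rw [add_sub_add_comm]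
  exact (abs_add_le _ _).trans (add_le_add h2 h3)

/-- Ratios tending to one are asymptotically equal under `log (1 + ·)`, whatever their size. -/
lemma strongApprox_log_one_add {x y : ℕ → ℝ} (hx : ∀ᶠ M in atTop, 0 < x M)
    (hy : ∀ᶠ M in atTop, 0 < y M) (h : Tendsto (fun M => x M / y M) atTop (𝓝 1)) :
    StrongApprox (fun M => Real.log (1 + x M)) (fun M => Real.log (1 + y M)) := by
  refine ⟨?_, ?_⟩
  · rw [tendsto_div_one_iff (a := fun M => Real.log (1 + x M))]
    refine squeeze_zero' (Eventually.of_forall fun M => abs_nonneg _) ?_ (tendsto_div_one_iff.1 h)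
    filter_upwards [hx, hy] with M h1 h2
    have h3 := abs_log_one_add_mul_sub_le_mul h2 (div_pos h1 h2).le
    rw [mul_div_cancel₀ _ h2.ne', mul_comm] at h3
    exact abs_div_sub_one_le_of_abs_sub_le (Real.log_pos (by linarith)) h3
  · have hl : Tendsto (fun M => |Real.log (x M / y M)|) atTop (𝓝 0) := by
      have := ((Real.continuousAt_log one_ne_zero).tendsto.comp h).abs
      simpa using this
    refine squeeze_zero_norm' ?_ hl
    filter_upwards [hx, hy] with M h1 h2
    have h3 := abs_log_one_add_mul_sub_le_abs_log h2 (div_pos h1 h2)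
    rwa [mul_div_cancel₀ _ h2.ne'] at h3

lemma tendsto_natCast_rpow_neg {r : ℝ} (hr : 0 < r) :
    Tendsto (fun M : ℕ => (M : ℝ) ^ (-r)) atTop (𝓝 0) :=
  (tendsto_rpow_neg_atTop hr).comp tendsto_natCast_atTop_atTop

/-- A ratio growing at most linearly has a logarithm of order `log M`, which any negative power of
`M` defeats. -/
lemma tendsto_log_one_add_mul_rpow_neg {s : ℕ → ℝ} {C r : ℝ} (hr : 0 < r)
    (hs : ∀ᶠ M : ℕ in atTop, 0 < s M ∧ s M ≤ C * M) :
    Tendsto (fun M : ℕ => Real.log (1 + s M) * (M : ℝ) ^ (-r)) atTop (𝓝 0) := by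
  have h1 : Tendsto (fun M : ℕ => Real.log M * (M : ℝ) ^ (-r)) atTop (𝓝 0) := by
    have := (isLittleO_log_rpow_atTop hr).tendsto_div_nhds_zero.comp tendsto_natCast_atTop_atTop
    refine this.congr fun M => ?_
    simp [Real.rpow_neg, div_eq_mul_inv]
  have h2 := ((tendsto_natCast_rpow_neg hr).const_mul (Real.log (1 + |C|))).add h1
  rw [mul_zero, add_zero] at h2
  refine squeeze_zero' ?_ ?_ h2
  · filter_upwards [hs] with M hM
    have := Real.log_nonneg (by linarith [hM.1] : 1 ≤ 1 + s M)
    positivity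
  · filter_upwards [hs, eventually_ge_atTop 1] with M hM hM1
    have hM' : (1 : ℝ) ≤ M := by exact_mod_cast hM1
    rw [← add_mul, ← Real.log_mul (by positivity) (by positivity)]
    have h3 : Real.log (1 + s M) ≤ Real.log ((1 + |C|) * M) := by
      refine Real.log_le_log (by linarith [hM.1]) ?_
      nlinarith [le_abs_self C, hM.2]
    gcongr

/-- The absolute bound yields the difference and the relative bound the quotient; neither suffices
for both over the whole range of `s`. -/
lemma strongApprox_log_of_abs_sub_le {I s : ℕ → ℝ} {C r : ℝ} (hr : 0 < r)
    (hs : ∀ᶠ M : ℕ in atTop, 0 < s M ∧ s M ≤ C * M)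
    (h1 : ∀ᶠ M : ℕ in atTop, ∀ δ η : ℝ, 0 < δ → δ ≤ 1 / 2 → 0 < η →
      |I M - Real.log (1 + s M)|
        ≤ 4 * δ + (Real.log (1 + s M) + 1 / η) * (C * (M : ℝ) ^ (-r) / δ) + η * C)
    (h2 : ∀ᶠ M : ℕ in atTop, ∀ δ η : ℝ, 0 < δ → δ ≤ 1 / 2 → 0 < η →
      |I M - Real.log (1 + s M)|
        ≤ Real.log (1 + s M)
          * (4 * δ + (1 + 1 / η) * (C * (M : ℝ) ^ (-r) / δ) + η * C)) :
    StrongApprox I (fun M => Real.log (1 + s M)) := by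
  -- With `δ = η = x` the deviation is `C x ^ 4`, so division by `δ` and by `δ η` still leaves `x ^
  -- 3` and `x ^ 2`.
  set x : ℕ → ℝ := fun M => (M : ℝ) ^ (-(r / 4)) with hx
  have hr4 : 0 < r / 4 := by positivity
  have hx0 : Tendsto x atTop (𝓝 0) := tendsto_natCast_rpow_neg hr4
  have hLx : Tendsto (fun M => Real.log (1 + s M) * x M) atTop (𝓝 0) :=
    tendsto_log_one_add_mul_rpow_neg hr4 hs
  have hxpos : ∀ᶠ M in atTop, 0 < x M := by
    filter_upwards [eventually_ge_atTop 1] with M hM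
    have : (0 : ℝ) < M := by exact_mod_cast hM
    positivity
  have hxr : ∀ M : ℕ, (M : ℝ) ^ (-r) = x M ^ 4 := fun M => by
    rw [hx, ← Real.rpow_mul_natCast (by positivity)]
    congr 1
    push_cast
    ring
  have hxhalf : ∀ᶠ M in atTop, x M ≤ 1 / 2 := hx0.eventually_le_const (by norm_num)
  refine ⟨?_, ?_⟩
  · rw [tendsto_div_one_iff]
    have hz : Tendsto (fun M => 4 * x M + C * (x M ^ 3 + x M ^ 2) + x M * C) atTop (𝓝 0) := by
      have := ((hx0.const_mul 4).add (((hx0.pow 3).add (hx0.pow 2)).const_mul C)).add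
        (hx0.mul_const C)
      simpa using this
    refine squeeze_zero' (Eventually.of_forall fun M => abs_nonneg _) ?_ hz
    filter_upwards [h2, hxpos, hxhalf, hs] with M hM hM1 hM2 hM3
    refine abs_div_sub_one_le_of_abs_sub_le (Real.log_pos (by linarith [hM3.1])) ?_
    refine (hM (x M) (x M) hM1 hM2 hM1).trans_eq ?_
    rw [hxr]
    field_simp
  · have hz : Tendsto (fun M => 4 * x M
        + C * ((Real.log (1 + s M) * x M) * x M ^ 2 + x M ^ 2) + x M * C) atTop (𝓝 0) := by
      have := ((hx0.const_mul 4).add (((hLx.mul (hx0.pow 2)).add (hx0.pow 2)).const_mul C)).add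
        (hx0.mul_const C)
      simpa using this
    refine squeeze_zero_norm' ?_ hz
    filter_upwards [h1, hxpos, hxhalf] with M hM hM1 hM2
    refine (hM (x M) (x M) hM1 hM2 hM1).trans_eq ?_
    rw [hxr]
    field_simp

lemma logApprox_log_of_abs_sub_le {I s : ℕ → ℝ} {C r : ℝ} (hr : 0 < r)
    (hs : ∀ᶠ M : ℕ in atTop, 0 < s M ∧ s M ≤ C * M) (hs' : Tendsto s atTop atTop)
    (h : ∀ᶠ M : ℕ in atTop, |I M - Real.log (1 + s M)|
      ≤ C + 2 * Real.log (1 + s M) * (C * (M : ℝ) ^ (-r))) :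
    LogApprox I (fun M => Real.log (1 + s M)) := by
  have hL : Tendsto (fun M => Real.log (1 + s M)) atTop atTop :=
    Real.tendsto_log_atTop.comp (tendsto_atTop_add_const_left _ 1 hs')
  have hbd : ∀ᶠ M in atTop, |I M - Real.log (1 + s M)| ≤ C + 1 := by
    have hz := (tendsto_log_one_add_mul_rpow_neg hr hs).const_mul (2 * C)
    rw [mul_zero] at hz
    filter_upwards [h, hz.eventually_le_const one_pos] with M h1 h2
    linarith
  refine ⟨?_, C + 1, hbd⟩
  rw [tendsto_div_one_iff]
  refine squeeze_zero' (Eventually.of_forall fun M => abs_nonneg _) ?_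
    (hL.const_div_atTop (C + 1))
  filter_upwards [hbd, hL.eventually_gt_atTop 0] with M h1 h2
  refine abs_div_sub_one_le_of_abs_sub_le h2 ?_
  rwa [div_mul_cancel₀ _ h2.ne']

end Approx

/-! ### Weighted uplink signals -/

section WeightedUplink

variable {N M : ℕ} {P : Params N} {gbar : Side → Fin N → Fin M → ℂ}

/-- A weighted sum of the two uplink signal terms of a pair. -/
def sigW (P : Params N) (gbar : Side → Fin N → Fin M → ℂ) (a : Side → ℝ) (i : Fin N)
    (s : Sample N M) : ℝ :=
  ∑ X, a X * sig P gbar X i s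

/-- The limit of the weighted uplink signal divided by the squared number of antennas. -/
def sigLim (P : Params N) (a : Side → ℝ) (i : Fin N) : ℝ :=
  ∑ X, a X * (P.p X i * omega P X i ^ 2)

/-- The spectral efficiency of a weighted uplink signal. -/
def RUpW (P : Params N) (gbar : Side → Fin N → Fin M → ℂ) (a : Side → ℝ) (i : Fin N) : ℝ :=
  P.prelog * ∫ s, Real.logb 2 (1 + sigW P gbar a i s / den P gbar i s) ∂law N M

/-- The closed-form ratio for a weighted uplink signal. -/
def sinrUp (P : Params N) (M : ℕ) (a : Side → ℝ) (i : Fin N) : ℝ :=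
  M * sigLim P a i / upDen P i

/-- The squared norms of the two channel estimates of a pair, relative to the squares of their
limits. -/
def relNorm (P : Params N) (gbar : Side → Fin N → Fin M → ℂ) (i : Fin N) (s : Sample N M) : ℝ :=
  ∑ X, sqNorm (chanEst P gbar X i s) / omega P X i ^ 2

variable {a : Side → ℝ}

lemma sigW_nonneg (hP : P.Valid) (ha : ∀ X, 0 ≤ a X) (i : Fin N) (s : Sample N M) :
    0 ≤ sigW P gbar a i s :=
  Finset.sum_nonneg fun X _ => mul_nonneg (ha X) (sig_nonneg hP X i s)

lemma integrable_sigW (hP : P.Valid) (i : Fin N) : Integrable (sigW P gbar a i) (law N M) :=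
  integrable_finsetSum _ fun _ _ => (integrable_sig hP _ i).const_mul _

lemma relNorm_nonneg (i : Fin N) (s : Sample N M) : 0 ≤ relNorm P gbar i s :=
  Finset.sum_nonneg fun X _ => div_nonneg (sqNorm_nonneg _) (sq_nonneg _)

lemma sigLim_pos (hP : P.Valid) (ha : ∀ X, 0 ≤ a X) (ha' : 0 < ∑ X, a X) {i : Fin N}
    (hω : ∀ X, 0 < omega P X i) : 0 < sigLim P a i := by
  have hpos : ∀ X, 0 < P.p X i * omega P X i ^ 2 := fun X =>
    mul_pos (hP.p_pos X i) (pow_pos (hω X) 2)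
  obtain ⟨X, -, hX⟩ := Finset.exists_lt_of_sum_lt (f := fun _ => (0 : ℝ)) (by simpa using ha')
  exact Finset.sum_pos' (fun Y _ => mul_nonneg (ha Y) (hpos Y).le)
    ⟨X, Finset.mem_univ _, mul_pos hX (hpos X)⟩

lemma upDen_pos (hP : P.Valid) {i : Fin N} (hω : ∀ X, 0 < omega P X i) : 0 < upDen P i :=
  (add_pos (hω _) (hω _)).trans_le (add_omega_le_upDen hP i)

/-- The weighted ratio is dominated by a multiple of the squared norms. -/
lemma sigW_le_mul_den (hP : P.Valid) (ha : ∀ X, 0 ≤ a X) {i : Fin N} (hω : ∀ X, 0 < omega P X i)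
    (s : Sample N M) :
    sigW P gbar a i s ≤ sigLim P a i * relNorm P gbar i s * den P gbar i s := by
  have hd := den_nonneg (gbar := gbar) hP i s
  have hterm : ∀ X, 0 ≤ a X * (P.p X i * omega P X i ^ 2) := fun X =>
    mul_nonneg (ha X) (mul_nonneg (hP.p_pos X i).le (sq_nonneg _))
  have h1 : sigW P gbar a i s
      ≤ (∑ X, a X * (P.p X i * sqNorm (chanEst P gbar X i s))) * den P gbar i s := by
    rw [sigW, Finset.sum_mul]
    refine Finset.sum_le_sum fun X _ => ?_
    rw [mul_assoc]
    exact mul_le_mul_of_nonneg_left (sig_le_mul_den hP X i s) (ha X)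
  refine h1.trans (mul_le_mul_of_nonneg_right ?_ hd)
  rw [relNorm, Finset.mul_sum]
  refine Finset.sum_le_sum fun X _ => ?_
  have h2 : a X * (P.p X i * omega P X i ^ 2) ≤ sigLim P a i :=
    Finset.single_le_sum (f := fun X => a X * (P.p X i * omega P X i ^ 2))
      (fun Y _ => hterm Y) (Finset.mem_univ X)
  have h3 : 0 ≤ sqNorm (chanEst P gbar X i s) / omega P X i ^ 2 :=
    div_nonneg (sqNorm_nonneg _) (sq_nonneg _)
  refine le_of_eq_of_le ?_ (mul_le_mul_of_nonneg_right h2 h3)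
  have := (hω X).ne'
  field_simp

lemma integrable_relNorm (hP : P.Valid) (i : Fin N) :
    Integrable (relNorm P gbar i) (law N M) :=
  integrable_finsetSum _ fun X _ => (integrable_sqNorm_chanEst hP X i).div_const _

lemma relNorm_sq_le (i : Fin N) (s : Sample N M) :
    relNorm P gbar i s ^ 2 ≤ ∑ X, 2 / omega P X i ^ 4 * sqNorm (chanEst P gbar X i s) ^ 2 := by
  have h : ∀ X, 2 / omega P X i ^ 4 * sqNorm (chanEst P gbar X i s) ^ 2
      = 2 * (sqNorm (chanEst P gbar X i s) / omega P X i ^ 2) ^ 2 := fun X => by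
    rw [div_pow, ← pow_mul]; ring
  simp_rw [h, relNorm, sum_side]
  linarith [add_sq_le (a := sqNorm (chanEst P gbar Side.A i s) / omega P Side.A i ^ 2)
    (b := sqNorm (chanEst P gbar Side.B i s) / omega P Side.B i ^ 2)]

lemma integrable_relNorm_sq (hP : P.Valid) (i : Fin N) :
    Integrable (fun s => relNorm P gbar i s ^ 2) (law N M) := by
  have hb : Integrable (fun s => ∑ X, 2 / omega P X i ^ 4 * sqNorm (chanEst P gbar X i s) ^ 2)
      (law N M) :=
    integrable_finsetSum _ fun X _ => (integrable_sqNorm_chanEst_sq hP X i).const_mul _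
  refine hb.mono' ((integrable_relNorm hP i).1.pow 2) (ae_of_all _ fun s => ?_)
  rw [Real.norm_eq_abs, abs_of_nonneg (sq_nonneg _)]
  exact relNorm_sq_le i s

/-- The 8 is a product of three twos: from `(x + y) ^ 2 ≤ 2 x ^ 2 + 2 y ^ 2`, from `M ≤ M ^ 2` in
the second moment, and from the two users. -/
lemma integral_relNorm_sq_le (hP : P.Valid) (hg : ∀ X i, sqNorm (gbar X i) = M) (hM : 0 < M)
    {i : Fin N} {c : ℝ} (hc : 0 < c) (hω : ∀ X, c ≤ omega P X i) :
    ∫ s, relNorm P gbar i s ^ 2 ∂law N M ≤ 8 * (M : ℝ) ^ 2 / c ^ 2 := by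
  have hM' : (1 : ℝ) ≤ M := by exact_mod_cast hM
  have hi : ∀ X, Integrable (fun s => 2 / omega P X i ^ 4 * sqNorm (chanEst P gbar X i s) ^ 2)
      (law N M) := fun X => (integrable_sqNorm_chanEst_sq hP X i).const_mul _
  have hX : ∀ X, ∫ s, 2 / omega P X i ^ 4 * sqNorm (chanEst P gbar X i s) ^ 2 ∂law N M
      ≤ 4 * (M : ℝ) ^ 2 / c ^ 2 := fun X => by
    have h0 : 0 < omega P X i := hc.trans_le (hω X)
    rw [integral_const_mul]
    calc _ ≤ 2 / omega P X i ^ 4 * ((M * omega P X i) ^ 2 + M * omega P X i ^ 2) := by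
          gcongr
          exact integral_sqNorm_chanEst_sq_le hP hg X i
      _ ≤ 2 / omega P X i ^ 4 * ((M * omega P X i) ^ 2 + (M : ℝ) ^ 2 * omega P X i ^ 2) := by
          gcongr
          nlinarith
      _ = 4 * (M : ℝ) ^ 2 / omega P X i ^ 2 := by
          field_simp
          ring
      _ ≤ _ := by
          gcongr
          exact hω X
  calc _ ≤ ∫ s, ∑ X, 2 / omega P X i ^ 4 * sqNorm (chanEst P gbar X i s) ^ 2 ∂law N M :=
        integral_mono (integrable_relNorm_sq hP i) (integrable_finsetSum _ fun X _ => hi X)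
          (relNorm_sq_le i)
    _ = ∑ X, ∫ s, 2 / omega P X i ^ 4 * sqNorm (chanEst P gbar X i s) ^ 2 ∂law N M :=
        integral_finsetSum _ fun X _ => hi X
    _ ≤ 4 * (M : ℝ) ^ 2 / c ^ 2 + 4 * (M : ℝ) ^ 2 / c ^ 2 := by
        rw [sum_side]; exact add_le_add (hX _) (hX _)
    _ = _ := by ring

lemma natCast_rpow_neg_half (M : ℕ) : (M : ℝ) ^ (-(1 / 2) : ℝ) = 1 / √M := by
  rw [Real.rpow_neg (by positivity), ← Real.sqrt_eq_rpow, one_div]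

/-- Each user's deviation is bounded by a common multiple of that user's own limit, so weights and
powers cancel. The quotient by `c ^ 2` expresses the partner's correlation in units of `ω ^ 2 ≥ c ^
2`. -/
lemma integral_abs_sigW_div_sub_one_le (hP : P.Valid) (hg : ∀ X i, sqNorm (gbar X i) = M)
    (hM : 0 < M) (ha : ∀ X, 0 ≤ a X) (ha' : 0 < ∑ X, a X) {i : Fin N} {c B : ℝ} (hc : 0 < c)
    (hω : ∀ X, c ≤ omega P X i) (hB : ∀ X, omega P X i ≤ B)
    (hl : ∀ X : Side, losCorr P gbar X.other i X i ≤ M) :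
    ∫ s, |sigW P gbar a i s / ((M : ℝ) ^ 2 * sigLim P a i) - 1| ∂law N M
      ≤ (3 + (1 + B ^ 2) / c ^ 2) * (M : ℝ) ^ (-(1 / 2) : ℝ) := by
  have hM' : (1 : ℝ) ≤ M := by exact_mod_cast hM
  have hω0 : ∀ X, 0 < omega P X i := fun X => hc.trans_le (hω X)
  have hL := sigLim_pos hP ha ha' hω0
  have hD : 0 < (M : ℝ) ^ 2 * sigLim P a i := by positivity
  have hs : √(M : ℝ) * √M = M := Real.mul_self_sqrt (by positivity)
  have hs1 : 1 ≤ √(M : ℝ) := Real.one_le_sqrt.2 hM'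
  have hiX : ∀ X, Integrable
      (fun s => a X * |sig P gbar X i s - (M : ℝ) ^ 2 * (P.p X i * omega P X i ^ 2)|) (law N M) :=
    fun X => ((integrable_sig hP X i).sub (integrable_const _)).abs.const_mul _
  have hpt : ∀ s, |sigW P gbar a i s / ((M : ℝ) ^ 2 * sigLim P a i) - 1|
      ≤ (∑ X, a X * |sig P gbar X i s - (M : ℝ) ^ 2 * (P.p X i * omega P X i ^ 2)|)
        / ((M : ℝ) ^ 2 * sigLim P a i) := fun s => by
    rw [div_sub_one hD.ne', abs_div, abs_of_pos hD]
    gcongr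
    have h1 : sigW P gbar a i s - (M : ℝ) ^ 2 * sigLim P a i
        = ∑ X, a X * (sig P gbar X i s - (M : ℝ) ^ 2 * (P.p X i * omega P X i ^ 2)) := by
      rw [sigW, sigLim, Finset.mul_sum, ← Finset.sum_sub_distrib]
      exact Finset.sum_congr rfl fun X _ => by ring
    rw [h1]
    refine (Finset.abs_sum_le_sum_abs _ _).trans_eq (Finset.sum_congr rfl fun X _ => ?_)
    rw [abs_mul, abs_of_nonneg (ha X)]
  have hX : ∀ X, ∫ s, a X * |sig P gbar X i s - (M : ℝ) ^ 2 * (P.p X i * omega P X i ^ 2)| ∂law N M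
      ≤ (M * √M * (3 + (1 + B ^ 2) / c ^ 2)) * (a X * (P.p X i * omega P X i ^ 2)) := fun X => by
    have hp := hP.p_pos X i
    have h2 := integral_abs_sig_sub_le hP hg hM X i (hω0 X)
    have h3 : losCorr P gbar X.other i X i + M * (omega P X.other i * omega P X i)
        ≤ M * √M * ((1 + B ^ 2) / c ^ 2) * omega P X i ^ 2 := by
      have h4 : omega P X.other i * omega P X i ≤ B ^ 2 := by
        rw [sq]
        exact mul_le_mul (hB _) (hB _) (hω0 _).le ((hω0 X).le.trans (hB X))
      have h5 : (1 : ℝ) ≤ omega P X i ^ 2 / c ^ 2 := by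
        rw [one_le_div (by positivity)]
        exact pow_le_pow_left₀ hc.le (hω X) 2
      calc _ ≤ (M : ℝ) + M * B ^ 2 := by
            gcongr
            exact hl X
        _ = M * (1 + B ^ 2) * 1 := by ring
        _ ≤ (M * √M) * (1 + B ^ 2) * (omega P X i ^ 2 / c ^ 2) := by
            gcongr
            exact le_mul_of_one_le_right (by positivity) hs1
        _ = _ := by ring
    rw [integral_const_mul]
    calc _ ≤ a X * (P.p X i * (3 * (M * √M) * omega P X i ^ 2
          + M * √M * ((1 + B ^ 2) / c ^ 2) * omega P X i ^ 2)) :=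
          mul_le_mul_of_nonneg_left (h2.trans (by gcongr)) (ha X)
      _ = _ := by ring
  calc _ ≤ ∫ s, (∑ X, a X * |sig P gbar X i s - (M : ℝ) ^ 2 * (P.p X i * omega P X i ^ 2)|)
        / ((M : ℝ) ^ 2 * sigLim P a i) ∂law N M :=
        integral_mono ((((integrable_sigW hP i).div_const _).sub (integrable_const _)).abs)
          ((integrable_finsetSum _ fun X _ => hiX X).div_const _) hpt
    _ = (∑ X, ∫ s, a X * |sig P gbar X i s - (M : ℝ) ^ 2 * (P.p X i * omega P X i ^ 2)| ∂law N M)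
        / ((M : ℝ) ^ 2 * sigLim P a i) := by
        rw [integral_div, integral_finsetSum _ fun X _ => hiX X]
    _ ≤ ((M * √M * (3 + (1 + B ^ 2) / c ^ 2)) * sigLim P a i) / ((M : ℝ) ^ 2 * sigLim P a i) := by
        gcongr
        rw [sigLim, Finset.mul_sum]
        exact Finset.sum_le_sum fun X _ => hX X
    _ = _ := by
        rw [natCast_rpow_neg_half, mul_div_mul_right _ _ hL.ne', div_eq_iff (by positivity)]
        have hs0 : √(M : ℝ) ≠ 0 := by positivity
        field_simp
        rw [sq, hs]

/-- The noise gives `M ^ (-1/2)`. Interference gives `3 k`, twice from `upDen` and once from the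
line of sight, over `upDen ≥ 2 c`; later `k` carries the factor `M ^ (-α)`. -/
lemma integral_abs_den_div_sub_one_le (hP : P.Valid) (hg : ∀ X i, sqNorm (gbar X i) = M)
    (hM : 0 < M) {i : Fin N} {c k : ℝ} (hc : 0 < c)
    (hω : ∀ X, c ≤ omega P X i)
    (hk : upDen P i - (omega P Side.A i + omega P Side.B i) ≤ k)
    (hl : losUp P gbar i ≤ k * M) :
    ∫ s, |den P gbar i s / (M * upDen P i) - 1| ∂law N M
      ≤ (M : ℝ) ^ (-(1 / 2) : ℝ) + 3 * k / (2 * c) := by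
  have hM' : (1 : ℝ) ≤ M := by exact_mod_cast hM
  have hω0 : ∀ X, 0 < omega P X i := fun X => hc.trans_le (hω X)
  have hU := upDen_pos hP hω0
  have hD : 0 < M * upDen P i := by positivity
  have hk0 : 0 ≤ k := (sub_nonneg.2 (add_omega_le_upDen hP i)).trans hk
  have hs : √(M : ℝ) * √M = M := Real.mul_self_sqrt (by positivity)
  have hs0 : 0 < √(M : ℝ) := by positivity
  have h : ∀ s, |den P gbar i s / (M * upDen P i) - 1|
      = |den P gbar i s - M * upDen P i| / (M * upDen P i) := fun s => by
    rw [div_sub_one hD.ne', abs_div, abs_of_pos hD]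
  simp_rw [h]
  rw [integral_div, div_le_iff₀ hD, natCast_rpow_neg_half]
  refine (integral_abs_den_sub_le hP hg hM i hω0).trans ?_
  have h1 : (1 : ℝ) / √M * (M * upDen P i) = √M * upDen P i := by
    field_simp
    rw [sq, hs]
  have h2 : √(M : ℝ) * (omega P Side.A i + omega P Side.B i) ≤ √M * upDen P i := by
    gcongr
    exact add_omega_le_upDen hP i
  have h3 : 3 * k * M ≤ 3 * k / (2 * c) * (M * upDen P i) := by
    have : 2 * c ≤ upDen P i := by
      linarith [add_omega_le_upDen hP i, hω Side.A, hω Side.B]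
    have h4 : 3 * k / (2 * c) * (M * (2 * c)) ≤ 3 * k / (2 * c) * (M * upDen P i) := by gcongr
    refine le_of_eq_of_le ?_ h4
    field_simp
  have h5 : 2 * M * (upDen P i - (omega P Side.A i + omega P Side.B i)) ≤ 2 * M * k := by gcongr
  rw [add_mul, h1]
  linarith

lemma RUpW_eq (hP : P.Valid) (hM : 0 < M) (ha : ∀ X, 0 ≤ a X) (ha' : 0 < ∑ X, a X) {i : Fin N}
    (hω : ∀ X, 0 < omega P X i) :
    RUpW P gbar a i = P.prelog / Real.log 2 * ∫ s, Real.log (1 + sinrUp P M a i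
      * ((sigW P gbar a i s / ((M : ℝ) ^ 2 * sigLim P a i))
        / (den P gbar i s / (M * upDen P i)))) ∂law N M := by
  have hM' : (0 : ℝ) < M := by exact_mod_cast hM
  have hL := sigLim_pos hP ha ha' hω
  have hU := upDen_pos hP hω
  have h : ∀ S d : ℝ, sinrUp P M a i * ((S / ((M : ℝ) ^ 2 * sigLim P a i))
      / (d / (M * upDen P i))) = S / d := fun S d => by
    rw [sinrUp]
    -- At a vanishing denominator both sides are zero by the convention for division.
    rcases eq_or_ne d 0 with rfl | hd
    · simp
    · field_simp
  simp_rw [h, RUpW, Real.logb, integral_div]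
  ring

end WeightedUplink

/-! ### Normalised uplink terms -/

section Normalised

variable {N M : ℕ} (P : Params N) (gbar : Side → Fin N → Fin M → ℂ) (a : Side → ℝ) (i : Fin N)

/-- The weighted uplink signal divided by its limit. -/
def relSig (s : Sample N M) : ℝ := sigW P gbar a i s / ((M : ℝ) ^ 2 * sigLim P a i)

/-- The uplink denominator divided by its approximate mean. -/
def relDen (s : Sample N M) : ℝ := den P gbar i s / (M * upDen P i)

/-- The random bound for the normalised uplink ratio. -/
def relBound (s : Sample N M) : ℝ := upDen P i / M * relNorm P gbar i s

variable {P gbar a i}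

lemma relSig_nonneg (hP : P.Valid) (ha : ∀ X, 0 ≤ a X) (s : Sample N M) :
    0 ≤ relSig P gbar a i s :=
  div_nonneg (sigW_nonneg hP ha i s) (mul_nonneg (sq_nonneg _)
    (Finset.sum_nonneg fun X _ => mul_nonneg (ha X)
      (mul_nonneg (hP.p_pos X i).le (sq_nonneg _))))

lemma relDen_nonneg (hP : P.Valid) (hω : ∀ X, 0 < omega P X i) (s : Sample N M) :
    0 ≤ relDen P gbar i s :=
  div_nonneg (den_nonneg hP i s) (mul_nonneg (Nat.cast_nonneg _) (upDen_pos hP hω).le)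

lemma relBound_nonneg (hP : P.Valid) (hω : ∀ X, 0 < omega P X i) (s : Sample N M) :
    0 ≤ relBound P gbar i s :=
  mul_nonneg (div_nonneg (upDen_pos hP hω).le (Nat.cast_nonneg _)) (relNorm_nonneg i s)

lemma relSig_le (hP : P.Valid) (hM : 0 < M) (ha : ∀ X, 0 ≤ a X) (ha' : 0 < ∑ X, a X)
    (hω : ∀ X, 0 < omega P X i) (s : Sample N M) :
    relSig P gbar a i s ≤ relBound P gbar i s * relDen P gbar i s := by
  have hM' : (0 : ℝ) < M := by exact_mod_cast hM
  have hL := sigLim_pos hP ha ha' hω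
  have hU := upDen_pos hP hω
  rw [relSig, div_le_iff₀ (by positivity)]
  refine (sigW_le_mul_den hP ha hω s).trans_eq ?_
  rw [relBound, relDen]
  field_simp

lemma integrable_relSig (hP : P.Valid) : Integrable (relSig P gbar a i) (law N M) :=
  (integrable_sigW hP i).div_const _

lemma integrable_relDen (hP : P.Valid) : Integrable (relDen P gbar i) (law N M) :=
  (integrable_den hP i).div_const _

lemma integrable_relBound (hP : P.Valid) : Integrable (relBound P gbar i) (law N M) :=
  (integrable_relNorm hP i).const_mul _

lemma integrable_relBound_sq (hP : P.Valid) :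
    Integrable (fun s => relBound P gbar i s ^ 2) (law N M) := by
  simp_rw [relBound, mul_pow]
  exact (integrable_relNorm_sq hP i).const_mul _

/-- The number of antennas cancels: the dominating variable has a bounded second moment as soon as
`upDen` is bounded. -/
lemma integral_relBound_sq_le (hP : P.Valid) (hg : ∀ X i, sqNorm (gbar X i) = M) (hM : 0 < M)
    {c : ℝ} (hc : 0 < c) (hω : ∀ X, c ≤ omega P X i) :
    ∫ s, relBound P gbar i s ^ 2 ∂law N M ≤ 8 * upDen P i ^ 2 / c ^ 2 := by
  have hM' : (0 : ℝ) < M := by exact_mod_cast hM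
  simp_rw [relBound, mul_pow]
  rw [integral_const_mul]
  calc _ ≤ (upDen P i / M) ^ 2 * (8 * (M : ℝ) ^ 2 / c ^ 2) := by
        gcongr
        exact integral_relNorm_sq_le hP hg hM hc hω
    _ = _ := by field_simp

end Normalised

/-! ### Scaled powers -/

section Scaled

variable {N : ℕ} {P : Params N} {gbar : (M : ℕ) → Side → Fin N → Fin M → ℂ} {α ε γ : ℝ}

lemma scale_valid (hP : P.Valid) {M : ℕ} (hM : 0 < M) : (P.scale α ε γ M).Valid := by
  have hM' : (0 : ℝ) < M := by exact_mod_cast hM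
  exact ⟨hP.tau_pos, hP.tau_lt, hP.beta_pos, hP.K_nonneg,
    fun X i => div_pos (hP.p_pos X i) (by positivity), div_pos hP.pr_pos (by positivity),
    div_pos hP.pp_pos (by positivity)⟩

lemma prelog_pos (hP : P.Valid) : 0 < P.prelog :=
  div_pos (sub_pos.2 hP.tau_lt) (mul_pos two_pos (hP.tau_pos.trans hP.tau_lt))

/-- For `γ = 0` the scaled `omega` does not depend on `M`. For `γ > 0` the estimated scatter fades
away and the line of sight alone gives the bound, so positive Rician factors are needed. -/
lemma exists_le_omega_scale (hP : P.Valid) (hγ : 0 ≤ γ) (hK : 0 < γ → ∀ X i, 0 < P.K X i)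
    (i : Fin N) :
    ∃ c, 0 < c ∧ ∀ M : ℕ, 0 < M → ∀ X j, c ≤ omega (P.scale α ε γ M) X j := by
  have hf : ∃ f : Side × Fin N → ℝ, (∀ u, 0 < f u) ∧
      ∀ M : ℕ, 0 < M → ∀ u, f u ≤ omega (P.scale α ε γ M) u.1 u.2 := by
    rcases hγ.eq_or_lt with rfl | hγ
    · refine ⟨fun u => omega P u.1 u.2, fun u => ?_, fun M _ u => ?_⟩
      · have h1 := hP.beta_pos u.1 u.2
        have h2 := hP.K_nonneg u.1 u.2
        have h3 := snr_pos hP u.1 u.2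
        unfold omega eta
        positivity
      · simp [omega, eta, Params.scale]
    · refine ⟨fun u => P.β u.1 u.2 / (P.K u.1 u.2 + 1) * P.K u.1 u.2, fun u => ?_,
        fun M hM u => ?_⟩
      · have h1 := hP.beta_pos u.1 u.2
        have h2 := hK hγ u.1 u.2
        positivity
      · have h1 := hP.beta_pos u.1 u.2
        have h2 := hK hγ u.1 u.2
        have h3 := eta_nonneg (scale_valid (α := α) (ε := ε) (γ := γ) hP hM) u.1 u.2
        refine mul_le_mul_of_nonneg_left ?_ (by positivity)
        exact le_add_of_nonneg_right h3
  obtain ⟨f, hf0, hf⟩ := hf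
  have : Nonempty (Side × Fin N) := ⟨(Side.A, i)⟩
  obtain ⟨u, hu⟩ := Finite.exists_min f
  exact ⟨f u, hf0 u, fun M hM X j => (hu (X, j)).trans (hf M hM (X, j))⟩

lemma tendsto_losCorr_div (hg : LineOfSight gbar) {X : Side} {i : Fin N} {Y : Side}
    {j : Fin N} (h : (X, i) ≠ (Y, j)) :
    Tendsto (fun M : ℕ => losCorr P (gbar M) X i Y j / M) atTop (𝓝 0) := by
  have := (hg.orthogonal X i Y j h).const_mul (losAmp P X i ^ 2 * losAmp P Y j ^ 2)
  rw [mul_zero] at this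
  refine this.congr fun M => ?_
  rw [losCorr_eq, mul_div_assoc]

lemma eventually_losCorr_le (hg : LineOfSight gbar) :
    ∀ᶠ M : ℕ in atTop, ∀ X i Y j, (X, i) ≠ (Y, j) → losCorr P (gbar M) X i Y j ≤ M := by
  simp only [eventually_all]
  intro X i Y j h
  filter_upwards [(tendsto_losCorr_div hg h).eventually_le_const one_pos,
    eventually_gt_atTop 0] with M h1 hM
  have hM' : (0 : ℝ) < M := by exact_mod_cast hM
  rwa [div_le_one hM'] at h1

lemma tendsto_losUp_div (hg : LineOfSight gbar) (i : Fin N) :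
    Tendsto (fun M : ℕ => losUp P (gbar M) i / M) atTop (𝓝 0) := by
  have h : Tendsto (fun M : ℕ => ∑ j ∈ Finset.univ.erase i,
    (P.p Side.A j * (losCorr P (gbar M) Side.A i Side.A j / M
        + losCorr P (gbar M) Side.B i Side.A j / M)
      + P.p Side.B j * (losCorr P (gbar M) Side.A i Side.B j / M
        + losCorr P (gbar M) Side.B i Side.B j / M))) atTop
      (𝓝 (∑ j ∈ Finset.univ.erase i,
        (P.p Side.A j * (0 + 0) + P.p Side.B j * (0 + 0)))) := by
    refine tendsto_finsetSum _ fun j hj => ?_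
    have hne : ∀ X Y : Side, (X, i) ≠ (Y, j) := fun X Y h =>
      Finset.ne_of_mem_erase hj (congrArg Prod.snd h.symm)
    have ht := fun X Y => tendsto_losCorr_div (P := P) hg (hne X Y)
    exact (((ht _ _).add (ht _ _)).const_mul _).add (((ht _ _).add (ht _ _)).const_mul _)
  simp only [add_zero, mul_zero, Finset.sum_const_zero] at h
  refine h.congr fun M => ?_
  rw [losUp, Finset.sum_div]
  exact Finset.sum_congr rfl fun j _ => by ring

lemma tendsto_losDown_div (hg : LineOfSight gbar) (X : Side) (i : Fin N) :
    Tendsto (fun M : ℕ => losDown P (gbar M) X i / M) atTop (𝓝 0) := by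
  have h : Tendsto (fun M : ℕ => ∑ j ∈ Finset.univ.erase i,
    (losCorr P (gbar M) Side.B j X i / M + losCorr P (gbar M) Side.A j X i / M)) atTop
      (𝓝 (∑ j ∈ Finset.univ.erase i, (0 + 0))) := by
    refine tendsto_finsetSum _ fun j hj => ?_
    have hne : ∀ Y : Side, (Y, j) ≠ (X, i) := fun Y h =>
      Finset.ne_of_mem_erase hj (congrArg Prod.snd h)
    exact (tendsto_losCorr_div hg (hne _)).add (tendsto_losCorr_div hg (hne _))
  simp only [add_zero, Finset.sum_const_zero] at h
  refine h.congr fun M => ?_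
  rw [losDown, Finset.sum_div]
  exact Finset.sum_congr rfl fun j _ => by ring

lemma div_rpow_le_self {x r : ℝ} {M : ℕ} (hx : 0 ≤ x) (hr : 0 ≤ r) (hM : 0 < M) :
    x / (M : ℝ) ^ r ≤ x :=
  div_le_self hx (Real.one_le_rpow (by exact_mod_cast hM) hr)

lemma losUp_scale_le (hP : P.Valid) (hα : 0 ≤ α) {M : ℕ} (hM : 0 < M) (i : Fin N) :
    losUp (P.scale α ε γ M) (gbar M) i ≤ losUp P (gbar M) i :=
  Finset.sum_le_sum fun _ _ => add_le_add
    (mul_le_mul_of_nonneg_right (div_rpow_le_self (hP.p_pos _ _).le hα hM)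
      (add_nonneg (losCorr_nonneg ..) (losCorr_nonneg ..)))
    (mul_le_mul_of_nonneg_right (div_rpow_le_self (hP.p_pos _ _).le hα hM)
      (add_nonneg (losCorr_nonneg ..) (losCorr_nonneg ..)))

/-- Linearity in `p` is the point: everything beyond the noise scales with the user powers. The
pair's own errors account for `4 p b ^ 2`, every other pair for as much again. -/
lemma upDen_sub_le (hP : P.Valid) {p b : ℝ} (hp : ∀ X j, P.p X j ≤ p) (hb : ∀ X j, P.β X j ≤ b)
    (i : Fin N) :
    upDen P i - (omega P Side.A i + omega P Side.B i) ≤ 4 * (N + 1) * (p * b ^ 2) := by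
  have hb0 : 0 ≤ b := (hP.beta_pos Side.A i).le.trans (hb _ _)
  have hp0 : 0 ≤ p := (hP.p_pos Side.A i).le.trans (hp _ _)
  have ho : ∀ X, omega P X i ≤ b := fun X => (omega_le hP X i).trans (hb X i)
  have hps : ∀ X, P.p X i * sigmaSq P X i ≤ p * b := fun X =>
    mul_le_mul (hp X i) ((sigmaSq_le hP X i).trans (hb X i)) (sigmaSq_nonneg hP X i) hp0
  have hps0 : ∀ X, 0 ≤ P.p X i * sigmaSq P X i := fun X =>
    mul_nonneg (hP.p_pos X i).le (sigmaSq_nonneg hP X i)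
  have hcr : ∀ X Y j, cross P X i Y j ≤ b ^ 2 := fun X Y j => by
    rw [sq]
    exact (cross_le hP X i Y j).trans
      (mul_le_mul (hb X i) (hb Y j) (hP.beta_pos Y j).le hb0)
  have hpc : ∀ Y j, P.p Y j * (cross P Side.A i Y j + cross P Side.B i Y j)
      ≤ p * (b ^ 2 + b ^ 2) := fun Y j =>
    mul_le_mul (hp Y j) (add_le_add (hcr _ _ _) (hcr _ _ _))
      (add_nonneg (cross_nonneg hP ..) (cross_nonneg hP ..)) hp0
  have hQ : Q P i ≤ N * (4 * (p * b ^ 2)) := by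
    calc Q P i ≤ ∑ _j ∈ Finset.univ.erase i, 4 * (p * b ^ 2) := by
          refine Finset.sum_le_sum fun j _ => ?_
          simp only [xi, chi]
          linarith [hpc Side.A j, hpc Side.B j]
      _ = ((Finset.univ.erase i).card : ℝ) * (4 * (p * b ^ 2)) := by simp
      _ ≤ _ := by
          gcongr
          simp
  have h1 : (omega P Side.A i + omega P Side.B i)
      * (P.p Side.A i * sigmaSq P Side.A i + P.p Side.B i * sigmaSq P Side.B i)
      ≤ (b + b) * (p * b + p * b) :=
    mul_le_mul (add_le_add (ho _) (ho _)) (add_le_add (hps _) (hps _))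
      (add_nonneg (hps0 _) (hps0 _)) (by positivity)
  rw [upDen, q]
  linarith

lemma losUp_le (hP : P.Valid) {p l : ℝ} (hl : 0 ≤ l) (hp : ∀ X j, P.p X j ≤ p) (i : Fin N) {M : ℕ}
    {g : Side → Fin N → Fin M → ℂ}
    (hlos : ∀ X i Y j, (X, i) ≠ (Y, j) → losCorr P g X i Y j ≤ l) :
    losUp P g i ≤ 4 * N * (p * l) := by
  have hp0 : 0 ≤ p := (hP.p_pos Side.A i).le.trans (hp _ _)
  calc losUp P g i ≤ ∑ _j ∈ Finset.univ.erase i, 4 * (p * l) := by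
        refine Finset.sum_le_sum fun j hj => ?_
        have hne : ∀ X Y : Side, (X, i) ≠ (Y, j) := fun X Y h =>
          Finset.ne_of_mem_erase hj (congrArg Prod.snd h.symm)
        have h : ∀ Y, P.p Y j * (losCorr P g Side.A i Y j + losCorr P g Side.B i Y j)
            ≤ p * (l + l) := fun Y =>
          mul_le_mul (hp Y j) (add_le_add (hlos _ _ _ _ (hne _ _)) (hlos _ _ _ _ (hne _ _)))
            (add_nonneg (losCorr_nonneg ..) (losCorr_nonneg ..)) hp0
        linarith [h Side.A, h Side.B]
    _ = ((Finset.univ.erase i).card : ℝ) * (4 * (p * l)) := by simp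
    _ ≤ N * (4 * (p * l)) := by
        gcongr
        simp
    _ = _ := by ring

lemma exists_uplink_bounds (hP : P.Valid) (hg : LineOfSight gbar) (hγ : 0 ≤ γ)
    (hK : 0 < γ → ∀ X i, 0 < P.K X i) (i : Fin N) :
    ∃ c b k : ℝ, 0 < c ∧ 0 ≤ b ∧ 0 ≤ k ∧ ∀ᶠ M : ℕ in atTop, 0 < M ∧
      (∀ X j, c ≤ omega (P.scale α ε γ M) X j) ∧ (∀ X j, omega (P.scale α ε γ M) X j ≤ b) ∧
      (∀ X : Side, losCorr (P.scale α ε γ M) (gbar M) X.other i X i ≤ M) ∧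
      upDen (P.scale α ε γ M) i
        - (omega (P.scale α ε γ M) Side.A i + omega (P.scale α ε γ M) Side.B i)
        ≤ k * (M : ℝ) ^ (-α) ∧
      losUp (P.scale α ε γ M) (gbar M) i ≤ k * (M : ℝ) ^ (-α) * M := by
  obtain ⟨c, hc, hω⟩ := exists_le_omega_scale (α := α) (ε := ε) hP hγ hK i
  obtain ⟨b, hb⟩ := (Set.finite_range (fun u : Side × Fin N => P.β u.1 u.2)).bddAbove
  obtain ⟨p, hp⟩ := (Set.finite_range (fun u : Side × Fin N => P.p u.1 u.2)).bddAbove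
  have hb' : ∀ X j, P.β X j ≤ b := fun X j => hb ⟨(X, j), rfl⟩
  have hp' : ∀ X j, P.p X j ≤ p := fun X j => hp ⟨(X, j), rfl⟩
  have hb0 : 0 ≤ b := (hP.beta_pos Side.A i).le.trans (hb' _ _)
  have hp0 : 0 ≤ p := (hP.p_pos Side.A i).le.trans (hp' _ _)
  -- The sum `b ^ 2 + 1` covers both `b ^ 2` from `upDen` and `1` from the line-of-sight bound
  -- `losCorr ≤ M`.
  refine ⟨c, b, 4 * (N + 1) * (p * (b ^ 2 + 1)), hc, hb0, by positivity, ?_⟩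
  filter_upwards [eventually_gt_atTop 0, eventually_losCorr_le hg] with M hM hlos
  have hM' : (0 : ℝ) < M := by exact_mod_cast hM
  have hV := scale_valid (α := α) (ε := ε) (γ := γ) hP hM
  have hps : ∀ X j, (P.scale α ε γ M).p X j ≤ p * (M : ℝ) ^ (-α) := fun X j => by
    rw [Real.rpow_neg hM'.le, ← div_eq_mul_inv]
    exact div_le_div_of_nonneg_right (hp' X j) (by positivity)
  refine ⟨hM, hω M hM, fun X j => (omega_le hV X j).trans (hb' X j),
    fun X => hlos _ _ _ _ (X.other_prod_ne i), ?_, ?_⟩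
  · refine (upDen_sub_le hV hps hb' i).trans ?_
    calc 4 * (N + 1) * (p * (M : ℝ) ^ (-α) * b ^ 2)
        = 4 * (N + 1) * (p * b ^ 2) * (M : ℝ) ^ (-α) := by ring
      _ ≤ _ := by gcongr; linarith
  · refine (losUp_le hV hM'.le hps i hlos).trans ?_
    calc 4 * N * (p * (M : ℝ) ^ (-α) * M) = 4 * N * (p * 1) * (M : ℝ) ^ (-α) * M := by ring
      _ ≤ _ := by gcongr <;> nlinarith

end Scaled

/-! ### Asymptotic spectral efficiencies -/

section Asymptotics

variable {N : ℕ} {P : Params N} {gbar : (M : ℕ) → Side → Fin N → Fin M → ℂ} {α ε γ : ℝ}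
  {a : Side → ℝ}

lemma sigLim_le (hP : P.Valid) (ha : ∀ X, 0 ≤ a X) {b : ℝ} {i : Fin N}
    (hb : ∀ X, omega P X i ≤ b) : sigLim P a i ≤ (∑ X, a X * P.p X i) * b ^ 2 := by
  rw [sigLim, Finset.sum_mul]
  refine Finset.sum_le_sum fun X _ => ?_
  rw [← mul_assoc]
  exact mul_le_mul_of_nonneg_left (pow_le_pow_left₀ (omega_nonneg hP X i) (hb X) 2)
    (mul_nonneg (ha X) (hP.p_pos X i).le)

lemma le_sigLim (hP : P.Valid) (ha : ∀ X, 0 ≤ a X) {c : ℝ} (hc : 0 ≤ c) {i : Fin N}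
    (hω : ∀ X, c ≤ omega P X i) : (∑ X, a X * P.p X i) * c ^ 2 ≤ sigLim P a i := by
  rw [sigLim, Finset.sum_mul]
  refine Finset.sum_le_sum fun X _ => ?_
  rw [← mul_assoc]
  exact mul_le_mul_of_nonneg_left (pow_le_pow_left₀ hc (hω X) 2)
    (mul_nonneg (ha X) (hP.p_pos X i).le)

lemma rpow_neg_le_one {r : ℝ} (hr : 0 ≤ r) {M : ℕ} (hM : 0 < M) : (M : ℝ) ^ (-r) ≤ 1 :=
  Real.rpow_le_one_of_one_le_of_nonpos (by exact_mod_cast hM) (by linarith)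

/-- Bounds for the normalised uplink terms that hold for all large numbers of antennas. -/
lemma exists_relative_bounds (hP : P.Valid) (hg : LineOfSight gbar) (hα : 0 ≤ α) (hγ : 0 ≤ γ)
    (hK : 0 < γ → ∀ X i, 0 < P.K X i) (i : Fin N) (ha : ∀ X, 0 ≤ a X) (ha' : 0 < ∑ X, a X) :
    ∃ c C : ℝ, 0 < c ∧ 0 ≤ C ∧ ∀ᶠ M : ℕ in atTop, 0 < M ∧
      (∀ X, c ≤ omega (P.scale α ε γ M) X i) ∧
      0 < sinrUp (P.scale α ε γ M) M a i ∧
      sinrUp (P.scale α ε γ M) M a i ≤ C * M ∧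
      M * (M : ℝ) ^ (-α) ≤ C * sinrUp (P.scale α ε γ M) M a i ∧
      ∫ s, |relSig (P.scale α ε γ M) (gbar M) a i s - 1| ∂law N M
        ≤ C * (M : ℝ) ^ (-(1 / 2) : ℝ) ∧
      ∫ s, |relDen (P.scale α ε γ M) (gbar M) i s - 1| ∂law N M
        ≤ C * ((M : ℝ) ^ (-(1 / 2) : ℝ) + (M : ℝ) ^ (-α)) ∧
      ∫ s, relBound (P.scale α ε γ M) (gbar M) i s ^ 2 ∂law N M ≤ C := by
  obtain ⟨c, b, k, hc, hb0, hk, hev⟩ := exists_uplink_bounds (α := α) (ε := ε) hP hg hγ hK i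
  set p := ∑ X, a X * P.p X i with hpdef
  have hp : 0 < p := by
    obtain ⟨X, -, hX⟩ := Finset.exists_lt_of_sum_lt (f := fun _ => (0 : ℝ)) (by simpa using ha')
    exact Finset.sum_pos' (fun Y _ => mul_nonneg (ha Y) (hP.p_pos Y i).le)
      ⟨X, Finset.mem_univ _, mul_pos hX (hP.p_pos X i)⟩
  -- In order: the constants for the upper and lower bounds of the ratio, the deviations of signal
  -- and denominator, and the second moment. Their sum serves for all five.
  set C1 := p * b ^ 2 / (2 * c)
  set C2 := (2 * b + k) / (p * c ^ 2)
  set C3 := 3 + (1 + b ^ 2) / c ^ 2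
  set C4 := 1 + 3 * k / (2 * c)
  set C5 := 8 * (2 * b + k) ^ 2 / c ^ 2
  have h1 : 0 ≤ C1 := by positivity
  have h2 : 0 ≤ C2 := by positivity
  have h3 : 0 ≤ C3 := by positivity
  have h4 : 0 ≤ C4 := by positivity
  have h5 : 0 ≤ C5 := by positivity
  refine ⟨c, C1 + C2 + C3 + C4 + C5, hc, by positivity, ?_⟩
  filter_upwards [hev] with M hM
  obtain ⟨hM, hω, hB, hl, hu, hlu⟩ := hM
  have hM' : (0 : ℝ) < M := by exact_mod_cast hM
  have hV := scale_valid (α := α) (ε := ε) (γ := γ) hP hM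
  set P' := P.scale α ε γ M with hP'
  have hω' : ∀ X, c ≤ omega P' X i := fun X => hω X i
  have hB' : ∀ X, omega P' X i ≤ b := fun X => hB X i
  have hω0 : ∀ X, 0 < omega P' X i := fun X => hc.trans_le (hω' X)
  set t := (M : ℝ) ^ (-α) with ht
  have ht0 : 0 < t := by positivity
  have ht1 : t ≤ 1 := rpow_neg_le_one hα hM
  have hsum : ∑ X, a X * P'.p X i = p * t := by
    rw [hpdef, Finset.sum_mul]
    refine Finset.sum_congr rfl fun X _ => ?_
    rw [ht, Real.rpow_neg hM'.le, ← div_eq_mul_inv, mul_div_assoc]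
    rfl
  have hU := upDen_pos hV hω0
  have hL := sigLim_pos hV ha ha' hω0
  have hUl : 2 * c ≤ upDen P' i := by
    linarith [add_omega_le_upDen hV i, hω' Side.A, hω' Side.B]
  have hUu : upDen P' i ≤ 2 * b + k := by
    have : k * t ≤ k := mul_le_of_le_one_right hk ht1
    linarith [hB' Side.A, hB' Side.B]
  have hLu := sigLim_le hV ha hB'
  have hLl := le_sigLim hV ha hc.le hω'
  rw [hsum] at hLu hLl
  refine ⟨hM, hω', ?_, ?_, ?_, ?_, ?_, ?_⟩
  · rw [sinrUp]; positivity
  · calc sinrUp P' M a i ≤ M * (p * 1 * b ^ 2) / (2 * c) := by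
          rw [sinrUp]
          gcongr
          exact hLu.trans (by gcongr)
      _ = C1 * M := by simp only [C1]; ring
      _ ≤ _ := by gcongr; linarith
  · calc M * t = C2 * (M * (p * t * c ^ 2) / (2 * b + k)) := by
          have : 0 < 2 * b + k := hU.trans_le hUu
          simp only [C2]
          field_simp
      _ ≤ C2 * sinrUp P' M a i := by
          rw [sinrUp]
          gcongr
      _ ≤ _ := by
          have : 0 ≤ sinrUp P' M a i := by rw [sinrUp]; positivity
          gcongr
          linarith
  · refine (integral_abs_sigW_div_sub_one_le hV (hg.norm_sq M) hM ha ha' hc hω' hB' hl).trans ?_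
    have h6 : C3 ≤ C1 + C2 + C3 + C4 + C5 := by linarith
    exact mul_le_mul_of_nonneg_right h6 (by positivity)
  · refine (integral_abs_den_div_sub_one_le hV (hg.norm_sq M) hM hc hω' hu hlu).trans ?_
    have h6 : C4 * ((M : ℝ) ^ (-(1 / 2) : ℝ) + t)
        ≤ (C1 + C2 + C3 + C4 + C5) * ((M : ℝ) ^ (-(1 / 2) : ℝ) + t) := by
      gcongr
      linarith
    refine le_trans ?_ h6
    have h7 : 0 ≤ 3 * k / (2 * c) * (M : ℝ) ^ (-(1 / 2) : ℝ) := by positivity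
    have h8 : 3 * (k * t) / (2 * c) = 3 * k / (2 * c) * t := by ring
    simp only [C4]
    rw [h8]
    linarith
  · refine (integral_relBound_sq_le hV (hg.norm_sq M) hM hc hω').trans ?_
    have : 8 * upDen P' i ^ 2 / c ^ 2 ≤ C5 := by
      simp only [C5]
      gcongr
    linarith

lemma div_log_two_ne_zero (hP : P.Valid) : P.prelog / Real.log 2 ≠ 0 :=
  div_ne_zero (prelog_pos hP).ne' (Real.log_pos (by norm_num)).ne'

lemma StrongApprox.congr {u u' v v' : ℕ → ℝ} (h : StrongApprox u v)
    (hu : ∀ᶠ M in atTop, u M = u' M) (hv : ∀ᶠ M in atTop, v M = v' M) : StrongApprox u' v' := by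
  refine ⟨h.1.congr' ?_, h.2.congr' ?_⟩ <;> filter_upwards [hu, hv] with M h1 h2 <;> rw [h1, h2]

lemma LogApprox.congr {u u' v v' : ℕ → ℝ} (h : LogApprox u v)
    (hu : ∀ᶠ M in atTop, u M = u' M) (hv : ∀ᶠ M in atTop, v M = v' M) : LogApprox u' v' := by
  obtain ⟨h1, C, hC⟩ := h
  refine ⟨h1.congr' ?_, C, ?_⟩
  · filter_upwards [hu, hv] with M h1 h2
    rw [h1, h2]
  · filter_upwards [hu, hv, hC] with M h1 h2 h3
    rwa [← h1, ← h2]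

lemma prelog_mul_logb (x : ℝ) :
    P.prelog * Real.logb 2 x = P.prelog / Real.log 2 * Real.log x := by
  rw [Real.logb]; ring

/-- With decreasing user powers the ergodic uplink efficiency is given by the closed form. -/
lemma strongApprox_RUpW (hP : P.Valid) (hg : LineOfSight gbar) (hα : 0 < α) (hγ : 0 ≤ γ)
    (hK : 0 < γ → ∀ X i, 0 < P.K X i) (i : Fin N) (ha : ∀ X, 0 ≤ a X) (ha' : 0 < ∑ X, a X) :
    StrongApprox (fun M => RUpW (P.scale α ε γ M) (gbar M) a i)
      (fun M => (P.scale α ε γ M).prelog * Real.logb 2 (1 + sinrUp (P.scale α ε γ M) M a i)) := by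
  obtain ⟨c, C, hc, hC, hev⟩ :=
    exists_relative_bounds (ε := ε) hP hg hα.le hγ hK i ha ha'
  -- The slower of two decays: fluctuations vanish like `M ^ (-1/2)`, interference relative to noise
  -- like `M ^ (-α)`.
  set r := min (1 / 2) α with hr
  have hr0 : 0 < r := lt_min (by norm_num) hα
  have hex : ∀ M : ℕ, 0 < M → C * (M : ℝ) ^ (-(1 / 2) : ℝ)
      + C * ((M : ℝ) ^ (-(1 / 2) : ℝ) + (M : ℝ) ^ (-α)) ≤ 3 * C * (M : ℝ) ^ (-r) := fun M hM => by
    have hM' : (1 : ℝ) ≤ M := by exact_mod_cast hM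
    have e1 : (M : ℝ) ^ (-(1 / 2) : ℝ) ≤ (M : ℝ) ^ (-r) :=
      Real.rpow_le_rpow_of_exponent_le hM' (neg_le_neg (min_le_left _ _))
    have e2 : (M : ℝ) ^ (-α) ≤ (M : ℝ) ^ (-r) :=
      Real.rpow_le_rpow_of_exponent_le hM' (neg_le_neg (min_le_right _ _))
    nlinarith
  have key := strongApprox_log_of_abs_sub_le (r := r) (C := 3 * C)
    (I := fun M => ∫ s, Real.log (1 + sinrUp (P.scale α ε γ M) M a i
      * (relSig (P.scale α ε γ M) (gbar M) a i s / relDen (P.scale α ε γ M) (gbar M) i s))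
      ∂law N M)
    (s := fun M => sinrUp (P.scale α ε γ M) M a i) hr0 ?_ ?_ ?_
  · refine (key.const_mul (div_log_two_ne_zero hP)).congr ?_ (Eventually.of_forall fun M => ?_)
    · filter_upwards [hev] with M hM
      obtain ⟨hM, hω, -⟩ := hM
      exact (RUpW_eq (scale_valid hP hM) hM ha ha' fun X => hc.trans_le (hω X)).symm
    · exact (prelog_mul_logb _).symm
  · filter_upwards [hev] with M hM
    obtain ⟨hM, -, h1, h2, -⟩ := hM
    exact ⟨h1, h2.trans (by gcongr; linarith)⟩
  all_goals
    filter_upwards [hev] with M hM δ η hδ0 hδ hη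
    obtain ⟨hM, hω, h1, -, -, h3, h4, h5⟩ := hM
    have hV := scale_valid (α := α) (ε := ε) (γ := γ) hP hM
    have hω0 : ∀ X, 0 < omega (P.scale α ε γ M) X i := fun X => hc.trans_le (hω X)
  · exact abs_integral_log_sub_le h1 (relSig_nonneg hV ha) (relDen_nonneg hV hω0)
      (relBound_nonneg hV hω0) (relSig_le hV hM ha ha' hω0) (integrable_relSig hV)
      (integrable_relDen hV) (integrable_relBound_sq hV) hδ0 hδ hη
      ((add_le_add h3 h4).trans (hex M hM)) (h5.trans (by linarith))
  · exact abs_integral_log_sub_le_mul h1 (relSig_nonneg hV ha) (relDen_nonneg hV hω0)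
      (relBound_nonneg hV hω0) (relSig_le hV hM ha ha' hω0) (integrable_relSig hV)
      (integrable_relDen hV) (integrable_relBound_sq hV) hδ0 hδ hη
      ((add_le_add h3 h4).trans (hex M hM)) (h5.trans (by linarith))

/-- With fixed user powers the ergodic uplink efficiency is given by the closed form up to a
bounded error. -/
lemma logApprox_RUpW (hP : P.Valid) (hg : LineOfSight gbar) (hγ : 0 ≤ γ)
    (hK : 0 < γ → ∀ X i, 0 < P.K X i) (i : Fin N) (ha : ∀ X, 0 ≤ a X) (ha' : 0 < ∑ X, a X) :
    LogApprox (fun M => RUpW (P.scale 0 ε γ M) (gbar M) a i)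
      (fun M => (P.scale 0 ε γ M).prelog * Real.logb 2 (1 + sinrUp (P.scale 0 ε γ M) M a i)) := by
  obtain ⟨c, C, hc, hC, hev⟩ :=
    exists_relative_bounds (α := 0) (ε := ε) hP hg le_rfl hγ hK i ha ha'
  have hl2 : 0 ≤ Real.log 2 := Real.log_nonneg (by norm_num)
  have key := logApprox_log_of_abs_sub_le (r := 1 / 2) (C := 2 + 4 * C + Real.log 2)
    (I := fun M => ∫ s, Real.log (1 + sinrUp (P.scale 0 ε γ M) M a i
      * (relSig (P.scale 0 ε γ M) (gbar M) a i s / relDen (P.scale 0 ε γ M) (gbar M) i s))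
      ∂law N M)
    (s := fun M => sinrUp (P.scale 0 ε γ M) M a i) (by norm_num) ?_ ?_ ?_
  · refine (key.const_mul (div_log_two_ne_zero hP)).congr ?_ (Eventually.of_forall fun M => ?_)
    · filter_upwards [hev] with M hM
      obtain ⟨hM, hω, -⟩ := hM
      exact (RUpW_eq (scale_valid hP hM) hM ha ha' fun X => hc.trans_le (hω X)).symm
    · exact (prelog_mul_logb _).symm
  · filter_upwards [hev] with M hM
    obtain ⟨hM, -, h1, h2, -⟩ := hM
    exact ⟨h1, h2.trans (by gcongr; linarith)⟩
  -- At `α = 0` the lower bound reads `M ≤ C * sinrUp`, so the ratio grows linearly; `C + 1` avoids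
  -- dividing by a possibly zero `C`.
  · have ht : Tendsto (fun M : ℕ => (M : ℝ) / (C + 1)) atTop atTop :=
      tendsto_natCast_atTop_atTop.atTop_div_const (by positivity)
    refine tendsto_atTop_mono' _ ?_ ht
    filter_upwards [hev] with M hM
    obtain ⟨hM, -, h1, -, h2, -⟩ := hM
    rw [neg_zero, Real.rpow_zero, mul_one] at h2
    rw [div_le_iff₀ (by positivity)]
    linarith
  · filter_upwards [hev] with M hM
    obtain ⟨hM, hω, h1, -, -, h3, h4, h5⟩ := hM
    have hV := scale_valid (α := 0) (ε := ε) (γ := γ) hP hM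
    have hω0 : ∀ X, 0 < omega (P.scale 0 ε γ M) X i := fun X => hc.trans_le (hω X)
    have hL : 0 ≤ Real.log (1 + sinrUp (P.scale 0 ε γ M) M a i) :=
      Real.log_nonneg (by linarith)
    -- At `α = 0` the deviation bound for the denominator does not tend to zero; it only serves to
    -- bound the mean.
    have hy : ∫ s, relDen (P.scale 0 ε γ M) (gbar M) i s ∂law N M ≤ 1 + 2 * C := by
      have hi := integrable_relDen (gbar := gbar M) (i := i) hV
      have e1 : ∫ s, relDen (P.scale 0 ε γ M) (gbar M) i s ∂law N M - 1
          = ∫ s, (relDen (P.scale 0 ε γ M) (gbar M) i s - 1) ∂law N M := by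
        rw [integral_sub hi (integrable_const _)]; simp
      have e2 := (le_abs_self _).trans (abs_integral_le_integral_abs
        (f := fun s => relDen (P.scale 0 ε γ M) (gbar M) i s - 1) (μ := law N M))
      have e3 := rpow_neg_le_one (r := 1 / 2) (by norm_num) hM
      have e4 : C * ((M : ℝ) ^ (-(1 / 2) : ℝ) + (M : ℝ) ^ (-0 : ℝ)) ≤ C * (1 + 1) := by
        rw [neg_zero, Real.rpow_zero]
        gcongr
      linarith
    have e5 := abs_integral_log_sub_le_const h1 (relSig_nonneg hV ha) (relDen_nonneg hV hω0)
      (relBound_nonneg hV hω0) (relSig_le hV hM ha ha' hω0) (integrable_relSig hV)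
      (integrable_relDen hV) (integrable_relBound hV) (integrable_relBound_sq hV) h3 h5
    have e6 : 2 * Real.log (1 + sinrUp (P.scale 0 ε γ M) M a i) * (C * (M : ℝ) ^ (-(1 / 2) : ℝ))
        ≤ 2 * Real.log (1 + sinrUp (P.scale 0 ε γ M) M a i)
          * ((2 + 4 * C + Real.log 2) * (M : ℝ) ^ (-(1 / 2) : ℝ)) := by
      gcongr
      linarith
    linarith

lemma tendsto_integral_of_integral_abs_sub {Ω : ℕ → Type*} [∀ M, MeasurableSpace (Ω M)]
    {μ : ∀ M, Measure (Ω M)} [∀ M, IsProbabilityMeasure (μ M)] {f : ∀ M, Ω M → ℝ}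
    {e : ℕ → ℝ} (he : Tendsto e atTop (𝓝 0))
    (h : ∀ᶠ M in atTop, Integrable (f M) (μ M) ∧ ∫ s, |f M s - 1| ∂μ M ≤ e M) :
    Tendsto (fun M => ∫ s, f M s ∂μ M) atTop (𝓝 1) := by
  rw [← tendsto_sub_nhds_zero_iff]
  refine squeeze_zero_norm' ?_ he
  filter_upwards [h] with M hM
  have e1 : ∫ s, f M s ∂μ M - 1 = ∫ s, (f M s - 1) ∂μ M := by
    rw [integral_sub hM.1 (integrable_const _)]; simp
  rw [e1]
  exact abs_integral_le_integral_abs.trans hM.2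

/-- The uplink efficiency computed from expected powers is given by the closed form. -/
lemma strongApprox_meanUp (hP : P.Valid) (hg : LineOfSight gbar) (hα : 0 ≤ α) (hγ : 0 ≤ γ)
    (hK : 0 < γ → ∀ X i, 0 < P.K X i) (i : Fin N) (ha : ∀ X, 0 ≤ a X) (ha' : 0 < ∑ X, a X) :
    StrongApprox (fun M => (P.scale α ε γ M).prelog * Real.logb 2
        (1 + (∫ s, sigW (P.scale α ε γ M) (gbar M) a i s ∂law N M)
          / ∫ s, den (P.scale α ε γ M) (gbar M) i s ∂law N M))
      (fun M => (P.scale α ε γ M).prelog * Real.logb 2 (1 + sinrUp (P.scale α ε γ M) M a i)) := by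
  obtain ⟨c, C, hc, hC, hev⟩ :=
    exists_relative_bounds (ε := ε) hP hg hα hγ hK i ha ha'
  have hS : Tendsto (fun M => ∫ s, relSig (P.scale α ε γ M) (gbar M) a i s ∂law N M) atTop
      (𝓝 1) := by
    have he := (tendsto_natCast_rpow_neg (r := 1 / 2) (by norm_num)).const_mul C
    rw [mul_zero] at he
    refine tendsto_integral_of_integral_abs_sub he ?_
    filter_upwards [hev] with M hM
    obtain ⟨hM, -, -, -, -, h3, -⟩ := hM
    exact ⟨integrable_relSig (scale_valid hP hM), h3⟩
  have hY : Tendsto (fun M => ∫ s, relDen (P.scale α ε γ M) (gbar M) i s ∂law N M) atTop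
      (𝓝 1) := by
    -- The mean of `relDen` is exactly 1 plus a line-of-sight term that vanishes for every `α ≥ 0`,
    -- so no concentration of the denominator is needed.
    have he := ((tendsto_losUp_div (P := P) hg i).div_const (2 * c)).const_add 1
    rw [zero_div, add_zero] at he
    refine tendsto_of_tendsto_of_tendsto_of_le_of_le' tendsto_const_nhds he ?_ ?_ <;>
    · filter_upwards [hev] with M hM
      obtain ⟨hM, hω, -⟩ := hM
      have hM' : (0 : ℝ) < M := by exact_mod_cast hM
      have hV := scale_valid (α := α) (ε := ε) (γ := γ) hP hM
      have hω0 : ∀ X, 0 < omega (P.scale α ε γ M) X i := fun X => hc.trans_le (hω X)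
      have hU := upDen_pos hV hω0
      have hUl : 2 * c ≤ upDen (P.scale α ε γ M) i := by
        linarith [add_omega_le_upDen hV i, hω Side.A, hω Side.B]
      have hl := losUp_nonneg (gbar := gbar M) hV i
      have hl' := losUp_nonneg (gbar := gbar M) hP i
      have heq : ∫ s, relDen (P.scale α ε γ M) (gbar M) i s ∂law N M
          = 1 + losUp (P.scale α ε γ M) (gbar M) i / M / upDen (P.scale α ε γ M) i := by
        simp_rw [relDen]
        rw [integral_div, integral_den hV (hg.norm_sq M)]
        field_simp
      rw [heq]
      first
      | exact le_add_of_nonneg_right (by positivity)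
      | gcongr
        exact losUp_scale_le hP hα hM i
  have hR := hS.div hY one_ne_zero
  rw [div_one] at hR
  have heq : ∀ᶠ M : ℕ in atTop,
      (∫ s, relSig (P.scale α ε γ M) (gbar M) a i s ∂law N M)
        / (∫ s, relDen (P.scale α ε γ M) (gbar M) i s ∂law N M)
      = ((∫ s, sigW (P.scale α ε γ M) (gbar M) a i s ∂law N M)
          / ∫ s, den (P.scale α ε γ M) (gbar M) i s ∂law N M)
        / sinrUp (P.scale α ε γ M) M a i := by
    filter_upwards [hev] with M hM
    obtain ⟨hM, hω, -⟩ := hM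
    have hM' : (0 : ℝ) < M := by exact_mod_cast hM
    have hV := scale_valid (α := α) (ε := ε) (γ := γ) hP hM
    have hω0 : ∀ X, 0 < omega (P.scale α ε γ M) X i := fun X => hc.trans_le (hω X)
    have hU := upDen_pos hV hω0
    have hL := sigLim_pos hV ha ha' hω0
    have hd : 0 < ∫ s, den (P.scale α ε γ M) (gbar M) i s ∂law N M := by
      rw [integral_den hV (hg.norm_sq M)]
      have := losUp_nonneg (gbar := gbar M) hV i
      positivity
    simp_rw [relSig, relDen, sinrUp]
    rw [integral_div, integral_div]
    field_simp
  have hpos : ∀ᶠ M : ℕ in atTop, 0 < sinrUp (P.scale α ε γ M) M a i := by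
    filter_upwards [hev] with M hM using hM.2.2.1
  have hR' := hR.congr' heq
  refine ((strongApprox_log_one_add ?_ hpos hR').const_mul (div_log_two_ne_zero hP)).congr
    (Eventually.of_forall fun M => (prelog_mul_logb _).symm)
    (Eventually.of_forall fun M => (prelog_mul_logb _).symm)
  filter_upwards [hpos, hR'.eventually_const_lt one_pos] with M h1 h2
  rwa [div_pos_iff_of_pos_right h1] at h2

/-- The closed-form downlink ratio. -/
def sinrDownApprox (P : Params N) (M : ℕ) (X : Side) (i : Fin N) : ℝ :=
  M * P.pr * omega P X i ^ 2 / downDen P X i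

lemma sinrDownApprox_pos (hP : P.Valid) {M : ℕ} (hM : 0 < M) (X : Side) {i : Fin N}
    (hω : ∀ X, 0 < omega P X i) : 0 < sinrDownApprox P M X i := by
  have hM' : (0 : ℝ) < M := by exact_mod_cast hM
  have hD : 0 < downDen P X i := (add_pos (hω _) (hω _)).trans_le (add_omega_le_downDen hP X i)
  have := hP.pr_pos
  have := hω X
  rw [sinrDownApprox]
  positivity

lemma strongApprox_RDown (hP : P.Valid) (hg : LineOfSight gbar) (hε : 0 ≤ ε) (hγ : 0 ≤ γ)
    (hK : 0 < γ → ∀ X i, 0 < P.K X i) (X : Side) (i : Fin N) :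
    StrongApprox (fun M => RDown (P.scale α ε γ M) (gbar M) X i)
      (fun M => RDownApprox (P.scale α ε γ M) M X i) := by
  obtain ⟨c, hc, hω⟩ := exists_le_omega_scale (α := α) (ε := ε) hP hγ hK i
  have hpos : ∀ᶠ M : ℕ in atTop, 0 < sinrDownApprox (P.scale α ε γ M) M X i := by
    filter_upwards [eventually_gt_atTop 0] with M hM
    exact sinrDownApprox_pos (scale_valid hP hM) hM X fun X => hc.trans_le (hω M hM X i)
  have hR : Tendsto (fun M => sinrDown (P.scale α ε γ M) (gbar M) X i
      / sinrDownApprox (P.scale α ε γ M) M X i) atTop (𝓝 1) := by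
    -- The inverse quotient is simpler: the line-of-sight term sits in the denominator of
    -- `sinrDown`, so it becomes a plain summand.
    have hinv : Tendsto (fun M => sinrDownApprox (P.scale α ε γ M) M X i
        / sinrDown (P.scale α ε γ M) (gbar M) X i) atTop (𝓝 1) := by
      have he := (((tendsto_losDown_div (P := P) hg X i).const_mul P.pr).div_const (2 * c)).const_add 1
      rw [mul_zero, zero_div, add_zero] at he
      refine tendsto_of_tendsto_of_tendsto_of_le_of_le' tendsto_const_nhds he ?_ ?_ <;>
      · filter_upwards [eventually_gt_atTop 0] with M hM
        have hM' : (0 : ℝ) < M := by exact_mod_cast hM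
        have hV := scale_valid (α := α) (ε := ε) (γ := γ) hP hM
        have hω0 : ∀ X, 0 < omega (P.scale α ε γ M) X i := fun X => hc.trans_le (hω M hM X i)
        have hDl : 2 * c ≤ downDen (P.scale α ε γ M) X i := by
          linarith [add_omega_le_downDen hV X i, hω M hM Side.A i, hω M hM Side.B i]
        have hD : 0 < downDen (P.scale α ε γ M) X i := lt_of_lt_of_le (by positivity) hDl
        have hpr := hV.pr_pos
        have hpr' := hP.pr_pos
        have hωX := hω0 X
        have hl := losDown_nonneg (P := P) (gbar := gbar M) X i
        -- Line-of-sight amplitudes involve no power, hence are untouched by the scaling.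
        have hlP : losDown (P.scale α ε γ M) (gbar M) X i = losDown P (gbar M) X i := rfl
        have heq : sinrDownApprox (P.scale α ε γ M) M X i
            / sinrDown (P.scale α ε γ M) (gbar M) X i
            = 1 + (P.scale α ε γ M).pr * (losDown P (gbar M) X i / M)
              / downDen (P.scale α ε γ M) X i := by
          rw [sinrDown_eq hV (hg.norm_sq M), sinrDownApprox, hlP]
          field_simp
        rw [heq]
        first
        | exact le_add_of_nonneg_right (by positivity)
        | gcongr
          exact div_rpow_le_self hP.pr_pos.le hε hM
    have := hinv.inv₀ one_ne_zero
    rw [inv_one] at this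
    exact this.congr fun M => inv_div _ _
  refine ((strongApprox_log_one_add ?_ hpos hR).const_mul (div_log_two_ne_zero hP)).congr
    (Eventually.of_forall fun M => (prelog_mul_logb _).symm)
    (Eventually.of_forall fun M => (prelog_mul_logb _).symm)
  filter_upwards [hpos, hR.eventually_const_lt one_pos] with M h1 h2
  rwa [div_pos_iff_of_pos_right h1] at h2

end Asymptotics

/-! ### The pair and its links -/

section Links

variable {N : ℕ} {P : Params N} {gbar : (M : ℕ) → Side → Fin N → Fin M → ℂ} {α ε γ : ℝ}

/-- The weight selecting the signal of one user. -/
def single (X Y : Side) : ℝ := if Y = X then 1 else 0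

lemma single_nonneg (X Y : Side) : 0 ≤ single X Y := by
  rw [single]; split_ifs <;> norm_num

lemma sum_single_mul (X : Side) (f : Side → ℝ) : ∑ Y, single X Y * f Y = f X := by
  simp [single]

lemma sum_single_pos (X : Side) : 0 < ∑ Y, single X Y := by
  simp [single]

lemma sum_one_pos : 0 < ∑ _X : Side, (1 : ℝ) := by
  rw [sum_side]; norm_num

lemma sigW_one {M : ℕ} (g : Side → Fin N → Fin M → ℂ) (i : Fin N) (s : Sample N M) :
    sigW P g (fun _ => 1) i s = sig P g Side.A i s + sig P g Side.B i s := by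
  simp only [sigW, sum_side, one_mul]

lemma sigW_single {M : ℕ} (g : Side → Fin N → Fin M → ℂ) (X : Side) (i : Fin N)
    (s : Sample N M) : sigW P g (single X) i s = sig P g X i s :=
  sum_single_mul X _

lemma R1Approx_eq (M : ℕ) (i : Fin N) :
    R1Approx P M i = P.prelog * Real.logb 2 (1 + sinrUp P M (fun _ => 1) i) := by
  simp only [R1Approx, sinrUp, sigLim, upDen, sum_side, one_mul, mul_add, mul_assoc]

lemma RUpApprox_eq (M : ℕ) (X : Side) (i : Fin N) :
    RUpApprox P M X i = P.prelog * Real.logb 2 (1 + sinrUp P M (single X) i) := by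
  rw [RUpApprox, sinrUp, sigLim, sum_single_mul, upDen, mul_assoc]

lemma RUpW_one {M : ℕ} (g : Side → Fin N → Fin M → ℂ) (i : Fin N) :
    RUpW P g (fun _ => 1) i = R1 P g i := by
  simp only [RUpW, sigW_one, R1]

lemma RUpW_single {M : ℕ} (g : Side → Fin N → Fin M → ℂ) (X : Side) (i : Fin N) :
    RUpW P g (single X) i = RUp P g X i := by
  simp only [RUpW, sigW_single, RUp]

lemma prelog_mul_logb_pos (hP : P.Valid) {x : ℝ} (hx : 0 < x) :
    0 < P.prelog * Real.logb 2 (1 + x) :=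
  mul_pos (prelog_pos hP) (Real.logb_pos one_lt_two (by linarith))

lemma sinrUp_pos (hP : P.Valid) {M : ℕ} (hM : 0 < M) {a : Side → ℝ} (ha : ∀ X, 0 ≤ a X)
    (ha' : 0 < ∑ X, a X) {i : Fin N} (hω : ∀ X, 0 < omega P X i) : 0 < sinrUp P M a i :=
  div_pos (mul_pos (Nat.cast_pos.2 hM) (sigLim_pos hP ha ha' hω)) (upDen_pos hP hω)

/-- Positivity of the closed forms is what lets relative errors pass through minima and sums. -/
lemma eventually_approx_pos (hP : P.Valid) (hγ : 0 ≤ γ) (hK : 0 < γ → ∀ X i, 0 < P.K X i)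
    (i : Fin N) :
    ∀ᶠ M : ℕ in atTop, 0 < R1Approx (P.scale α ε γ M) M i ∧
      ∀ X, 0 < RUpApprox (P.scale α ε γ M) M X i ∧ 0 < RDownApprox (P.scale α ε γ M) M X i := by
  obtain ⟨c, hc, hω⟩ := exists_le_omega_scale (α := α) (ε := ε) hP hγ hK i
  filter_upwards [eventually_gt_atTop 0] with M hM
  have hV := scale_valid (α := α) (ε := ε) (γ := γ) hP hM
  have hω0 : ∀ X, 0 < omega (P.scale α ε γ M) X i := fun X => hc.trans_le (hω M hM X i)
  refine ⟨?_, fun X => ⟨?_, prelog_mul_logb_pos hV (sinrDownApprox_pos hV hM X hω0)⟩⟩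
  · rw [R1Approx_eq]
    exact prelog_mul_logb_pos hV (sinrUp_pos hV hM (fun _ => zero_le_one) sum_one_pos hω0)
  · rw [RUpApprox_eq]
    exact prelog_mul_logb_pos hV (sinrUp_pos hV hM (single_nonneg X) (sum_single_pos X) hω0)

lemma strongApprox_R1 (hP : P.Valid) (hg : LineOfSight gbar) (hα : 0 < α) (hγ : 0 ≤ γ)
    (hK : 0 < γ → ∀ X i, 0 < P.K X i) (i : Fin N) :
    StrongApprox (fun M => R1 (P.scale α ε γ M) (gbar M) i)
      (fun M => R1Approx (P.scale α ε γ M) M i) := by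
  simpa only [RUpW_one, ← R1Approx_eq] using
    strongApprox_RUpW hP hg hα hγ hK i (fun _ => zero_le_one) sum_one_pos

lemma logApprox_R1 (hP : P.Valid) (hg : LineOfSight gbar) (hα : 0 ≤ α) (hγ : 0 ≤ γ)
    (hK : 0 < γ → ∀ X i, 0 < P.K X i) (i : Fin N) :
    LogApprox (fun M => R1 (P.scale α ε γ M) (gbar M) i)
      (fun M => R1Approx (P.scale α ε γ M) M i) := by
  rcases hα.eq_or_lt with rfl | hα
  · simpa only [RUpW_one, ← R1Approx_eq] using
      logApprox_RUpW hP hg hγ hK i (fun _ => zero_le_one) sum_one_pos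
  · exact (strongApprox_R1 hP hg hα hγ hK i).logApprox

lemma strongApprox_RUp (hP : P.Valid) (hg : LineOfSight gbar) (hα : 0 < α) (hγ : 0 ≤ γ)
    (hK : 0 < γ → ∀ X i, 0 < P.K X i) (X : Side) (i : Fin N) :
    StrongApprox (fun M => RUp (P.scale α ε γ M) (gbar M) X i)
      (fun M => RUpApprox (P.scale α ε γ M) M X i) := by
  simpa only [RUpW_single, ← RUpApprox_eq] using
    strongApprox_RUpW hP hg hα hγ hK i (single_nonneg X) (sum_single_pos X)

lemma logApprox_RUp (hP : P.Valid) (hg : LineOfSight gbar) (hα : 0 ≤ α) (hγ : 0 ≤ γ)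
    (hK : 0 < γ → ∀ X i, 0 < P.K X i) (X : Side) (i : Fin N) :
    LogApprox (fun M => RUp (P.scale α ε γ M) (gbar M) X i)
      (fun M => RUpApprox (P.scale α ε γ M) M X i) := by
  rcases hα.eq_or_lt with rfl | hα
  · simpa only [RUpW_single, ← RUpApprox_eq] using
      logApprox_RUpW hP hg hγ hK i (single_nonneg X) (sum_single_pos X)
  · exact (strongApprox_RUp hP hg hα hγ hK X i).logApprox

lemma strongApprox_R1Mean (hP : P.Valid) (hg : LineOfSight gbar) (hα : 0 ≤ α) (hγ : 0 ≤ γ)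
    (hK : 0 < γ → ∀ X i, 0 < P.K X i) (i : Fin N) :
    StrongApprox (fun M => R1Mean (P.scale α ε γ M) (gbar M) i)
      (fun M => R1Approx (P.scale α ε γ M) M i) := by
  simpa only [sigW_one, R1Mean, ← R1Approx_eq] using
    strongApprox_meanUp hP hg hα hγ hK i (fun _ => zero_le_one) sum_one_pos

lemma strongApprox_RUpMean (hP : P.Valid) (hg : LineOfSight gbar) (hα : 0 ≤ α) (hγ : 0 ≤ γ)
    (hK : 0 < γ → ∀ X i, 0 < P.K X i) (X : Side) (i : Fin N) :
    StrongApprox (fun M => RUpMean (P.scale α ε γ M) (gbar M) X i)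
      (fun M => RUpApprox (P.scale α ε γ M) M X i) := by
  simpa only [sigW_single, RUpMean, ← RUpApprox_eq] using
    strongApprox_meanUp hP hg hα hγ hK i (single_nonneg X) (sum_single_pos X)

end Links

end TwoWayRelay

end

/-! ### Assembly of the links into the efficiency of the pair. -/

open TwoWayRelay in
theorem theorem1 {N : ℕ} (P : Params N) (hP : P.Valid)
    (gbar : (M : ℕ) → Side → Fin N → Fin M → ℂ) (hg : LineOfSight gbar)
    (α ε γ : ℝ) (hα : 0 ≤ α) (hε : 0 ≤ ε) (hγ : 0 ≤ γ)
    (hK : 0 < γ → ∀ X i, 0 < P.K X i) (i : Fin N) :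
    -- the spectral efficiency of the pair
    LogApprox (fun M => R (P.scale α ε γ M) (gbar M) i)
      (fun M => RApprox (P.scale α ε γ M) M i) ∧
    (0 < α → StrongApprox (fun M => R (P.scale α ε γ M) (gbar M) i)
      (fun M => RApprox (P.scale α ε γ M) M i)) ∧
    -- its uplink and downlink parts
    LogApprox (fun M => R1 (P.scale α ε γ M) (gbar M) i)
      (fun M => R1Approx (P.scale α ε γ M) M i) ∧
    (0 < α → StrongApprox (fun M => R1 (P.scale α ε γ M) (gbar M) i)
      (fun M => R1Approx (P.scale α ε γ M) M i)) ∧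
    LogApprox (fun M => R2 (P.scale α ε γ M) (gbar M) i)
      (fun M => R2Approx (P.scale α ε γ M) M i) ∧
    (0 < α → StrongApprox (fun M => R2 (P.scale α ε γ M) (gbar M) i)
      (fun M => R2Approx (P.scale α ε γ M) M i)) ∧
    -- the links between each user and the relay
    (∀ X : Side,
      LogApprox (fun M => RUp (P.scale α ε γ M) (gbar M) X i)
        (fun M => RUpApprox (P.scale α ε γ M) M X i) ∧
      (0 < α → StrongApprox (fun M => RUp (P.scale α ε γ M) (gbar M) X i)
        (fun M => RUpApprox (P.scale α ε γ M) M X i)) ∧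
      StrongApprox (fun M => RDown (P.scale α ε γ M) (gbar M) X i)
        (fun M => RDownApprox (P.scale α ε γ M) M X i)) ∧
    -- the uplink expressions with expected signal and expected interference
    StrongApprox (fun M => R1Mean (P.scale α ε γ M) (gbar M) i)
      (fun M => R1Approx (P.scale α ε γ M) M i) ∧
    (∀ X : Side, StrongApprox (fun M => RUpMean (P.scale α ε γ M) (gbar M) X i)
      (fun M => RUpApprox (P.scale α ε γ M) M X i)) := by
  have hpos := eventually_approx_pos (α := α) (ε := ε) hP hγ hK i
  have hp1 := hpos.mono fun _ h => h.1
  have hpU := fun X => hpos.mono fun _ h => (h.2 X).1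
  have hpD := fun X => hpos.mono fun _ h => (h.2 X).2
  have hpm : ∀ X Y, ∀ᶠ M : ℕ in atTop, 0 < min (RUpApprox (P.scale α ε γ M) M X i)
      (RDownApprox (P.scale α ε γ M) M Y i) := fun X Y =>
    ((hpU X).and (hpD Y)).mono fun _ h => lt_min h.1 h.2
  have hp2 : ∀ᶠ M : ℕ in atTop, 0 < R2Approx (P.scale α ε γ M) M i :=
    ((hpm _ _).and (hpm _ _)).mono fun _ h => add_pos h.1 h.2
  -- The downlink is strongly approximated for all exponents, so the uplink alone decides which mode
  -- holds for `R2` and `R`.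
  have hD := fun X => strongApprox_RDown (α := α) hP hg hε hγ hK X i
  have h1 := logApprox_R1 (ε := ε) hP hg hα hγ hK i
  have hU := fun X => logApprox_RUp (ε := ε) hP hg hα hγ hK X i
  have h2 : LogApprox (fun M => R2 (P.scale α ε γ M) (gbar M) i)
      (fun M => R2Approx (P.scale α ε γ M) M i) :=
    ((hU _).min (hD _).logApprox (hpU _) (hpD _)).add
      ((hU _).min (hD _).logApprox (hpU _) (hpD _)) (hpm _ _) (hpm _ _)
  have h1' := fun hα => strongApprox_R1 (α := α) (ε := ε) hP hg hα hγ hK i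
  have hU' := fun hα X => strongApprox_RUp (α := α) (ε := ε) hP hg hα hγ hK X i
  have h2' : 0 < α → StrongApprox (fun M => R2 (P.scale α ε γ M) (gbar M) i)
      (fun M => R2Approx (P.scale α ε γ M) M i) := fun hα =>
    ((hU' hα _).min (hD _) (hpU _) (hpD _)).add
      ((hU' hα _).min (hD _) (hpU _) (hpD _)) (hpm _ _) (hpm _ _)
  exact ⟨h1.min h2 hp1 hp2, fun hα => (h1' hα).min (h2' hα) hp1 hp2, h1, h1', h2, h2',
    fun X => ⟨hU X, fun hα => hU' hα X, hD X⟩, strongApprox_R1Mean hP hg hα hγ hK i,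
    fun X => strongApprox_RUpMean hP hg hα hγ hK X i⟩
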